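/- \textbf{Setting.} Alphabets are finite. A deterministic two-way transducer (2DFT) has a finite state set $P$, an initial state, final states, and a partial transition function $P\times(A\uplus\{\vdash,\dashv\})\to B^*\times P\times\{-1,0,+1\}$ that never moves left on $\vdash$ or right on $\dashv$; on $\vdash u\dashv$ it starts at $\vdash$ and accepts when it first reaches $\dashv$ in a final state. For $x,y\in\{\ell,r\}$, $\mathrm{bh}_{xy}(u)$ is the set of pairs $(p,q)$ such that a run over $u$ enters $u$ on side $x$ in state $p$ and exits on side $y$ in state $q$; its transition monoid is the quotient of $A^*$ by equality of the four behaviours. A streaming string transducer (SST) is a deterministic one-way automaton with states $Q$, initial state $q_0$ and partial transition function $\delta$, with a finite set $\mathcal X$ of variables, a substitution $\rho(q,a):\mathcal X\to(B\cup\mathcal X)^*$ for each transition, and a partial output function $F$ from final states to $(B\cup\mathcal X)^*$. A run $r$ from $q$ on $a_1\cdots a_n$ induces the substitution $\sigma_r$ obtained by composing the successive updates, $\sigma_{rr'}(X)=\hat\sigma_r(\sigma_{r'}(X))$, and the output on $u$ is obtained from $\hat\sigma_r(F(q_n))$, where $r$ is the run on $u$ from $q_0$ to $q_n$, by erasing variables.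 The SST is 1-bounded if for every run $r$ (from any state) and all variables $X,Y$, $X$ occurs at most once in $\sigma_r(Y)$. Its flow transition monoid consists of the matrices $m_u$ $(u\in A^*)$ where $m_u[p,X][q,Y]$ is the number of occurrences of $X$ in $\sigma_r(Y)$ if there is a run $r$ on $u$ from $p$ to $q$, and $\bot$ otherwise. A machine is aperiodic if its transition monoid (for an SST: its flow transition monoid) $M$ satisfies: there is $n$ with $z^n=z^{n+1}$ for all $z\in M$. \textbf{Construction.} Given an SST $T$, let $\mathcal T$ be the 2DFT obtained by composing the following three transducers (below, $u\in B^*$). (1) A left-to-right sequential transducer annotating each letter, and $\dashv$, with the state $q$ of $T$ before reading it. (2) A right-to-left sequential transducer annotating each letter with the set $S$ of useful variables after it: it starts at $(\dashv,q)$ with the set of variables of $F(q)$, and on $(a,q)$ passes from $S$ to $\{X : X \text{ occurs in } \rho(q,a)(Y)\text{ for some }Y\in S\}$. (3) A two-way machine with states $p_0$ (initial), $f$ (final), $(X,i)$ and $(X,o)$ for $X\in\mathcal X$. In $p_0$ it moves right until $(\dashv,q)$; there, if $F(q)$ starts with $uX$ it outputs $u$ and moves left in state $(X,i)$, and if $F(q)\in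 B^*$ it outputs $F(q)$ and goes to $f$. In $(X,i)$ on $(a,q,S)$: if $\rho(q,a)(X)=u\in B^*$ it outputs $u$ and moves right in $(X,o)$; if $\rho(q,a)(X)$ starts with $uY$ it outputs $u$ and moves left in $(Y,i)$. In $(X,i)$ on $\vdash$ it moves right in $(X,o)$. In $(X,o)$ on $(a,q,S)$: let $Y$ be the unique element of $S$ such that $X$ occurs in $\rho(q,a)(Y)$ (the machine is blocked if there is no unique one); if $X$ is followed by $u$ and then the end of $\rho(q,a)(Y)$, it outputs $u$ and moves right in $(Y,o)$; if $X$ is followed by $uX'$, it outputs $u$ and moves left in $(X',i)$. In $(X,o)$ on $(\dashv,q)$ it acts in the same way with $F(q)$ (at the first occurrence of $X$), going to $f$ if no variable follows $X$. In all cases not listed it is blocked, in particular where $F(q)$ or the transition of $T$ is undefined. The composition of a two-way machine with a sequential left-to-right transducer with partial transition function $\eta$ on its states simulates the former while storing the state $s$ of the latter at the current cell. Right moves apply $\eta$. After a left move, the previous state $r$ is recovered by maintaining the partial function $h$ that sends a state to the candidate for $r$ it leads to, while moving left until exactly one candidate remains; the head then comes back to the cell by following two runs, started from states with distinct images under the last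 $h$ having several candidates, until they merge. The composition with a right-to-left transducer is the mirror image, preceded by a move to the right end and a sweep back to $\vdash$ that computes the annotation. \textbf{Theorem.} Let $T$ be an aperiodic 1-bounded SST with at least one variable. Then the 2DFT $\mathcal T$ built from $T$ is aperiodic. Moreover $\mathcal T$ realizes the same function as $T$ whenever 1-boundedness is also respected by the output function, i.e. whenever, for every suffix $r$ of an accepting run, with final state $q$, each variable occurs at most once in $\hat\sigma_r(F(q))$. -/

import Mathlib

universe u v w

/-! ## Two-way machines -/

/-- Tape symbols: the letters of `A` and the two endmarkers `⊢` (`lend`) and `⊣` (`rend`). -/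
inductive TapeSym (A : Type u) : Type u
  | lend : TapeSym A
  | letter : A → TapeSym A
  | rend : TapeSym A

/-- Head moves `-1`, `0`, `+1`. -/
inductive HeadMove : Type
  | left : HeadMove
  | stay : HeadMove
  | right : HeadMove

def HeadMove.toInt : HeadMove → ℤ
  | .left => -1
  | .stay => 0
  | .right => 1

def HeadMove.mirror : HeadMove → HeadMove
  | .left => .right
  | .stay => .stay
  | .right => .left

/-- A deterministic (partial) two-way transition function with states `P` reading symbols of `Γ`
and producing words over `B`. -/
abbrev TwoWayStep (Γ : Type u) (B : Type v) (P : Type w) := P → Γ → Option (List B × P × HeadMove)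

/-- The symbol in cell `i` of `x`; cells are numbered from `0`, and cells outside `x` are
undefined. -/
def cellAt {Γ : Type u} (x : List Γ) (i : ℤ) : Option Γ :=
  if 0 ≤ i then x[i.toNat]? else none

/-- `TwoWayRun δ x halt c y c'`: there is a run of `δ` over `x` from configuration `c` to
configuration `c'` producing `y`, in which no configuration before the last one is in `halt`.
No transition can be fired from a position outside `x`. -/
inductive TwoWayRun {Γ : Type u} {B : Type v} {P : Type w} (δ : TwoWayStep Γ B P) (x : List Γ)
    (halt : P × ℤ → Prop) : P × ℤ → List B → P × ℤ → Prop
  | refl (c : P × ℤ) : TwoWayRun δ x halt c [] c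
  | head {p p' : P} {i : ℤ} {a : Γ} {y y' : List B} {d : HeadMove} {c : P × ℤ}
      (hhalt : ¬ halt (p, i)) (ha : cellAt x i = some a) (hδ : δ p a = some (y, p', d))
      (h : TwoWayRun δ x halt (p', i + d.toInt) y' c) : TwoWayRun δ x halt (p, i) (y ++ y') c

/-- Deterministic two-way finite state transducers with input alphabet `A` and output
alphabet `B`. -/
structure TwoDFT (A : Type u) (B : Type v) where
  State : Type w
  finite_state : Finite State
  init : State
  final : Set State
  step : TwoWayStep (TapeSym A) B State
  no_left : ∀ p y p', step p .lend ≠ some (y, p', .left)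
  no_right : ∀ p y p', step p .rend ≠ some (y, p', .right)

/-- The `n`-th power of a word. -/
def wordPow {A : Type u} (x : List A) (n : ℕ) : List A := (List.replicate n x).flatten

namespace TwoDFT

variable {A : Type u} {B : Type v} (M : TwoDFT.{u, v, w} A B)

/-- `(x, y)` belongs to the transduction of `M`: on the tape `⊢ x ⊣`, the run of `M` from its
initial state at `⊢` reaches `⊣` in a final state, and has produced `y` when it does so for the
first time. -/
def Realizes (x : List A) (y : List B) : Prop :=
  ∃ q ∈ M.final,
    TwoWayRun M.step (TapeSym.lend :: (x.map TapeSym.letter ++ [TapeSym.rend]))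
      (fun c => c.1 ∈ M.final ∧ c.2 = x.length + 1) (M.init, 0) y (q, x.length + 1)

/-- The two ends of a word. -/
inductive Side : Type
  | left : Side
  | right : Side

/-- Position at which a word of length `n` is entered from a side. -/
def Side.entry (n : ℕ) : Side → ℤ
  | .left => 0
  | .right => n - 1

/-- Position reached when a word of length `n` is exited on a side. -/
def Side.exit (n : ℕ) : Side → ℤ
  | .left => -1
  | .right => n

/-- The behaviour `bh_{st}(x)`: the pairs `(p, q)` such that there is a run over `x` that enters
`x` on side `s` in state `p` and exits it on side `t` in state `q`. For the empty word this is the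
identity if `s ≠ t` and empty if `s = t`. -/
def bh (s t : Side) (x : List A) : Set (M.State × M.State) :=
  {pq | ∃ y, TwoWayRun M.step (x.map TapeSym.letter) (fun _ => False)
    (pq.1, s.entry x.length) y (pq.2, t.exit x.length)}

/-- The congruence `∼` on words whose quotient is the transition monoid of `M`. -/
def TransEquiv (x x' : List A) : Prop := ∀ s t : Side, M.bh s t x = M.bh s t x'

/-- The transition monoid of `M`, i.e. the quotient of the free monoid by `TransEquiv`, satisfies
`z ^ n = z ^ (n + 1)` for some `n` and all its elements `z`. -/
def Aperiodic : Prop :=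
  ∃ n : ℕ, ∀ x : List A, M.TransEquiv (wordPow x n) (wordPow x (n + 1))

end TwoDFT

/-! ## Streaming string transducers -/

/-- Substitutions of variables in `X` by words over variables and letters of `B`. -/
abbrev VarSubst (X : Type u) (B : Type v) := X → List (X ⊕ B)

namespace VarSubst

variable {X : Type u} {B : Type v}

/-- The extension of a substitution to words. -/
def ext (σ : VarSubst X B) (y : List (X ⊕ B)) : List (X ⊕ B) :=
  y.flatMap (Sum.elim σ (fun b => [Sum.inr b]))

protected def one : VarSubst X B := fun x => [Sum.inl x]

protected def comp (σ τ : VarSubst X B) : VarSubst X B := fun x => σ.ext (τ x)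

end VarSubst

open Classical in
/-- Number of occurrences of the variable `x` in `y`. -/
noncomputable def varCount {X : Type u} {B : Type v} (x : X) (y : List (X ⊕ B)) : ℕ :=
  (y.filterMap Sum.getLeft?).count x

/-- Deterministic streaming string transducers. The transition function `δ` and the variable
update `ρ : δ → substitutions` are given together by `step`. -/
structure SST (A : Type u) (B : Type v) where
  State : Type w
  Var : Type w
  finite_state : Finite State
  finite_var : Finite Var
  init : State
  final : Set State
  step : State → A → Option (State × VarSubst Var B)
  /-- The partial output function, defined on final states only. -/
  out : State → Option (List (Var ⊕ B))
  out_final : ∀ q y, out q = some y → q ∈ final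

namespace SST

variable {A : Type u} {B : Type v} (T : SST.{u, v, w} A B)

/-- The state reached by the run from `p` over a word and the substitution this run induces,
if there is such a run. -/
def run : T.State → List A → Option (T.State × VarSubst T.Var B)
  | p, [] => some (p, VarSubst.one)
  | p, a :: x =>
    (T.step p a).bind fun s => (run s.1 x).map fun r => (r.1, VarSubst.comp s.2 r.2)

/-- `(x, y)` belongs to the transduction of `T`: all variables start with the empty word. -/
def Realizes (x : List A) (y : List B) : Prop :=
  ∃ q σ f, T.run T.init x = some (q, σ) ∧ q ∈ T.final ∧ T.out q = some f ∧
    y = (VarSubst.ext σ f).filterMap Sum.getRight?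

/-- All runs induce `k`-linear substitutions. -/
def IsBounded (k : ℕ) : Prop :=
  ∀ p x q σ, T.run p x = some (q, σ) → ∀ X Y, varCount X (σ Y) ≤ k

/-- The output function respects 1-boundedness: along every accepting run, the substitution
`σ` induced by any suffix of the run sends the final output expression to a word in which each
variable occurs at most once. -/
def OutputLinear : Prop :=
  ∀ x₀ p σ₀ x q σ f, T.run T.init x₀ = some (p, σ₀) → T.run p x = some (q, σ) →
    T.out q = some f → ∀ X, varCount X (VarSubst.ext σ f) ≤ 1

open Classical in
/-- The image of a word in the flow transition monoid: the entry `[p, X][q, Y]` is `⊥` if there is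
no run from `p` to `q`, and otherwise the number of occurrences of `X` in `σ(Y)`, for `σ` induced
by this run. -/
noncomputable def flow (x : List A) : Matrix (T.State × T.Var) (T.State × T.Var) (WithBot ℕ) :=
  fun pX qY => match T.run pX.1 x with
    | some (q, σ) => if q = qY.1 then ((varCount pX.2 (σ qY.2) : ℕ) : WithBot ℕ) else ⊥
    | none => ⊥

/-- The flow transition monoid (the image of `flow`, in which the image of a concatenation is the
product) satisfies `z ^ n = z ^ (n + 1)` for some `n` and all its elements `z`. -/
def Aperiodic : Prop :=
  ∃ n : ℕ, ∀ x : List A, T.flow (wordPow x n) = T.flow (wordPow x (n + 1))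

end SST

/-! ## Composition of a two-way machine with a sequential transducer

A letter-to-letter sequential transducer that annotates each cell with its current state is given
by a partial transition function `δ : Q → Γ → Option Q`. -/

/-- States of the composition. In `sim p q`, the two-way machine is in state `p` and the annotation
of the current cell is `q`. In `prev p q`, the head has just moved left towards the cell (the
target) where the two-way machine is to be in state `p`; `q` is the annotation of the cell on the
right of the target. In `back p h`, the head is on the left of the target; `h` maps each state in
the cell to the right of the head to the candidate annotation of the target it leads to. In
`fwd p r s t`, the annotation `r` of the target is known and the head returns to the target, the
unique cell where the runs from `s` and `t` merge. -/
inductive CompState (P : Type u) (Q : Type v) : Type (max u v)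
  | sim : P → Q → CompState P Q
  | prev : P → Q → CompState P Q
  | back : P → (Q → Option Q) → CompState P Q
  | fwd : P → Q → Q → Q → CompState P Q

instance CompState.instFinite {P : Type u} {Q : Type v} [Finite P] [Finite Q] :
    Finite (CompState P Q) := by
  let f : CompState P Q → ((P × Q) ⊕ (P × Q)) ⊕ ((P × (Q → Option Q)) ⊕ (P × Q × Q × Q)) :=
    fun c => match c with
      | .sim p q => .inl (.inl (p, q))
      | .prev p q => .inl (.inr (p, q))
      | .back p h => .inr (.inl (p, h))
      | .fwd p r s t => .inr (.inr (p, r, s, t))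
  apply Finite.of_injective f
  rintro (⟨_, _⟩ | ⟨_, _⟩ | ⟨_, _⟩ | ⟨_, _, _, _⟩) (⟨_, _⟩ | ⟨_, _⟩ | ⟨_, _⟩ | ⟨_, _, _, _⟩) hh <;>
    simp_all [f]

/-- The values taken by a partial function. -/
def candidates {Q : Type u} (h : Q → Option Q) : Set Q := {r | ∃ s, h s = some r}

open Classical in
/-- The states `s` before reading `a` such that reading `a` leads to `q`, as candidates for
themselves. -/
noncomputable def initCand {Γ : Type u} {Q : Type v} (δ : Q → Γ → Option Q) (q : Q) (a : Γ) :
    Q → Option Q :=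
  fun s => if δ s a = some q then some s else none

/-- Propagation of candidates one cell to the left. -/
def stepCand {Γ : Type u} {Q : Type v} (δ : Q → Γ → Option Q) (h : Q → Option Q) (a : Γ) :
    Q → Option Q :=
  fun s => (δ s a).bind h

open Classical in
/-- Composition of a two-way machine `C`, reading annotated symbols, with the left-to-right
sequential annotation by `δ`. When `C` moves left, the previous annotation is recovered by moving
left until one candidate remains and coming back. -/
noncomputable def compStep {Γ : Type u} {Q : Type v} {P : Type w} {B : Type*}
    (δ : Q → Γ → Option Q) (C : TwoWayStep (Γ × Q) B P) : TwoWayStep Γ B (CompState P Q)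
  | .sim p q, a => match C p (a, q) with
    | none => none
    | some (y, p', .stay) => some (y, .sim p' q, .stay)
    | some (y, p', .right) => (δ q a).map fun q' => (y, .sim p' q', .right)
    | some (y, p', .left) => some (y, .prev p' q, .left)
  | .prev p q, a =>
    let h := initCand δ q a
    if hr : ∃ r, candidates h = {r} then some ([], .sim p hr.choose, .stay)
    else if (candidates h).Nontrivial then some ([], .back p h, .left)
    else none
  | .back p h, a =>
    let h' := stepCand δ h a
    if hr : ∃ r, candidates h' = {r} then
      if hst : ∃ st : Q × Q, ∃ r₁ r₂, h st.1 = some r₁ ∧ h st.2 = some r₂ ∧ r₁ ≠ r₂ then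
        some ([], .fwd p hr.choose hst.choose.1 hst.choose.2, .right)
      else none
    else if (candidates h').Nontrivial then some ([], .back p h', .left)
    else none
  | .fwd p r s t, a => match δ s a, δ t a with
    | some s', some t' =>
      if s' = t' then some ([], .sim p r, .stay) else some ([], .fwd p r s' t', .right)
    | _, _ => none

/-- Exchange of left and right. -/
def mirrorStep {Γ : Type u} {B : Type v} {P : Type w} (C : TwoWayStep Γ B P) : TwoWayStep Γ B P :=
  fun p a => (C p a).map fun r => (r.1, r.2.1, r.2.2.mirror)

/-- States for the composition with a right-to-left sequential transducer: the head first goes to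
the right end (`toEnd`), comes back to the left end computing the annotation (`toStart`), and then
performs the proper simulation (`run`). -/
inductive ScanState (P : Type u) (Q : Type v) : Type (max u v)
  | toEnd : ScanState P Q
  | toStart : Q → ScanState P Q
  | run : CompState P Q → ScanState P Q

instance ScanState.instFinite {P : Type u} {Q : Type v} [Finite P] [Finite Q] :
    Finite (ScanState P Q) := by
  let f : ScanState P Q → Option (Q ⊕ CompState P Q) :=
    fun c => match c with
      | .toEnd => none
      | .toStart q => some (.inl q)
      | .run c => some (.inr c)
  apply Finite.of_injective f
  rintro (_ | _ | _) (_ | _ | _) hh <;> simp_all [f]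

/-- Composition of a two-way machine `C` with initial state `p₀` with the right-to-left sequential
annotation by `δ` with initial state `ι`, on a tape with endmarkers whose symbols carry a first
annotation in `R`. -/
noncomputable def compStepRL {A : Type*} {R : Type*} {Q : Type v} {P : Type w} {B : Type*}
    (δ : Q → TapeSym A × R → Option Q) (ι : Q) (C : TwoWayStep ((TapeSym A × R) × Q) B P) (p₀ : P) :
    TwoWayStep (TapeSym A × R) B (ScanState P Q)
  | .toEnd, (.rend, _) => some ([], .toStart ι, .stay)
  | .toEnd, _ => some ([], .toEnd, .right)
  | .toStart s, (.lend, _) => some ([], .run (.sim p₀ s), .stay)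
  | .toStart s, a => (δ s a).map fun s' => ([], .toStart s', .left)
  | .run c, a =>
    (mirrorStep (compStep δ (mirrorStep C)) c a).map fun r => (r.1, .run r.2.1, r.2.2)

theorem compStep_no_left {Γ : Type u} {Q : Type v} {P : Type w} {B : Type*}
    (δ : Q → Γ → Option Q) (C : TwoWayStep (Γ × Q) B P) (a : Γ)
    (hC : ∀ p q y p', C p (a, q) ≠ some (y, p', .left))
    (hδ : ∀ s s' t t', δ s a = some t → δ s' a = some t' → s = s') (c y c') :
    compStep δ C c a ≠ some (y, c', .left) := by
  intro hc
  cases c with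
  | sim p q =>
    simp only [compStep] at hc
    split at hc <;> simp_all
  | prev p q =>
    simp only [compStep] at hc
    split_ifs at hc with h1 h2
    · simp at hc
    · obtain ⟨r₁, ⟨s₁, h₁⟩, r₂, ⟨s₂, h₂⟩, hne⟩ := h2
      simp only [initCand] at h₁ h₂
      split_ifs at h₁ h₂ with e1 e2
      have := hδ _ _ _ _ e1 e2
      simp_all
  | back p h =>
    simp only [compStep] at hc
    split_ifs at hc with h1 h2 h3
    · simp at hc
    · obtain ⟨r₁, ⟨s₁, h₁⟩, r₂, ⟨s₂, h₂⟩, hne⟩ := h3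
      simp only [stepCand, Option.bind_eq_some_iff] at h₁ h₂
      obtain ⟨t₁, e1, f1⟩ := h₁
      obtain ⟨t₂, e2, f2⟩ := h₂
      have := hδ _ _ _ _ e1 e2
      simp_all
  | fwd p r s t =>
    simp only [compStep] at hc
    split at hc
    · split_ifs at hc <;> simp at hc
    · simp at hc

theorem compStep_no_right {Γ : Type u} {Q : Type v} {P : Type w} {B : Type*}
    (δ : Q → Γ → Option Q) (C : TwoWayStep (Γ × Q) B P) (a : Γ)
    (hδ : ∀ s, δ s a = none) (c y c') :
    compStep δ C c a ≠ some (y, c', .right) := by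
  intro hc
  cases c with
  | sim p q =>
    simp only [compStep] at hc
    split at hc <;> simp_all
  | prev p q =>
    simp only [compStep] at hc
    split_ifs at hc <;> simp at hc
  | back p h =>
    have h0 : candidates (stepCand δ h a) = ∅ := by
      ext r; simp [candidates, stepCand, hδ]
    have h1 : ¬ ∃ r, candidates (stepCand δ h a) = {r} := by
      rw [h0]; rintro ⟨r, hr⟩; exact Set.singleton_ne_empty r hr.symm
    simp only [compStep, dif_neg h1] at hc
    split_ifs at hc
    simp at hc
  | fwd p r s t => simp [compStep, hδ] at hc

theorem mirrorStep_eq_some {Γ : Type u} {B : Type v} {P : Type w} {C : TwoWayStep Γ B P}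
    {p : P} {a : Γ} {y : List B} {p' : P} {d : HeadMove}
    (h : mirrorStep C p a = some (y, p', d)) : C p a = some (y, p', d.mirror) := by
  simp only [mirrorStep, Option.map_eq_some_iff] at h
  obtain ⟨⟨y', p'', d'⟩, h, e⟩ := h
  simp only [Prod.mk.injEq] at e
  obtain ⟨rfl, rfl, rfl⟩ := e
  cases d' <;> exact h

/-! ## From streaming string transducers to two-way transducers -/

/-- The letters before the first variable of a word, and this variable if there is one. -/
def leading {X : Type u} {B : Type v} : List (X ⊕ B) → List B × Option X
  | [] => ([], none)
  | .inl x :: _ => ([], some x)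
  | .inr b :: y => (b :: (leading y).1, (leading y).2)

open Classical in
/-- The part of a word after the first occurrence of the variable `x`. -/
noncomputable def afterVar {X : Type u} {B : Type v} (x : X) : List (X ⊕ B) → List (X ⊕ B)
  | [] => []
  | .inl z :: y => if z = x then y else afterVar x y
  | .inr _ :: y => afterVar x y

/-- States of the machine that follows the output structure: `start`, the states `(X, i)` and
`(X, o)` (`inn X` and `out X`), and `fin`. -/
inductive FollowState (X : Type u) : Type u
  | start : FollowState X
  | inn : X → FollowState X
  | out : X → FollowState X
  | fin : FollowState X

instance FollowState.instFinite {X : Type u} [Finite X] : Finite (FollowState X) := by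
  let f : FollowState X → Option (Option (X ⊕ X)) :=
    fun c => match c with
      | .start => none
      | .fin => some none
      | .inn x => some (some (.inl x))
      | .out x => some (some (.inr x))
  apply Finite.of_injective f
  rintro (_ | _ | _ | _) (_ | _ | _ | _) hh <;> simp_all [f]

namespace SST

variable {A : Type u} {B : Type v} (T : SST.{u, v, w} A B)

/-- First sequential transducer, left-to-right: each cell is annotated with the state of `T` before
reading it. The state `none` is used before reading `⊢`. -/
def stateAnn : Option T.State → TapeSym A → Option (Option T.State)
  | none, .lend => some (some T.init)
  | some q, .letter a => (T.step q a).map fun s => some s.1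
  | _, _ => none

/-- Second sequential transducer, right-to-left: each cell is annotated with the set of variables
that are useful after reading it. The state `none` is used before reading `⊣`. -/
def usefulAnn : Option (Set T.Var) → TapeSym A × Option T.State → Option (Option (Set T.Var))
  | none, (.rend, some q) => (T.out q).map fun f => some {X | Sum.inl X ∈ f}
  | some S, (.letter a, some q) =>
    (T.step q a).map fun s => some {X | ∃ Y ∈ S, Sum.inl X ∈ s.2 Y}
  | _, _ => none

open Classical in
/-- Third transducer, two-way: it reads the annotated word and follows the output structure. -/
noncomputable def followStep :
    TwoWayStep ((TapeSym A × Option T.State) × Option (Set T.Var)) B (FollowState T.Var)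
  | .start, ((.rend, some q), _) => (T.out q).map fun f => match leading f with
    | (y, none) => (y, .fin, .stay)
    | (y, some X) => (y, .inn X, .left)
  | .start, ((.rend, none), _) => none
  | .start, _ => some ([], .start, .right)
  | .inn X, ((.lend, _), _) => some ([], .out X, .right)
  | .inn X, ((.letter a, some q), _) => (T.step q a).map fun s => match leading (s.2 X) with
    | (y, none) => (y, .out X, .right)
    | (y, some Y) => (y, .inn Y, .left)
  | .out X, ((.letter a, some q), some S) => (T.step q a).bind fun s =>
    if hY : ∃! Y, Y ∈ S ∧ Sum.inl X ∈ s.2 Y then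
      match leading (afterVar X (s.2 hY.choose)) with
      | (y, none) => some (y, .out hY.choose, .right)
      | (y, some X') => some (y, .inn X', .left)
    else none
  | .out X, ((.rend, some q), _) => (T.out q).bind fun f =>
    if Sum.inl X ∈ f then
      match leading (afterVar X f) with
      | (y, none) => some (y, .fin, .stay)
      | (y, some X') => some (y, .inn X', .left)
    else none
  | _, _ => none

/-- States of the composition of the three transducers. -/
abbrev BuiltState : Type w :=
  CompState (ScanState (FollowState T.Var) (Option (Set T.Var))) (Option T.State)

/-- The third transducer composed with the second one. -/
noncomputable def midStep : TwoWayStep (TapeSym A × Option T.State) B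
    (ScanState (FollowState T.Var) (Option (Set T.Var))) :=
  compStepRL T.usefulAnn none T.followStep .start

/-- The composition of the three transducers. -/
noncomputable def builtStep : TwoWayStep (TapeSym A) B T.BuiltState :=
  compStep T.stateAnn T.midStep

theorem followStep_no_left (p) (q : Option T.State) (S : Option (Set T.Var)) (y p') :
    T.followStep p ((.lend, q), S) ≠ some (y, p', .left) := by
  cases p <;> simp [followStep]

theorem followStep_no_right (p) (q : Option T.State) (S : Option (Set T.Var)) (y p') :
    T.followStep p ((.rend, q), S) ≠ some (y, p', .right) := by
  intro h
  cases p <;> cases q <;> simp only [followStep, reduceCtorEq] at h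
  · simp only [Option.map_eq_some_iff] at h
    obtain ⟨f, -, h⟩ := h
    split at h <;> simp at h
  · simp only [Option.bind_eq_some_iff] at h
    obtain ⟨f, -, h⟩ := h
    split_ifs at h
    split at h <;> simp at h

theorem midStep_no_left (p) (q : Option T.State) (y p') :
    T.midStep p (.lend, q) ≠ some (y, p', .left) := by
  intro h
  rcases p with _ | s | c
  · simp [midStep, compStepRL] at h
  · simp [midStep, compStepRL] at h
  · simp only [midStep, compStepRL, Option.map_eq_some_iff] at h
    obtain ⟨⟨y', c', d⟩, h, e⟩ := h
    simp only [Prod.mk.injEq] at e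
    obtain ⟨rfl, rfl, rfl⟩ := e
    refine compStep_no_right _ _ _ (fun s => ?_) _ _ _ (mirrorStep_eq_some h)
    cases s <;> simp [usefulAnn]

theorem midStep_no_right (p) (q : Option T.State) (y p') :
    T.midStep p (.rend, q) ≠ some (y, p', .right) := by
  intro h
  rcases p with _ | s | c
  · simp [midStep, compStepRL] at h
  · simp [midStep, compStepRL] at h
  · simp only [midStep, compStepRL, Option.map_eq_some_iff] at h
    obtain ⟨⟨y', c', d⟩, h, e⟩ := h
    simp only [Prod.mk.injEq] at e
    obtain ⟨rfl, rfl, rfl⟩ := e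
    refine compStep_no_left _ _ _ (fun p S y p' h => ?_) (fun s s' t t' hs hs' => ?_) _ _ _
      (mirrorStep_eq_some h)
    · exact T.followStep_no_right _ _ _ _ _ (mirrorStep_eq_some h)
    · cases s <;> cases s' <;> simp_all [usefulAnn]

theorem builtStep_no_left (p : T.BuiltState) (y p') :
    T.builtStep p .lend ≠ some (y, p', .left) := by
  refine compStep_no_left _ _ _ (T.midStep_no_left) (fun s s' t t' hs hs' => ?_) _ _ _
  cases s <;> cases s' <;> simp_all [stateAnn]

theorem builtStep_no_right (p : T.BuiltState) (y p') :
    T.builtStep p .rend ≠ some (y, p', .right) := by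
  refine compStep_no_right _ _ _ (fun s => ?_) _ _ _
  cases s <;> simp [stateAnn]

/-- The two-way transducer built from `T`: the composition of the three transducers. -/
noncomputable def toTwoDFT : TwoDFT.{u, v, w} A B where
  State := T.BuiltState
  finite_state := by
    have := T.finite_state
    have := T.finite_var
    infer_instance
  init := .sim .toEnd none
  final := {c | ∃ s q, c = .sim (.run (.sim .fin s)) q}
  step := T.builtStep
  no_left := T.builtStep_no_left
  no_right := T.builtStep_no_right

end SST

/-! Aperiodicity is reduced to a property of runs on two-way infinite periodic tapes. A machine is
steady for the period `L` if every run that repeats its state at distance `d * L`, with `d ≥ 1`,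
meets a configuration whose state is repeated at distance exactly `L`. In a steady machine, the
states in which successive period boundaries are first crossed are constant as soon as one of them
recurs (`first_passage_constant`), and the pigeonhole principle makes one recur within as many
periods as there are states. Hence the traversals of `x ^ n` and `x ^ (n + 1)` agree for large `n`.
Runs that exit on their entry side need no steadiness: a state recurring further away makes the run
drift off for ever. The behaviours entered from the right follow by reflection.

Steadiness survives composition with an aperiodic sequential transducer (`comp_steady`). All the
states of the transducer stored during a run lead to the same state at the right end of the run. At
the rightmost point of a cycle, the stored state thus returns to itself after `d` periods, and by
aperiodicity after one. This yields a periodic annotation of the tape, on which the composition does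
nothing but simulate the inner machine. A look-back that goes on for whole periods iterates the
transducer, so the same aperiodicity applies to it. Both sequential transducers are aperiodic
because the flow of `T` determines the states reached and the variables that flow into a given set.

There remains the machine that follows occurrences. Variables placed at the boundaries between cells
are vertices, and `X` is a child of `Y` if it occurs in the update of `Y`. Long runs to the right
climb through ancestors, long runs to the left go down through descendants (`follow_steady`), so a
recurring state gives a flow from `X` to some `Y` in one period and from `Y` back to `X`. By
aperiodicity, `X` then flows to `X` and to `Y`, and both flow to `X`, in one common number of
periods. If `X ≠ Y`, this puts two occurrences of `X` into the value of `X` over twice that number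
of periods, against 1-boundedness (`desc_cycle`).

For correctness, each annotation can be recovered because the endmarker where it starts is readable
from its initial state only. Linearity of the output makes the useful parent of an occurrence
unique, and induction on the prefix shows that the machine started in `(X, i)` outputs the value of
`X` (`run_inn`). The converse inclusion comes from determinism: final configurations are stuck, as
are the ones reached when `T` has no output. -/

/-! ## Runs on tapes indexed by the integers -/

section Tapes

variable {Γ : Type*} {B : Type*} {P : Type*}

/-- A single transition of `M` on the partial tape `t`, with its output. -/
def Fires (M : TwoWayStep Γ B P) (t : ℤ → Option Γ) (c : P × ℤ) (y : List B) (c' : P × ℤ) : Prop :=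
  ∃ a d, t c.2 = some a ∧ M c.1 a = some (y, c'.1, d) ∧ c'.2 = c.2 + d.toInt

/-- Runs of `M` on the partial tape `t`, with their output. -/
inductive Run (M : TwoWayStep Γ B P) (t : ℤ → Option Γ) : P × ℤ → List B → P × ℤ → Prop
  | refl (c : P × ℤ) : Run M t c [] c
  | head {c c' c'' : P × ℤ} {y y' : List B} (h : Fires M t c y c') (h' : Run M t c' y' c'') :
      Run M t c (y ++ y') c''

/-- A single transition, without its output. -/
def Moves (M : TwoWayStep Γ B P) (t : ℤ → Option Γ) (c c' : P × ℤ) : Prop := ∃ y, Fires M t c y c'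

/-- Reachability between configurations. -/
def Reach (M : TwoWayStep Γ B P) (t : ℤ → Option Γ) : P × ℤ → P × ℤ → Prop :=
  Relation.ReflTransGen (Moves M t)

variable {M : TwoWayStep Γ B P} {t t' : ℤ → Option Γ} {c c' c'' : P × ℤ} {y y' : List B}

theorem Fires.eq {c₁ c₂ : P × ℤ} {y₁ y₂ : List B} (h₁ : Fires M t c y₁ c₁)
    (h₂ : Fires M t c y₂ c₂) : y₁ = y₂ ∧ c₁ = c₂ := by
  obtain ⟨a, d, h1, h2, h3⟩ := h₁
  obtain ⟨a', d', k1, k2, k3⟩ := h₂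
  rw [h1, Option.some.injEq] at k1
  subst k1
  rw [h2] at k2
  simp only [Option.some.injEq, Prod.mk.injEq] at k2
  obtain ⟨rfl, e, rfl⟩ := k2
  exact ⟨rfl, Prod.ext e (by rw [h3, k3])⟩

theorem Moves.rightUnique : Relator.RightUnique (Moves M t) := fun _ _ _ ⟨_, h⟩ ⟨_, h'⟩ =>
  (h.eq h').2

theorem Fires.mono (hle : ∀ i a, t i = some a → t' i = some a) (h : Fires M t c y c') :
    Fires M t' c y c' := by
  obtain ⟨a, d, h1, h2, h3⟩ := h
  exact ⟨a, d, hle _ _ h1, h2, h3⟩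

theorem Reach.mono (hle : ∀ i a, t i = some a → t' i = some a) (h : Reach M t c c') :
    Reach M t' c c' :=
  Relation.ReflTransGen.mono (fun _ _ ⟨y, h⟩ => ⟨y, h.mono hle⟩) _ _ h

theorem Reach.trans (h : Reach M t c c') (h' : Reach M t c' c'') : Reach M t c c'' :=
  Relation.ReflTransGen.trans h h'

theorem Reach.comparable (h : Reach M t c c') (h' : Reach M t c c'') :
    Reach M t c' c'' ∨ Reach M t c'' c' :=
  Relation.ReflTransGen.total_of_right_unique Moves.rightUnique h h'

theorem Reach.eq_of_stuck (h : Reach M t c c') (hs : ∀ c'', ¬ Moves M t c c'') : c' = c := by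
  rcases Relation.ReflTransGen.cases_head h with h | ⟨d, h, -⟩
  · exact h.symm
  · exact absurd h (hs _)

/-- A configuration reached by a run ending in a stuck configuration reaches the latter. -/
theorem Reach.to_stuck (h : Reach M t c c') (h' : Reach M t c c'')
    (hs : ∀ d, ¬ Moves M t c'' d) : Reach M t c' c'' := by
  rcases h.comparable h' with h | h
  · exact h
  · rw [h.eq_of_stuck hs]; exact .refl

/-- Makes every exit from a finite window a stuck configuration, so that by determinism a run has at
most one exit. -/
theorem not_moves_of_none (h : t c.2 = none) (c' : P × ℤ) : ¬ Moves M t c c' := by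
  rintro ⟨y, a, d, h1, -⟩
  rw [h] at h1
  cases h1

theorem HeadMove.le_one (d : HeadMove) : d.toInt ≤ 1 ∧ -1 ≤ d.toInt := by
  cases d <;> simp [HeadMove.toInt]

theorem Moves.le (h : Moves M t c c') : c'.2 ≤ c.2 + 1 ∧ c.2 - 1 ≤ c'.2 := by
  obtain ⟨y, a, d, -, -, h3⟩ := h
  have := d.le_one
  omega

theorem Run.fires (h : Fires M t c y c') : Run M t c y c' := by
  simpa using Run.head h (.refl _)

theorem Run.trans (h : Run M t c y c') (h' : Run M t c' y' c'') : Run M t c (y ++ y') c'' := by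
  induction h with
  | refl => exact h'
  | head h _ ih => rw [List.append_assoc]; exact .head h (ih h')

theorem Run.reach (h : Run M t c y c') : Reach M t c c' := by
  induction h with
  | refl => exact .refl
  | head h _ ih => exact .head ⟨_, h⟩ ih

theorem Reach.run (h : Reach M t c c') : ∃ y, Run M t c y c' := by
  induction h using Relation.ReflTransGen.head_induction_on with
  | refl => exact ⟨_, .refl _⟩
  | head h _ ih =>
    obtain ⟨y, h⟩ := h
    obtain ⟨y', h'⟩ := ih
    exact ⟨_, .head h h'⟩

/-- Two runs from the same configuration to stuck configurations are equal. -/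
theorem Run.eq_of_stuck {c₁ c₂ : P × ℤ} {y₁ y₂ : List B} (h₁ : Run M t c y₁ c₁)
    (h₂ : Run M t c y₂ c₂) (hs₁ : ∀ d, ¬ Moves M t c₁ d) (hs₂ : ∀ d, ¬ Moves M t c₂ d) :
    y₁ = y₂ ∧ c₁ = c₂ := by
  induction h₁ generalizing y₂ with
  | refl =>
    cases h₂ with
    | refl => exact ⟨rfl, rfl⟩
    | head h => exact absurd ⟨_, h⟩ (hs₁ _)
  | head h _ ih =>
    cases h₂ with
    | refl => exact absurd ⟨_, h⟩ (hs₂ _)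
    | head k h' =>
      obtain ⟨rfl, rfl⟩ := h.eq k
      obtain ⟨rfl, rfl⟩ := ih h' hs₁
      exact ⟨rfl, rfl⟩

theorem Fires.shift {s : ℤ} (hle : ∀ i a, t i = some a → t' (i + s) = some a)
    (h : Fires M t c y c') : Fires M t' (c.1, c.2 + s) y (c'.1, c'.2 + s) := by
  obtain ⟨a, d, h1, h2, h3⟩ := h
  exact ⟨a, d, hle _ _ h1, h2, by simp only [h3]; ring⟩

theorem Reach.shift {s : ℤ} (hle : ∀ i a, t i = some a → t' (i + s) = some a)
    (h : Reach M t c c') : Reach M t' (c.1, c.2 + s) (c'.1, c'.2 + s) :=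
  Relation.ReflTransGen.lift (fun c : P × ℤ => (c.1, c.2 + s))
    (fun _ _ ⟨y, h⟩ => ⟨y, h.shift hle⟩) _ _ h

theorem HeadMove.mirror_mirror (d : HeadMove) : d.mirror.mirror = d := by cases d <;> rfl

theorem HeadMove.toInt_mirror (d : HeadMove) : d.mirror.toInt = - d.toInt := by
  cases d <;> rfl

theorem mirrorStep_mirrorStep (M : TwoWayStep Γ B P) : mirrorStep (mirrorStep M) = M := by
  funext p a
  simp only [mirrorStep, Option.map_map]
  cases M p a <;> simp [HeadMove.mirror_mirror]

/-- Reflection about `s / 2` turns statements on left-to-right motion into statements on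
right-to-left motion. -/
theorem Fires.mirror (s : ℤ) (h : Fires M t c y c') :
    Fires (mirrorStep M) (fun i => t (s - i)) (c.1, s - c.2) y (c'.1, s - c'.2) := by
  obtain ⟨a, d, h1, h2, h3⟩ := h
  refine ⟨a, d.mirror, by simpa using h1, by simp [mirrorStep, h2], ?_⟩
  simp only [h3, HeadMove.toInt_mirror]
  ring

theorem Reach.mirror (s : ℤ) (h : Reach M t c c') :
    Reach (mirrorStep M) (fun i => t (s - i)) (c.1, s - c.2) (c'.1, s - c'.2) :=
  Relation.ReflTransGen.lift (fun c : P × ℤ => (c.1, s - c.2))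
    (fun _ _ ⟨y, h⟩ => ⟨y, h.mirror s⟩) _ _ h

theorem Run.mirror (s : ℤ) (h : Run M t c y c') :
    Run (mirrorStep M) (fun i => t (s - i)) (c.1, s - c.2) y (c'.1, s - c'.2) := by
  induction h with
  | refl => exact .refl _
  | head h _ ih => exact .head (h.mirror s) ih

theorem reach_mirror_iff {s : ℤ} {p q : P} {i j : ℤ} :
    Reach (mirrorStep M) (fun i => t (s - i)) (p, i) (q, j) ↔
      Reach M t (p, s - i) (q, s - j) := by
  constructor
  · intro h
    simpa [mirrorStep_mirrorStep] using h.mirror s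
  · intro h
    simpa using h.mirror s

/-- Transport of runs along an embedding of machines. -/
theorem Fires.embed {P' : Type*} {M' : TwoWayStep Γ B P'} (f : P → P')
    (hf : ∀ p a, M' (f p) a = (M p a).map fun r => (r.1, f r.2.1, r.2.2)) (h : Fires M t c y c') :
    Fires M' t (f c.1, c.2) y (f c'.1, c'.2) := by
  obtain ⟨a, d, h1, h2, h3⟩ := h
  exact ⟨a, d, h1, by simp [hf, h2], h3⟩

theorem Run.embed {P' : Type*} {M' : TwoWayStep Γ B P'} (f : P → P')
    (hf : ∀ p a, M' (f p) a = (M p a).map fun r => (r.1, f r.2.1, r.2.2)) (h : Run M t c y c') :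
    Run M' t (f c.1, c.2) y (f c'.1, c'.2) := by
  induction h with
  | refl => exact .refl _
  | head h _ ih => exact .head (h.embed f hf) ih

theorem Reach.embed {P' : Type*} {M' : TwoWayStep Γ B P'} (f : P → P')
    (hf : ∀ p a, M' (f p) a = (M p a).map fun r => (r.1, f r.2.1, r.2.2)) (h : Reach M t c c') :
    Reach M' t (f c.1, c.2) (f c'.1, c'.2) :=
  Relation.ReflTransGen.lift (fun c : P × ℤ => (f c.1, c.2))
    (fun _ _ ⟨y, h⟩ => ⟨y, h.embed f hf⟩) _ _ h

/-- Runs from an embedded configuration are embedded runs. -/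
theorem Reach.of_embed {P' : Type*} {M' : TwoWayStep Γ B P'} (f : P → P')
    (hf : ∀ p a, M' (f p) a = (M p a).map fun r => (r.1, f r.2.1, r.2.2)) {c' : P' × ℤ}
    (h : Reach M' t (f c.1, c.2) c') : ∃ d : P × ℤ, c' = (f d.1, d.2) ∧ Reach M t c d := by
  induction h with
  | refl => exact ⟨c, rfl, .refl⟩
  | tail _ h ih =>
    obtain ⟨d, rfl, hd⟩ := ih
    obtain ⟨y, a, m, h1, h2, h3⟩ := h
    simp only [hf, Option.map_eq_some_iff, Prod.mk.injEq] at h2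
    obtain ⟨⟨y', p', m'⟩, h2, h4, h5, h6⟩ := h2
    simp only at h4 h5 h6
    subst h4 h6
    exact ⟨(p', d.2 + m'.toInt), Prod.ext h5.symm h3, hd.tail ⟨_, a, m', h1, h2, rfl⟩⟩

end Tapes


/-! ## A criterion for aperiodicity -/

section Steady

variable {Γ : Type*} {B : Type*} {P : Type*}

open Classical in
/-- The tape with the content of `t` on the cells of `s`. -/
noncomputable def restr (t : ℤ → Γ) (s : Set ℤ) : ℤ → Option Γ :=
  fun i => if i ∈ s then some (t i) else none

/-- Total tapes. -/
def total (t : ℤ → Γ) : ℤ → Option Γ := fun i => some (t i)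

/-- A run that reaches its starting state at a distance `d * L` passes through some state twice at
distance `L`. -/
def Steady (M : TwoWayStep Γ B P) (t : ℤ → Γ) (L : ℤ) : Prop :=
  ∀ (p : P) (i : ℤ) (d : ℕ), 1 ≤ d → Reach M (total t) (p, i) (p, i + d * L) →
    ∃ p' i', Reach M (total t) (p, i) (p', i') ∧ Reach M (total t) (p', i') (p', i' + L)

variable {M : TwoWayStep Γ B P} {t : ℤ → Γ} {s s' : Set ℤ} {c c' : P × ℤ}

theorem Steady.mirror {L : ℤ} (s : ℤ) (h : Steady M t L) :
    Steady (mirrorStep M) (fun i => t (s - i)) (-L) := by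
  intro p i d hd hr
  have e : total (fun i => t (s - i)) = fun i => total t (s - i) := rfl
  simp only [e, reach_mirror_iff] at hr ⊢
  obtain ⟨p', i', h1, h2⟩ := h p (s - i) d hd (by convert hr using 2; ring)
  refine ⟨p', s - i', by simpa using h1, ?_⟩
  convert h2 using 2 <;> ring

theorem restr_of_mem {i : ℤ} (h : i ∈ s) : restr t s i = some (t i) := if_pos h

theorem restr_of_notMem {i : ℤ} (h : i ∉ s) : restr t s i = none := if_neg h

theorem restr_eq_some {i : ℤ} {a : Γ} : restr t s i = some a ↔ i ∈ s ∧ t i = a := by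
  simp [restr]

theorem Reach.restr_mono (hs : s ⊆ s') (h : Reach M (restr t s) c c') :
    Reach M (restr t s') c c' :=
  h.mono fun i a hi => by
    rw [restr_eq_some] at hi ⊢
    exact ⟨hs hi.1, hi.2⟩

theorem Reach.restr_total (h : Reach M (restr t s) c c') : Reach M (total t) c c' :=
  h.mono fun i a hi => by
    rw [restr_eq_some] at hi
    exact congrArg some hi.2

theorem restr_stuck {p : P} {i : ℤ} (h : i ∉ s) (c' : P × ℤ) : ¬ Moves M (restr t s) (p, i) c' :=
  not_moves_of_none (restr_of_notMem h) c'

theorem Moves.restrict (h : Moves M (total t) c c') (hc : c.2 ∈ s) : Moves M (restr t s) c c' := by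
  obtain ⟨y, a, d, h1, h2⟩ := h
  exact ⟨y, a, d, by rw [restr_of_mem hc]; exact h1, h2⟩

theorem Moves.of_restrict (h : Moves M (restr t s) c c') : Moves M (total t) c c' ∧ c.2 ∈ s := by
  obtain ⟨y, a, d, h1, h2⟩ := h
  rw [restr_eq_some] at h1
  exact ⟨⟨y, a, d, congrArg some h1.2, h2⟩, h1.1⟩

/-- The head moves by at most one cell, so it cannot jump over `b`; the run is cut at its first
visit there. -/
theorem Reach.first_passage {b : ℤ} (h : Reach M (restr t s) c c') (hc : c.2 ≤ b)
    (hc' : b ≤ c'.2) : ∃ r, Reach M (restr t (s ∩ Set.Iio b)) c (r, b) ∧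
      Reach M (restr t s) (r, b) c' := by
  induction h using Relation.ReflTransGen.head_induction_on with
  | refl =>
    refine ⟨c'.1, ?_⟩
    rw [show (c'.1, b) = c' from Prod.ext rfl (by simp only; omega)]
    exact ⟨.refl, .refl⟩
  | @head c d h h' ih =>
    rcases hc.eq_or_lt with rfl | hlt
    · exact ⟨c.1, .refl, .head h h'⟩
    · obtain ⟨r, h1, h2⟩ := ih (by have := h.le; omega)
      exact ⟨r, .head (h.of_restrict.1.restrict ⟨h.of_restrict.2, hlt⟩) h1, h2⟩

theorem Reach.passage_or {b : ℤ} (h : Reach M (restr t s) c c') (hc : c.2 ≤ b) :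
    Reach M (restr t (s ∩ Set.Iio b)) c c' ∨
      ∃ r, Reach M (restr t (s ∩ Set.Iio b)) c (r, b) ∧ Reach M (restr t s) (r, b) c' := by
  induction h using Relation.ReflTransGen.head_induction_on with
  | refl => exact .inl .refl
  | @head c d h h' ih =>
    rcases hc.eq_or_lt with rfl | hlt
    · exact .inr ⟨c.1, .refl, .head h h'⟩
    · have h0 := h.of_restrict.1.restrict (s := s ∩ Set.Iio b) ⟨h.of_restrict.2, hlt⟩
      rcases ih (by have := h.le; omega) with h1 | ⟨r, h1, h2⟩
      · exact .inl (.head h0 h1)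
      · exact .inr ⟨r, .head h0 h1, h2⟩

/-- A finite run visits finitely many cells. -/
theorem Reach.bounded (h : Reach M (total t) c c') :
    ∃ b, ∀ b', b ≤ b' → Reach M (restr t (Set.Iio b')) c c' := by
  induction h using Relation.ReflTransGen.head_induction_on with
  | refl => exact ⟨0, fun _ _ => .refl⟩
  | @head c d h h' ih =>
    obtain ⟨b, hb⟩ := ih
    exact ⟨max b (c.2 + 1), fun b' hb' =>
      .head (h.restrict (show c.2 < b' by omega)) (hb _ (by omega))⟩

theorem Reach.restr_shift {L : ℤ} (ht : ∀ i, t (i + L) = t i)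
    (hs : ∀ i ∈ s, i + L ∈ s') (h : Reach M (restr t s) c c') :
    Reach M (restr t s') (c.1, c.2 + L) (c'.1, c'.2 + L) :=
  h.shift fun i a hi => by
    rw [restr_eq_some] at hi ⊢
    exact ⟨hs i hi.1, by rw [ht, hi.2]⟩

theorem Reach.total_shift {L : ℤ} (ht : ∀ i, t (i + L) = t i) (h : Reach M (total t) c c') :
    Reach M (total t) (c.1, c.2 + L) (c'.1, c'.2 + L) :=
  h.shift fun i a hi => by rw [← hi]; simp [total, ht]

theorem periodic_nat_mul {t : ℤ → Γ} {L : ℤ} (ht : ∀ i, t (i + L) = t i) (d : ℕ) (i : ℤ) :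
    t (i + d * L) = t i := by
  induction d with
  | zero => simp
  | succ d ih => rw [← ih, ← ht (i + d * L)]; congr 1; push_cast; ring

/-- Crossing for the first time in state `p` after `d` periods, the run starts again from a
translated situation, so the first passages after all multiples of `d` are in `p`. Steadiness
supplies one more such period, of a length coprime to `d`, and a count of periods common to both
then forces `v = p`. -/
theorem first_passage_constant {L : ℤ} (hL : 0 < L) (ht : ∀ i, t (i + L) = t i)
    (hst : Steady M t L) {p v : P} {i : ℤ} {d k : ℕ} (hd : 1 ≤ d)
    (h : Reach M (restr t (Set.Iio (i + d * L))) (p, i) (p, i + d * L))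
    (hv : Reach M (restr t (Set.Iio (i + k * L))) (p, i) (v, i + k * L)) : v = p := by
  -- `G k v`: the boundary after `k` periods is first reached in state `v`.
  let G : ℕ → P → Prop := fun k v => Reach M (restr t (Set.Iio (i + k * L))) (p, i) (v, i + k * L)
  have Gu : ∀ k v v', G k v → G k v' → v = v' := fun k v v' h h' =>
    congrArg Prod.fst (h.to_stuck h' (restr_stuck (by simp))
      |>.eq_of_stuck (restr_stuck (by simp))).symm
  have Ga : ∀ a b v, G a p → G b v → G (a + b) v := by
    intro a b v ha hb
    have h1 := hb.restr_shift (s' := Set.Iio (i + (a + b : ℕ) * L)) (periodic_nat_mul ht a)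
      (fun j hj => by simp only [Set.mem_Iio] at hj ⊢; push_cast; linarith)
    have h2 := ha.restr_mono (s' := Set.Iio (i + (a + b : ℕ) * L))
      (fun j hj => by simp only [Set.mem_Iio] at hj ⊢; push_cast; nlinarith)
    refine h2.trans ?_
    rwa [show (i + (a + b : ℕ) * L) = i + b * L + a * L by push_cast; ring] at *
  have Gm : ∀ e k, G k p → G (e * k) p := by
    intro e k hk
    induction e with
    | zero => simp only [G, Nat.cast_zero, zero_mul, add_zero]; exact .refl
    | succ e ih => rw [Nat.succ_mul]; exact Ga _ _ _ ih hk
  obtain ⟨p', i', h1, h2⟩ := hst p i d hd h.restr_total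
  obtain ⟨b₁, hb₁⟩ := h1.bounded
  obtain ⟨b₂, hb₂⟩ := h2.bounded
  have key : ∃ e : ℕ, G (e * d + 1) p := by
    -- A boundary beyond everything seen by the runs to `(p', i')` and to `(p', i' + L)`. The rest
    -- of the run from `(p', i')` up to this boundary, translated by `L`, also continues the second
    -- run, and shows that the next boundary is first reached in `p` too.
    obtain ⟨e, he⟩ : ∃ e : ℕ, max b₁ b₂ ≤ i + (e * d : ℕ) * L := by
      refine ⟨(max b₁ b₂ - i).toNat, ?_⟩
      have := Int.self_le_toNat (max b₁ b₂ - i)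
      push_cast
      have hd' : (1 : ℤ) ≤ d := by exact_mod_cast hd
      have h0 : (0 : ℤ) ≤ ((max b₁ b₂ - i).toNat : ℤ) := by positivity
      have : ((max b₁ b₂ - i).toNat : ℤ) ≤ (max b₁ b₂ - i).toNat * d * L := by
        rw [mul_assoc]; exact le_mul_of_one_le_right h0 (by nlinarith)
      linarith
    refine ⟨e, ?_⟩
    have g := Gm e d h
    have r1 := hb₁ _ (le_trans (le_max_left _ _) he)
    have r2 := hb₂ _ (le_trans (le_max_right _ _) he)
    have r3 := r1.to_stuck g (restr_stuck (by simp))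
    have r4 := r3.restr_shift (s' := Set.Iio (i + (e * d + 1 : ℕ) * L)) ht
      (fun j hj => by simp only [Set.mem_Iio] at hj ⊢; push_cast at hj ⊢; linarith)
    have r5 := (r1.trans r2).restr_mono (s' := Set.Iio (i + (e * d + 1 : ℕ) * L))
      (fun j hj => by simp only [Set.mem_Iio] at hj ⊢; push_cast at hj ⊢; linarith)
    refine r5.trans ?_
    rwa [show (i + (e * d + 1 : ℕ) * L) = i + (e * d : ℕ) * L + L by push_cast; ring] at *
  obtain ⟨e, he⟩ := key
  have g1 := Gm k _ he
  have g2 := Ga _ _ _ (Gm (k * e) _ h) hv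
  -- The same boundary seen as `k` blocks of `e * d + 1` periods (state `p`), and as `k * e` blocks
  -- of `d` periods followed by `k` periods (state `v`).
  rw [show k * e * d + k = k * (e * d + 1) by ring] at g2
  exact Gu _ _ _ g2 g1

/-- A run that repeats its state further to the right does not come back to the left. -/
theorem not_reach_left {L : ℤ} (hL : 0 < L) (ht : ∀ i, t (i + L) = t i) {p q : P} {i b : ℤ}
    {d : ℕ} (hd : 1 ≤ d) (hib : i ≤ b) (hb0 : 0 ≤ b)
    (h : Reach M (restr t (Set.Ici 0)) (p, i) (p, i + d * L)) :
    ¬ Reach M (restr t (Set.Ico 0 b)) (p, i) (q, -1) := by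
  intro hq
  have hm : ∀ e : ℕ, Reach M (restr t (Set.Ici 0)) (p, i) (p, i + (e * d : ℕ) * L) := by
    intro e
    induction e with
    | zero => simp only [Nat.cast_zero, zero_mul, add_zero]; exact .refl
    | succ e ih =>
      refine ih.trans ?_
      have := h.restr_shift (s' := Set.Ici 0) (periodic_nat_mul ht (e * d))
        (fun j hj => by simp only [Set.mem_Ici] at hj ⊢; positivity)
      rwa [show (i + ((e + 1) * d : ℕ) * L) = i + d * L + (e * d : ℕ) * L by push_cast; ring]
  -- Enough repetitions of the drift to pass `b`: the run leaves `Set.Ico 0 b` on the right before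
  -- it could leave on the left.
  have hb : b ≤ i + (((b - i).toNat * d : ℕ) : ℤ) * L := by
    have := Int.self_le_toNat (b - i)
    push_cast
    have hd' : (1 : ℤ) ≤ d := by exact_mod_cast hd
    have h0 : (0 : ℤ) ≤ ((b - i).toNat : ℤ) := by positivity
    have : ((b - i).toNat : ℤ) ≤ (b - i).toNat * d * L := by
      rw [mul_assoc]; exact le_mul_of_one_le_right h0 (by nlinarith)
    linarith
  obtain ⟨r, h1, -⟩ := Reach.first_passage (hm (b - i).toNat) hib hb
  rw [Set.Ici_inter_Iio] at h1
  have := congrArg Prod.snd ((hq.to_stuck h1 (restr_stuck (by simp))).eq_of_stuck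
    (restr_stuck (by simp)))
  simp only at this
  omega

end Steady


/-! ### Behaviours of a steady machine on powers of a word -/

section Criterion

variable {Γ : Type*} {B : Type*} {P : Type*} {M : TwoWayStep Γ B P} {t : ℤ → Γ}

theorem Ico_mul_subset {L : ℤ} (hL : 0 < L) {m n : ℕ} (h : m ≤ n) :
    Set.Ico 0 (m * L) ⊆ Set.Ico 0 (n * L) :=
  Set.Ico_subset_Ico_right (mul_le_mul_of_nonneg_right (by exact_mod_cast h) hL.le)

theorem exists_passage {L : ℤ} (hL : 0 < L) {p : P} {c' : P × ℤ} {k n : ℕ} (hk : k ≤ n)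
    (h : Reach M (restr t (Set.Ico 0 (n * L))) (p, 0) c') (hc' : n * L ≤ c'.2) :
    ∃ s, Reach M (restr t (Set.Ico 0 (k * L))) (p, 0) (s, k * L) ∧
      Reach M (restr t (Set.Ico 0 (n * L))) (s, k * L) c' := by
  have hkn : (k : ℤ) * L ≤ n * L := mul_le_mul_of_nonneg_right (by exact_mod_cast hk) hL.le
  obtain ⟨s, h1, h2⟩ := h.first_passage (b := k * L) (by positivity) (hkn.trans hc')
  rw [Set.Ico_inter_Iio, min_eq_right hkn] at h1
  exact ⟨s, h1, h2⟩

/-- A long run from left to right repeats a state. -/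
theorem exists_repetition [Finite P] {L : ℤ} (hL : 0 < L) {p : P} {n : ℕ} (hn : Nat.card P ≤ n)
    {q : P} (h : Reach M (restr t (Set.Ico 0 (n * L))) (p, 0) (q, n * L)) :
    ∃ (j d : ℕ) (s : P), 1 ≤ d ∧ j + d ≤ n ∧ 
      Reach M (restr t (Set.Ico 0 (j * L))) (p, 0) (s, j * L) ∧
      Reach M (restr t (Set.Ico 0 ((j + d : ℕ) * L))) (s, j * L) (s, j * L + d * L) := by
  have : Fintype P := Fintype.ofFinite P
  choose f hf hf' using fun k : Fin (n + 1) =>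
    exists_passage (k := k) hL (by have := k.2; omega) h le_rfl
  obtain ⟨a, b, hab, e⟩ := Fintype.exists_ne_map_eq_of_card_lt f
    (by rw [Fintype.card_fin, ← Nat.card_eq_fintype_card]; omega)
  wlog hlt : a < b generalizing a b
  · exact this b a hab.symm e.symm (lt_of_le_of_ne (not_lt.mp hlt) hab.symm)
  refine ⟨a, b - a, f a, by omega, by omega, hf a, ?_⟩
  have hab' : (a : ℕ) ≤ b := by omega
  have h1 := ((hf a).restr_mono (Ico_mul_subset hL hab')).to_stuck (hf b) (restr_stuck (by simp))
  rw [← e] at h1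
  rw [← add_mul, ← Nat.cast_add]
  rwa [show (a : ℕ) + (b - a : ℕ) = (b : ℕ) by omega]

theorem repetition_constant {L : ℤ} (hL : 0 < L) (ht : ∀ i, t (i + L) = t i)
    (hst : Steady M t L) {p s v : P} {j d k : ℕ} (hd : 1 ≤ d) (hk : j ≤ k)
    (h1 : Reach M (restr t (Set.Ico 0 (j * L))) (p, 0) (s, j * L))
    (h2 : Reach M (restr t (Set.Ico 0 ((j + d : ℕ) * L))) (s, j * L) (s, j * L + d * L))
    (hv : Reach M (restr t (Set.Ico 0 (k * L))) (p, 0) (v, k * L)) : v = s := by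
  have h3 := (h1.restr_mono (Ico_mul_subset hL hk)).to_stuck hv (restr_stuck (by simp))
  have e1 : ((j + d : ℕ) : ℤ) * L = j * L + d * L := by push_cast; ring
  have e2 : (k : ℤ) * L = j * L + (k - j : ℕ) * L := by push_cast [Nat.cast_sub hk]; ring
  rw [e1] at h2
  rw [e2] at h3
  exact first_passage_constant hL ht hst hd (h2.restr_mono Set.Ico_subset_Iio_self)
    (h3.restr_mono Set.Ico_subset_Iio_self)

/-- From the repetition on, all boundaries are first crossed in the same state `s`, so one period
can be inserted after the repetition starts, or the last one dropped, without changing the exit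
state. -/
theorem reach_left_right_succ [Finite P] {L : ℤ} (hL : 0 < L) (ht : ∀ i, t (i + L) = t i)
    (hst : Steady M t L) {n : ℕ} (hn : Nat.card P ≤ n) (p q : P) :
    Reach M (restr t (Set.Ico 0 (n * L))) (p, 0) (q, n * L) ↔
      Reach M (restr t (Set.Ico 0 ((n + 1 : ℕ) * L))) (p, 0) (q, (n + 1 : ℕ) * L) := by
  constructor
  · intro h
    obtain ⟨j, d, s, hd, hjd, h1, h2⟩ := exists_repetition hL hn h
    obtain rfl := repetition_constant hL ht hst hd (by omega) h1 h2 h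
    obtain ⟨s', h3, -⟩ := exists_passage (k := j + 1) hL (by omega) h le_rfl
    obtain rfl := repetition_constant hL ht hst hd (by omega) h1 h2 h3
    have h4 := (h1.restr_mono (Ico_mul_subset hL (by omega : j ≤ n))).to_stuck h
      (restr_stuck (by simp))
    have h5 := (h4.restr_shift (s' := Set.Ico 0 ((n + 1 : ℕ) * L)) ht
      (fun i hi => by simp only [Set.mem_Ico] at hi ⊢; push_cast; constructor <;> linarith))
    have h6 := h3.restr_mono (Ico_mul_subset hL (by omega : j + 1 ≤ n + 1))
    refine h6.trans ?_
    convert h5 using 2 <;> push_cast <;> ring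
  · intro h
    obtain ⟨s', h3, -⟩ := exists_passage (k := n) hL (by omega) h le_rfl
    obtain ⟨j, d, s, hd, hjd, h1, h2⟩ := exists_repetition hL hn h3
    obtain rfl := repetition_constant hL ht hst hd (by omega) h1 h2 h
    obtain rfl := repetition_constant hL ht hst hd (by omega) h1 h2 h3
    exact h3

/-- A run that needs the last period has crossed `n` periods, hence has repeated a state further to
the right, and `not_reach_left` forbids its return. -/
theorem reach_left_left_succ [Finite P] {L : ℤ} (hL : 0 < L) (ht : ∀ i, t (i + L) = t i)
    {n : ℕ} (hn : Nat.card P ≤ n) (p q : P) :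
    Reach M (restr t (Set.Ico 0 (n * L))) (p, 0) (q, -1) ↔
      Reach M (restr t (Set.Ico 0 ((n + 1 : ℕ) * L))) (p, 0) (q, -1) := by
  refine ⟨fun h => h.restr_mono (Ico_mul_subset hL (by omega)), fun h => ?_⟩
  have hle : (n : ℤ) * L ≤ (n + 1 : ℕ) * L := by push_cast; linarith
  rcases h.passage_or (b := n * L) (by positivity) with h' | ⟨r, h', -⟩
  · rwa [Set.Ico_inter_Iio, min_eq_right hle] at h'
  · rw [Set.Ico_inter_Iio, min_eq_right hle] at h'
    obtain ⟨j, d, s, hd, hjd, h1, h2⟩ := exists_repetition hL hn h'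
    have h3 := (h1.restr_mono (Ico_mul_subset hL (by omega : j ≤ n + 1))).to_stuck h
      (restr_stuck (by simp))
    refine absurd h3 (not_reach_left hL ht hd ?_ (by positivity)
      (h2.restr_mono Set.Ico_subset_Ici_self))
    exact mul_le_mul_of_nonneg_right (by exact_mod_cast (by omega : j ≤ n + 1)) hL.le

theorem TwoWayRun.run {Γ : Type u} {B : Type v} {P : Type w} {M : TwoWayStep Γ B P} {x : List Γ}
    {c c' : P × ℤ} {y : List B} {halt : P × ℤ → Prop}
    (h : TwoWayRun M x halt c y c') : Run M (cellAt x) c y c' := by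
  induction h with
  | refl => exact .refl _
  | head _ ha hδ _ ih => exact .head ⟨_, _, ha, hδ, rfl⟩ ih

/-- If halting configurations are stuck, no run goes through one before its end, so the halting
condition costs nothing. -/
theorem Run.twoWayRun {Γ : Type u} {B : Type v} {P : Type w} {M : TwoWayStep Γ B P} {x : List Γ}
    {c c' : P × ℤ} {y : List B} {halt : P × ℤ → Prop}
    (hs : ∀ c c', halt c → ¬ Moves M (cellAt x) c c')
    (h : Run M (cellAt x) c y c') : TwoWayRun M x halt c y c' := by
  induction h with
  | refl => exact .refl _
  | @head c c' c'' y y' h _ ih =>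
    have hh : ¬ halt c := fun hc => hs _ _ hc ⟨_, h⟩
    obtain ⟨a, d, h1, h2, h3⟩ := h
    obtain ⟨p, i⟩ := c
    obtain ⟨p', i'⟩ := c'
    simp only at h1 h2 h3
    subst h3
    exact .head hh h1 h2 ih

theorem exists_twoWayRun_iff {Γ : Type u} {B : Type v} {P : Type w} {M : TwoWayStep Γ B P}
    {x : List Γ} {c c' : P × ℤ} :
    (∃ y, TwoWayRun M x (fun _ => False) c y c') ↔ Reach M (cellAt x) c c' := by
  constructor
  · rintro ⟨y, h⟩
    exact h.run.reach
  · intro h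
    obtain ⟨y, h⟩ := h.run
    exact ⟨y, h.twoWayRun fun _ _ h => h.elim⟩

end Criterion

/-! ### Powers of a word as windows of one periodic tape -/

section Words

variable {A : Type u} 

theorem wordPow_succ (x : List A) (n : ℕ) : wordPow x (n + 1) = x ++ wordPow x n := by
  simp [wordPow, List.replicate_succ]

theorem length_wordPow (x : List A) (n : ℕ) : (wordPow x n).length = n * x.length := by
  simp [wordPow]

theorem wordPow_nil (n : ℕ) : wordPow ([] : List A) n = [] := by
  simp [wordPow]

theorem map_wordPow {A' : Type*} (f : A → A') (x : List A) (n : ℕ) :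
    (wordPow x n).map f = wordPow (x.map f) n := by
  simp [wordPow, List.map_flatten]

/-- The two-way infinite periodic word with period `x`. -/
def periodicWord (x : List A) (hx : x ≠ []) (i : ℤ) : A :=
  x[(i % (x.length : ℤ)).toNat]'(by
    have h : (0 : ℤ) < x.length := by exact_mod_cast List.length_pos_iff.mpr hx
    have := Int.emod_lt_of_pos i h
    have := Int.emod_nonneg i h.ne'
    omega)

theorem periodicWord_periodic (x : List A) (hx : x ≠ []) (i : ℤ) :
    periodicWord x hx (i + x.length) = periodicWord x hx i := by
  simp [periodicWord]

theorem getElem?_wordPow (x : List A) (hx : x ≠ []) (n k : ℕ) (hk : k < n * x.length) :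
    (wordPow x n)[k]? = some (periodicWord x hx k) := by
  have h0 := List.length_pos_iff.mpr hx
  induction n generalizing k with
  | zero => simp at hk
  | succ n ih =>
    rw [wordPow_succ]
    by_cases h : k < x.length
    · rw [List.getElem?_append_left h, List.getElem?_eq_getElem h]
      simp only [periodicWord, Option.some.injEq]
      congr 1
      rw [Int.emod_eq_of_lt (by omega) (by omega)]
      simp
    · rw [List.getElem?_append_right (by omega), ih _ (by rw [Nat.succ_mul] at hk; omega),
        ← periodicWord_periodic]
      congr 2
      omega

theorem cellAt_wordPow (x : List A) (hx : x ≠ []) (n : ℕ) :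
    cellAt (wordPow x n) = restr (periodicWord x hx) (Set.Ico 0 (n * (x.length : ℤ))) := by
  funext i
  by_cases h : i ∈ Set.Ico 0 (n * (x.length : ℤ))
  · rw [restr_of_mem h]
    simp only [cellAt, if_pos h.1]
    rw [getElem?_wordPow x hx n i.toNat (by zify; rw [Int.toNat_of_nonneg h.1]; exact h.2),
      Int.toNat_of_nonneg h.1]
  · rw [restr_of_notMem h, cellAt]
    split_ifs with h0
    · rw [List.getElem?_eq_none]
      rw [length_wordPow]
      simp only [Set.mem_Ico, not_and, not_lt] at h
      zify
      rw [Int.toNat_of_nonneg h0]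
      exact h h0
    · rfl

end Words

/-- A two-way transducer is aperiodic if it is steady on all periodic words. -/
theorem TwoDFT.aperiodic_of_steady {A : Type u} {B : Type v} (M : TwoDFT.{u, v, w} A B)
    (h : ∀ (x : ℤ → A) (L : ℤ), L ≠ 0 → (∀ i, x (i + L) = x i) →
      Steady M.step (fun i => .letter (x i)) L) : M.Aperiodic := by
  have := M.finite_state
  refine ⟨Nat.card M.State, fun x => ?_⟩
  by_cases hx : x = []
  · subst hx
    simp [wordPow_nil, TransEquiv]
  set n := Nat.card M.State
  have hL : (0 : ℤ) < x.length := by exact_mod_cast List.length_pos_iff.mpr hx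
  have hcell : ∀ m, cellAt ((wordPow x m).map TapeSym.letter) =
      restr (fun i => TapeSym.letter (periodicWord x hx i)) (Set.Ico 0 (m * (x.length : ℤ))) := by
    intro m
    rw [map_wordPow, cellAt_wordPow _ (by simpa using hx)]
    congr 1
    · funext i
      simp [periodicWord]
    · simp
  have hx' := periodicWord_periodic x hx
  set u := periodicWord x hx
  have ht : ∀ i, (fun i => TapeSym.letter (u i)) (i + x.length) = TapeSym.letter (u i) :=
    fun i => congrArg _ (hx' i)
  have hs := h u x.length hL.ne' hx'
  -- Steadiness for the negative period is what controls the right-to-left traversals.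
  have hs' : Steady (mirrorStep M.step) (fun i => TapeSym.letter (u (-1 - i))) x.length := by
    have := (h u (-x.length) (by omega) (fun i => by rw [← hx' (i + -x.length)]; simp)).mirror (-1)
    simpa using this
  have ht' : ∀ i, (fun i => TapeSym.letter (u (-1 - i))) (i + x.length) =
      TapeSym.letter (u (-1 - i)) := by
    intro i
    simp only
    rw [← hx' (-1 - (i + x.length))]
    congr 2; ring
  -- The reflection preserving the window of `m` periods depends on `m`, but by periodicity the
  -- reflected tape does not; both powers can thus be compared on a single mirrored tape.
  have hmir : ∀ (m : ℕ) p q (j : ℤ),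
      Reach M.step (restr (fun i => TapeSym.letter (u i)) (Set.Ico 0 (m * (x.length : ℤ))))
        (p, m * x.length - 1) (q, m * x.length - 1 - j) ↔
      Reach (mirrorStep M.step) (restr (fun i => TapeSym.letter (u (-1 - i)))
        (Set.Ico 0 (m * (x.length : ℤ)))) (p, 0) (q, j) := by
    intro m p q j
    rw [show restr (fun i => TapeSym.letter (u (-1 - i))) (Set.Ico 0 (m * (x.length : ℤ))) =
      fun i => restr (fun i => TapeSym.letter (u i)) (Set.Ico 0 (m * (x.length : ℤ)))
        (m * x.length - 1 - i) from ?_, reach_mirror_iff, sub_zero]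
    funext i
    have hp := periodic_nat_mul hx' m (-1 - i)
    rw [show -1 - i + m * (x.length : ℤ) = m * x.length - 1 - i by ring] at hp
    simp only [restr, Set.mem_Ico, hp]
    congr 1
    apply propext
    constructor <;> intro h <;> omega
  intro s t
  ext ⟨p, q⟩
  simp only [bh, Set.mem_ofPred_eq, exists_twoWayRun_iff, hcell, length_wordPow]
  rcases s with _ | _ <;> rcases t with _ | _ <;> simp only [Side.entry, Side.exit] <;> push_cast
  · exact_mod_cast reach_left_left_succ hL ht le_rfl p q
  · exact_mod_cast reach_left_right_succ hL ht hs le_rfl p q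
  · have := reach_left_right_succ hL ht' hs' le_rfl p q
    rw [← hmir, ← hmir] at this
    simpa using this
  · have := reach_left_left_succ (M := mirrorStep M.step)
      (t := fun i => TapeSym.letter (u (-1 - i))) hL ht' le_rfl p q
    rw [← hmir, ← hmir] at this
    simpa using this


/-! ## Composition with a sequential transducer -/

section AnnRun

variable {Γ : Type*} {Q : Type*}

/-- The run over `n` cells from cell `i` of a sequential transducer. -/
def annRun (δ : Q → Γ → Option Q) (t : ℤ → Option Γ) : Q → ℤ → ℕ → Option Q
  | q, _, 0 => some q
  | q, i, n + 1 => (t i).bind fun a => (δ q a).bind fun q' => annRun δ t q' (i + 1) n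

variable {δ : Q → Γ → Option Q} {t : ℤ → Option Γ}

theorem annRun_zero (q : Q) (i : ℤ) : annRun δ t q i 0 = some q := rfl

theorem annRun_succ (q : Q) (i : ℤ) (n : ℕ) : annRun δ t q i (n + 1) =
    (t i).bind fun a => (δ q a).bind fun q' => annRun δ t q' (i + 1) n := rfl

theorem annRun_one (q : Q) (i : ℤ) : annRun δ t q i 1 = (t i).bind (δ q) := by
  simp [annRun]

theorem annRun_add (q : Q) (i : ℤ) (m n : ℕ) : annRun δ t q i (m + n) =
    (annRun δ t q i m).bind fun q' => annRun δ t q' (i + m) n := by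
  induction m generalizing q i with
  | zero => simp [annRun]
  | succ m ih =>
    rw [Nat.succ_add, annRun_succ, annRun_succ, Option.bind_assoc]
    congr 1
    funext a
    rw [Option.bind_assoc]
    congr 1
    funext q'
    rw [ih]
    push_cast
    rw [add_assoc, add_comm 1 (m : ℤ)]

theorem annRun_shift {s : ℤ} (ht : ∀ i, t (i + s) = t i) (q : Q) (i : ℤ) (n : ℕ) :
    annRun δ t q (i + s) n = annRun δ t q i n := by
  induction n generalizing q i with
  | zero => rfl
  | succ n ih =>
    rw [annRun_succ, annRun_succ, ht]
    congr 1
    funext a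
    congr 1
    funext q'
    rw [add_right_comm, ih]

theorem annRun_of_consistent {t : ℤ → Γ} {α : ℤ → Q}
    (hα : ∀ i, δ (α i) (t i) = some (α (i + 1))) (i : ℤ) (n : ℕ) :
    annRun δ (total t) (α i) i n = some (α (i + n)) := by
  induction n generalizing i with
  | zero => simp [annRun]
  | succ n ih =>
    simp only [annRun_succ, total, Option.bind_some, hα]
    have := ih (i + 1)
    rw [this]
    congr 2
    push_cast; ring

/-- The candidates for the annotation of cell `k`, given the annotation `q` of cell `k + 1`, which
remain after looking at the `m` cells on the left of `k`. -/
def Cands (δ : Q → Γ → Option Q) (t : ℤ → Option Γ) (k : ℤ) (q : Q) (m : ℕ) : Set Q :=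
  {r | (∃ s, annRun δ t s (k - m) m = some r) ∧ annRun δ t r k 1 = some q}

/-- The annotation `r` of cell `k` can be recovered from the annotation `q` of cell `k + 1`. -/
def Landing (δ : Q → Γ → Option Q) (t : ℤ → Option Γ) (k : ℤ) (q r : Q) : Prop :=
  ∃ m, Cands δ t k q m = {r}

/-- The map `h` sends the states in cell `k - m` to the candidates for cell `k` they lead to. -/
def Tracks (δ : Q → Γ → Option Q) (t : ℤ → Option Γ) (k : ℤ) (q : Q) (m : ℕ)
    (h : Q → Option Q) : Prop :=
  ∀ s r, h s = some r ↔ annRun δ t s (k - m) m = some r ∧ annRun δ t r k 1 = some q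

variable {k : ℤ} {q r : Q} {m : ℕ} {h : Q → Option Q}

theorem Cands.subset (δ : Q → Γ → Option Q) (t : ℤ → Option Γ) (k : ℤ) (q : Q) (m : ℕ) :
    Cands δ t k q (m + 1) ⊆ Cands δ t k q m := by
  rintro r ⟨⟨s, hs⟩, hr⟩
  rw [add_comm m 1, annRun_add, Option.bind_eq_some_iff] at hs
  obtain ⟨s', -, h2⟩ := hs
  refine ⟨⟨s', ?_⟩, hr⟩
  convert h2 using 1
  congr 1
  push_cast; ring

theorem Cands.antitone (δ : Q → Γ → Option Q) (t : ℤ → Option Γ) (k : ℤ) (q : Q) :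
    Antitone (Cands δ t k q) := antitone_nat_of_succ_le (Cands.subset δ t k q)

theorem Tracks.candidates_eq (hh : Tracks δ t k q m h) : candidates h = Cands δ t k q m := by
  ext r
  simp only [candidates, Cands, Set.mem_ofPred_eq, hh _ r, exists_and_right]

theorem tracks_initCand {a : Γ} (ha : t k = some a) : Tracks δ t k q 0 (initCand δ q a) := by
  intro s r
  simp only [initCand, annRun_zero, annRun_one, ha, Option.bind_some]
  split_ifs with h
  · simp only [Option.some.injEq]
    exact ⟨fun e => ⟨e, e ▸ h⟩, fun e => e.1⟩
  · simp only [Option.some.injEq, false_iff, not_and]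
    rintro rfl
    exact h

theorem Tracks.step {a : Γ} (hh : Tracks δ t k q m h) (ha : t (k - m - 1) = some a) :
    Tracks δ t k q (m + 1) (stepCand δ h a) := by
  intro s r
  rw [add_comm m 1, annRun_add, annRun_one]
  push_cast
  rw [show k - (1 + m : ℤ) = k - m - 1 by ring, ha, sub_add_cancel]
  simp only [stepCand, Option.bind_eq_some_iff, hh _ r, Option.bind_some, ← and_assoc,
    exists_and_right]

theorem exists_cell_of_mem_Cands (hr : r ∈ Cands δ t k q (m + 1)) :
    ∃ a, t (k - m - 1) = some a := by
  obtain ⟨⟨s, hs⟩, -⟩ := hr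
  rw [annRun_succ, Option.bind_eq_some_iff] at hs
  obtain ⟨a, ha, -⟩ := hs
  exact ⟨a, by rw [← ha]; congr 1; push_cast; ring⟩

/-- The annotation `α` always remains among the candidates, at every depth of look-back. -/
theorem Landing.eq_of_consistent {t : ℤ → Γ} {α : ℤ → Q}
    (hα : ∀ i, δ (α i) (t i) = some (α (i + 1))) (h : Landing δ (total t) k (α (k + 1)) r) :
    r = α k := by
  obtain ⟨m, hm⟩ := h
  have : α k ∈ Cands δ (total t) k (α (k + 1)) m := by
    refine ⟨⟨α (k - m), ?_⟩, ?_⟩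
    · rw [annRun_of_consistent hα]; simp
    · rw [annRun_of_consistent hα]; simp
  rw [hm] at this
  exact (this : α k = r).symm

end AnnRun

/-! ### The look-back phase and the simulation it supports -/

section Lookback

variable {Γ : Type*} {Q : Type*} {P : Type*} {B : Type*} {δ : Q → Γ → Option Q}
  {C : TwoWayStep (Γ × Q) B P} {t : ℤ → Option Γ} {k : ℤ} {q r : Q} {m : ℕ} {h : Q → Option Q}

/-- The states `s` and `s'` in cell `k - m` lead to distinct states in cell `k` that merge after
reading this cell. -/
def Merging (δ : Q → Γ → Option Q) (t : ℤ → Option Γ) (k : ℤ) (m : ℕ) (s s' : Q) : Prop :=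
  ∃ r₁ r₂ q, annRun δ t s (k - m) m = some r₁ ∧ annRun δ t s' (k - m) m = some r₂ ∧ r₁ ≠ r₂ ∧
    annRun δ t r₁ k 1 = some q ∧ annRun δ t r₂ k 1 = some q

theorem Merging.fires_zero {s s' : Q} (hm : Merging δ t k 0 s s') (p : P) (r : Q) :
    Fires (compStep δ C) t (.fwd p r s s', k) [] (.sim p r, k) := by
  obtain ⟨r₁, r₂, q, h1, h2, hne, h3, h4⟩ := hm
  simp only [annRun_zero, Option.some.injEq] at h1 h2
  subst h1 h2
  rw [annRun_one, Option.bind_eq_some_iff] at h3 h4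
  obtain ⟨a, ha, h3⟩ := h3
  obtain ⟨a', ha', h4⟩ := h4
  rw [ha, Option.some.injEq] at ha'
  subst ha'
  exact ⟨a, .stay, ha, by simp [compStep, h3, h4], by simp [HeadMove.toInt]⟩

/-- Two runs that are still distinct in cell `k` cannot have merged earlier, so the head does not
stop before `k`. -/
theorem Merging.fires_succ {s s' : Q} (hm : Merging δ t k (m + 1) s s') (p : P) (r : Q) :
    ∃ u u', Merging δ t k m u u' ∧
      Fires (compStep δ C) t (.fwd p r s s', k - (m + 1 : ℕ)) [] (.fwd p r u u', k - m) := by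
  obtain ⟨r₁, r₂, q, h1, h2, hne, h3, h4⟩ := hm
  rw [annRun_succ, Option.bind_eq_some_iff] at h1 h2
  obtain ⟨a, ha, h1⟩ := h1
  obtain ⟨a', ha', h2⟩ := h2
  rw [ha, Option.some.injEq] at ha'
  subst ha'
  rw [Option.bind_eq_some_iff] at h1 h2
  obtain ⟨u, hu, h1⟩ := h1
  obtain ⟨u', hu', h2⟩ := h2
  have e : k - (m + 1 : ℕ) + 1 = k - m := by push_cast; ring
  rw [e] at h1 h2
  have hne' : u ≠ u' := by
    rintro rfl
    rw [h1, Option.some.injEq] at h2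
    exact hne h2
  exact ⟨u, u', ⟨r₁, r₂, q, h1, h2, hne, h3, h4⟩, a, .right, ha,
    by simp [compStep, hu, hu', hne'], by simp only [HeadMove.toInt, e]⟩

theorem Merging.run {s s' : Q} (hm : Merging δ t k m s s') (p : P) (r : Q) :
    Run (compStep δ C) t (.fwd p r s s', k - m) [] (.sim p r, k) := by
  induction m generalizing s s' with
  | zero => simpa using Run.fires (hm.fires_zero (C := C) p r)
  | succ m ih =>
    obtain ⟨u, u', h, hf⟩ := hm.fires_succ (C := C) p r
    exact .head hf (ih h)

/-- The previous map still had two candidates, so it provides the two states whose runs merge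
exactly on reading cell `k`. -/
theorem Tracks.fires_fwd (hh : Tracks δ t k q m h) (hn : (Cands δ t k q m).Nontrivial)
    (hr : Cands δ t k q (m + 1) = {r}) (p : P) :
    ∃ s s', Merging δ t k m s s' ∧
      Fires (compStep δ C) t (.back p h, k - m - 1) [] (.fwd p r s s', k - m) := by
  obtain ⟨a, ha⟩ := exists_cell_of_mem_Cands (by rw [hr]; rfl : r ∈ _)
  have e := (hh.step ha).candidates_eq
  rw [hr] at e
  have hx : ∃ r, candidates (stepCand δ h a) = {r} := ⟨r, e⟩
  have hst : ∃ st : Q × Q, ∃ r₁ r₂, h st.1 = some r₁ ∧ h st.2 = some r₂ ∧ r₁ ≠ r₂ := by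
    rw [← hh.candidates_eq] at hn
    obtain ⟨r₁, ⟨s₁, h₁⟩, r₂, ⟨s₂, h₂⟩, hne⟩ := hn
    exact ⟨(s₁, s₂), r₁, r₂, h₁, h₂, hne⟩
  have hc : hx.choose = r := Set.singleton_injective (hx.choose_spec.symm.trans e)
  obtain ⟨r₁, r₂, h1, h2, hne⟩ := hst.choose_spec
  rw [hh] at h1 h2
  refine ⟨hst.choose.1, hst.choose.2, ⟨r₁, r₂, q, h1.1, h2.1, hne, h1.2, h2.2⟩, a, .right, ha, ?_,
    by simp [HeadMove.toInt]⟩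
  simp only [compStep, dif_pos hx, dif_pos hst, hc]

theorem Tracks.fires_back {a : Γ} (hh : Tracks δ t k q m h)
    (hn : (Cands δ t k q (m + 1)).Nontrivial) (ha : t (k - m - 1) = some a) (p : P) :
    Fires (compStep δ C) t (.back p h, k - m - 1) []
      (.back p (stepCand δ h a), k - (m + 1 : ℕ) - 1) := by
  have e := (hh.step ha).candidates_eq
  have hx : ¬ ∃ r, candidates (stepCand δ h a) = {r} := by
    rintro ⟨r, hr⟩
    rw [e] at hr
    rw [hr] at hn
    exact Set.not_nontrivial_singleton hn
  rw [← e] at hn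
  refine ⟨a, .left, ha, ?_, ?_⟩
  · simp only [compStep, dif_neg hx, if_pos hn]
  · simp only [HeadMove.toInt]; push_cast; ring

theorem fires_prev_sim (hr : Cands δ t k q 0 = {r}) (p : P) :
    Fires (compStep δ C) t (.prev p q, k) [] (.sim p r, k) := by
  have hmem : r ∈ Cands δ t k q 0 := by rw [hr]; rfl
  obtain ⟨a, ha, -⟩ := Option.bind_eq_some_iff.mp ((annRun_one (δ := δ) r k).symm.trans hmem.2)
  have e := (tracks_initCand (δ := δ) (q := q) ha).candidates_eq
  rw [hr] at e
  have hx : ∃ r, candidates (initCand δ q a) = {r} := ⟨r, e⟩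
  have hc : hx.choose = r := Set.singleton_injective (hx.choose_spec.symm.trans e)
  exact ⟨a, .stay, ha, by simp only [compStep, dif_pos hx, hc], by simp [HeadMove.toInt]⟩

theorem fires_prev_back {a : Γ} (hn : (Cands δ t k q 0).Nontrivial) (ha : t k = some a) (p : P) :
    Fires (compStep δ C) t (.prev p q, k) [] (.back p (initCand δ q a), k - (0 : ℕ) - 1) := by
  have e := (tracks_initCand (δ := δ) (q := q) ha).candidates_eq
  have hx : ¬ ∃ r, candidates (initCand δ q a) = {r} := by
    rintro ⟨r, hr⟩
    rw [e] at hr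
    rw [hr] at hn
    exact Set.not_nontrivial_singleton hn
  rw [← e] at hn
  refine ⟨a, .left, ha, ?_, by simp [HeadMove.toInt, sub_eq_add_neg]⟩
  simp only [compStep, dif_neg hx, if_pos hn]

theorem Tracks.run {n : ℕ} (hh : Tracks δ t k q m h) (hn : (Cands δ t k q m).Nontrivial)
    (hr : Cands δ t k q (m + 1 + n) = {r}) (p : P) :
    Run (compStep δ C) t (.back p h, k - m - 1) [] (.sim p r, k) := by
  induction n generalizing m h with
  | zero =>
    obtain ⟨s, s', hm, hf⟩ := hh.fires_fwd (C := C) hn hr p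
    exact .head hf (hm.run p r)
  | succ n ih =>
    have hmem : r ∈ Cands δ t k q (m + 1) :=
      Cands.antitone δ t k q (by omega : m + 1 ≤ m + 1 + (n + 1)) (by rw [hr]; rfl)
    rcases Set.eq_singleton_or_nontrivial hmem with h1 | h1
    · obtain ⟨s, s', hm, hf⟩ := hh.fires_fwd (C := C) hn h1 p
      exact .head hf (hm.run p r)
    · obtain ⟨a, ha⟩ := exists_cell_of_mem_Cands hmem
      exact .head (hh.fires_back h1 ha p) (ih (hh.step ha) h1 (by rw [← hr]; congr 1; omega))

/-- The candidate sets decrease with the depth. They contain `r` up to the depth where only `r` is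
left, so the head keeps moving left until the first depth with a single candidate, and then returns.
-/
theorem Landing.run (hl : Landing δ t k q r) (p : P) :
    Run (compStep δ C) t (.prev p q, k) [] (.sim p r, k) := by
  obtain ⟨m, hm⟩ := hl
  have hmem : r ∈ Cands δ t k q 0 := Cands.antitone δ t k q (Nat.zero_le m) (by rw [hm]; rfl)
  rcases Set.eq_singleton_or_nontrivial hmem with h1 | h1
  · exact .fires (fires_prev_sim h1 p)
  · obtain ⟨a, ha, -⟩ := Option.bind_eq_some_iff.mp ((annRun_one (δ := δ) r k).symm.trans hmem.2)
    cases m with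
    | zero => rw [hm] at h1; exact absurd h1 Set.not_nontrivial_singleton
    | succ m =>
      exact .head (fires_prev_back h1 ha p)
        ((tracks_initCand ha).run h1 (n := m) (by rw [← hm]; congr 1; omega) p)

/-- A transition of the simulated machine, on a tape annotated by the stored states. -/
def SimStep (δ : Q → Γ → Option Q) (C : TwoWayStep (Γ × Q) B P) (t : ℤ → Option Γ)
    (c c' : (P × Q) × ℤ) : Prop :=
  ∃ a y d, t c.2 = some a ∧ C c.1.1 (a, c.1.2) = some (y, c'.1.1, d) ∧ c'.2 = c.2 + d.toInt ∧
    match d with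
    | .stay => c'.1.2 = c.1.2
    | .right => δ c.1.2 a = some c'.1.2
    | .left => Landing δ t c'.2 c.1.2 c'.1.2

/-- The configuration that represents a configuration of the simulated machine. -/
def simConf (c : (P × Q) × ℤ) : CompState P Q × ℤ := (.sim c.1.1 c.1.2, c.2)

theorem SimStep.reach {c c' : (P × Q) × ℤ} (hs : SimStep δ C t c c') :
    Reach (compStep δ C) t (simConf c) (simConf c') := by
  obtain ⟨a, y, d, ha, hC, hi, hd⟩ := hs
  cases d with
  | stay => 
    refine .single ⟨y, a, .stay, ha, ?_, hi⟩
    simp only at hd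
    simp [simConf, compStep, hC, hd]
  | right =>
    refine .single ⟨y, a, .right, ha, ?_, hi⟩
    simp only at hd
    simp [simConf, compStep, hC, hd]
  | left =>
    refine .head ⟨y, a, .left, ha, ?_, hi⟩ (hd.run c'.1.1).reach
    simp [simConf, compStep, hC]

/-- The runs between configurations that represent configurations of the simulated machine are
simulations of runs of it. -/
theorem Reach.simSteps {c c' : (P × Q) × ℤ} (hr : Reach (compStep δ C) t (simConf c) (simConf c')) :
    Relation.ReflTransGen (SimStep δ C t) c c' := by
  -- The invariants of the phases, propagated backwards from the end of the run. As the run ends in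
  -- a `sim` configuration, each look-back on the way is completed, and this yields the `Landing`
  -- required of a simulated left move.
  let G : CompState P Q × ℤ → Prop := fun d => match d.1 with
    | .sim p q => Relation.ReflTransGen (SimStep δ C t) ((p, q), d.2) c'
    | .prev p q => ∃ r, Landing δ t d.2 q r ∧
        Relation.ReflTransGen (SimStep δ C t) ((p, r), d.2) c'
    | .back p h => ∀ k q (m : ℕ), d.2 = k - m - 1 → Tracks δ t k q m h →
        (Cands δ t k q m).Nontrivial →
        ∃ r, Landing δ t k q r ∧ Relation.ReflTransGen (SimStep δ C t) ((p, r), k) c'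
    | .fwd p r s s' => ∀ k (m : ℕ), d.2 = k - m → Merging δ t k m s s' →
        Relation.ReflTransGen (SimStep δ C t) ((p, r), k) c'
  suffices ∀ d, Reach (compStep δ C) t d (simConf c') → G d from this _ hr
  intro d hd
  induction hd using Relation.ReflTransGen.head_induction_on with
  | refl => exact .refl
  | @head d e hde _ ih =>
    obtain ⟨y, hf⟩ := hde
    obtain ⟨d, i⟩ := d
    rcases d with ⟨p, q⟩ | ⟨p, q⟩ | ⟨p, h⟩ | ⟨p, r, s, s'⟩
    · show Relation.ReflTransGen (SimStep δ C t) ((p, q), i) c'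
      obtain ⟨a, m, ha, hs, hi⟩ := hf
      obtain ⟨e, j⟩ := e
      simp only at ha hs hi
      simp only [compStep] at hs
      split at hs
      · cases hs
      · next y' p' hC =>
        simp only [Option.some.injEq, Prod.mk.injEq] at hs
        obtain ⟨rfl, rfl, rfl⟩ := hs
        refine .head (b := ((_, _), j)) ⟨a, y', .stay, ha, hC, hi, rfl⟩ ih
      · next y' p' hC =>
        simp only [Option.map_eq_some_iff, Prod.mk.injEq] at hs
        obtain ⟨q', hq, rfl, rfl, rfl⟩ := hs
        exact .head (b := ((_, _), j)) ⟨a, y', .right, ha, hC, hi, hq⟩ ih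
      · next y' p' hC =>
        simp only [Option.some.injEq, Prod.mk.injEq] at hs
        obtain ⟨rfl, rfl, rfl⟩ := hs
        obtain ⟨r, hl, hr⟩ := ih
        exact .head (b := ((_, _), j)) ⟨a, y', .left, ha, hC, hi, hl⟩ hr
    · show ∃ r, Landing δ t i q r ∧ Relation.ReflTransGen (SimStep δ C t) ((p, r), i) c'
      have hf' := hf
      obtain ⟨a, m, ha, hs, hi⟩ := hf'
      have hT := tracks_initCand (δ := δ) (q := q) ha
      simp only [compStep] at hs
      split_ifs at hs with h1 h2 <;> rw [hT.candidates_eq] at *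
      · obtain ⟨r, hr⟩ := h1
        obtain ⟨-, rfl⟩ := hf.eq (fires_prev_sim (C := C) hr p)
        exact ⟨r, ⟨0, hr⟩, ih⟩
      · obtain ⟨-, rfl⟩ := hf.eq (fires_prev_back (C := C) h2 ha p)
        exact ih i q 0 rfl hT h2
    · intro k q m hk hT hn
      simp only at hk
      subst hk
      have hf' := hf
      obtain ⟨a, _, ha, hs, hi⟩ := hf'
      have hT' := hT.step ha
      simp only [compStep] at hs
      by_cases h1 : ∃ r, Cands δ t k q (m + 1) = {r}
      · obtain ⟨r, hr⟩ := h1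
        obtain ⟨s, s', hm, hf'⟩ := hT.fires_fwd (C := C) hn hr p
        obtain ⟨-, rfl⟩ := hf.eq hf'
        exact ⟨r, ⟨m + 1, hr⟩, ih k m rfl hm⟩
      · rw [dif_neg (by rwa [hT'.candidates_eq])] at hs
        split_ifs at hs with h2
        rw [hT'.candidates_eq] at h2
        obtain ⟨-, rfl⟩ := hf.eq (hT.fires_back (C := C) h2 ha p)
        exact ih k q (m + 1) rfl hT' h2
    · intro k m hk hm
      simp only at hk
      subst hk
      cases m with
      | zero =>
        simp only [Nat.cast_zero, sub_zero] at hf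
        obtain ⟨-, rfl⟩ := hf.eq (hm.fires_zero (C := C) p r)
        exact ih
      | succ m =>
        obtain ⟨u, u', hm', hf'⟩ := hm.fires_succ (C := C) p r
        obtain ⟨-, rfl⟩ := hf.eq hf'
        exact ih k m rfl hm'

end Lookback


/-! ### Cycles of the composition through simulating configurations -/

section CompSteady

variable {Γ : Type*} {Q : Type*} {P : Type*} {B : Type*} {δ : Q → Γ → Option Q}
  {C : TwoWayStep (Γ × Q) B P}

/-- Used to restart a cycle at its rightmost configuration, where the stored state can be compared
with itself. -/
theorem exists_max_on_path {α : Type*} {r : α → α → Prop} (f : α → ℤ) {c c' : α}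
    (h : Relation.ReflTransGen r c c') :
    ∃ m, Relation.ReflTransGen (fun a b => r a b ∧ f a ≤ f m ∧ f b ≤ f m) c m ∧
      Relation.ReflTransGen (fun a b => r a b ∧ f a ≤ f m ∧ f b ≤ f m) m c' := by
  induction h using Relation.ReflTransGen.head_induction_on with
  | refl => exact ⟨c', .refl, .refl⟩
  | @head c d h _ ih =>
    obtain ⟨m, h1, h2⟩ := ih
    have hd : f d ≤ f m := by
      rcases Relation.ReflTransGen.cases_head h1 with e | ⟨d', h, -⟩
      · rw [e]
      · exact h.2.1
    by_cases hc : f c ≤ f m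
    · exact ⟨m, .head ⟨h, hc, hd⟩ h1, h2⟩
    · refine ⟨c, .refl, .head ⟨h, le_rfl, by omega⟩ ?_⟩
      exact Relation.ReflTransGen.mono (fun a b h => ⟨h.1, by omega, by omega⟩) _ _ (h1.trans h2)

theorem Cands.shift {t : ℤ → Option Γ} {s : ℤ} (ht : ∀ i, t (i + s) = t i) (k : ℤ) (q : Q)
    (m : ℕ) : Cands δ t (k + s) q m = Cands δ t k q m := by
  ext r
  simp only [Cands, Set.mem_ofPred_eq, add_sub_right_comm, annRun_shift ht]

theorem SimStep.shift {t : ℤ → Option Γ} {s : ℤ} (ht : ∀ i, t (i + s) = t i)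
    {c c' : (P × Q) × ℤ} (h : SimStep δ C t c c') :
    SimStep δ C t (c.1, c.2 + s) (c'.1, c'.2 + s) := by
  obtain ⟨a, y, d, ha, hC, hi, hd⟩ := h
  refine ⟨a, y, d, by rw [← ha]; exact ht _, hC, by simp only [hi]; ring, ?_⟩
  cases d with
  | stay => exact hd
  | right => exact hd
  | left =>
    obtain ⟨m, hm⟩ := hd
    exact ⟨m, by rw [← hm]; exact Cands.shift ht _ _ _⟩

/-- The annotations met during a run lead to the same state at the right of this run. -/
theorem annRun_eq_of_simSteps {t : ℤ → Option Γ} {K : ℤ} {c c' : (P × Q) × ℤ}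
    (h : Relation.ReflTransGen (fun a b => SimStep δ C t a b ∧ a.2 ≤ K ∧ b.2 ≤ K) c c') :
    annRun δ t c.1.2 c.2 (K - c.2).toNat = annRun δ t c'.1.2 c'.2 (K - c'.2).toNat := by
  induction h with
  | refl => rfl
  | @tail d e _ h ih =>
    rw [ih]
    obtain ⟨⟨a, y, m, ha, -, hi, hd⟩, h1, h2⟩ := h
    cases m with
    | stay =>
      simp only [HeadMove.toInt, add_zero] at hd hi
      rw [hd, hi]
    | right =>
      simp only [HeadMove.toInt] at hd hi
      rw [show (K - d.2).toNat = (K - e.2).toNat + 1 by omega, annRun_succ, ha, hi]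
      simp only [Option.bind_some, hd]
    -- The stored state after a left move is a candidate, so reading one cell from it gives back the
    -- state stored before the move.
    | left =>
      simp only [HeadMove.toInt] at hd hi
      obtain ⟨m, hm⟩ := hd
      have hmem : e.1.2 ∈ Cands δ t e.2 d.1.2 m := by rw [hm]; rfl
      rw [show (K - e.2).toNat = 1 + (K - d.2).toNat by omega, annRun_add, hmem.2]
      simp only [Option.bind_some]
      rw [show e.2 + (1 : ℕ) = d.2 by rw [hi]; simp]

/-- In presence of a consistent annotation, the simulation follows the run on the annotated
tape. -/
theorem SimStep.of_consistent {t : ℤ → Γ} {α : ℤ → Q}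
    (hα : ∀ i, δ (α i) (t i) = some (α (i + 1))) {p : P} {i : ℤ} {c' : (P × Q) × ℤ}
    (h : SimStep δ C (total t) ((p, α i), i) c') :
    c' = ((c'.1.1, α c'.2), c'.2) ∧ Moves C (total fun i => (t i, α i)) (p, i) (c'.1.1, c'.2) := by
  obtain ⟨⟨p', q'⟩, i'⟩ := c'
  obtain ⟨a, y, d, ha, hC, hi, hd⟩ := h
  simp only [total, Option.some.injEq] at ha hC hi hd ⊢
  subst ha
  refine ⟨?_, y, _, d, rfl, hC, hi⟩
  cases d with
  | stay =>
    simp only [HeadMove.toInt, add_zero] at hd hi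
    rw [hd, hi]
  | right =>
    simp only [HeadMove.toInt] at hd hi
    rw [hα, Option.some.injEq] at hd
    rw [← hd, hi]
  | left =>
    simp only [HeadMove.toInt] at hd hi
    have : i = i' + 1 := by omega
    subst this
    rw [hd.eq_of_consistent hα]

section Periodic

variable {t : ℤ → Γ} {L : ℤ} {N : ℕ}

theorem total_natAbs (ht : ∀ i, t (i + L) = t i) (m : ℕ) (i : ℤ) :
    total t (i + (m * L.natAbs : ℕ)) = total t i := by
  have h : ∀ i, t (i + (L.natAbs : ℤ)) = t i := by
    intro i
    rcases Int.natAbs_eq L with e | e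
    · rw [← e]; exact ht i
    · rw [← ht (i + (L.natAbs : ℤ))]
      congr 1
      omega
  have := periodic_nat_mul h m i
  simp only [total]
  push_cast at this ⊢
  rw [this]

theorem annRun_stable
    (hδ : ∀ q i, annRun δ (total t) q i (N * L.natAbs) = annRun δ (total t) q i ((N + 1) * L.natAbs))
    {m : ℕ} (hm : N ≤ m) (q : Q) (i : ℤ) :
    annRun δ (total t) q i (m * L.natAbs) = annRun δ (total t) q i ((m + 1) * L.natAbs) := by
  obtain ⟨e, rfl⟩ := Nat.exists_eq_add_of_le' hm
  rw [add_mul, add_assoc, add_mul e, annRun_add, annRun_add]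
  congr 1
  funext q'
  exact hδ _ _

/-- The `d * N`-th and the `d * N + 1`-st iterates of the action of a period agree; on `q` the
former is the identity, so the action itself fixes `q`. -/
theorem annRun_cycle (ht : ∀ i, t (i + L) = t i)
    (hδ : ∀ q i, annRun δ (total t) q i (N * L.natAbs) = annRun δ (total t) q i ((N + 1) * L.natAbs))
    {d : ℕ} (hd : 1 ≤ d) {q : Q} {i : ℤ} (h : annRun δ (total t) q i (d * L.natAbs) = some q) :
    annRun δ (total t) q i L.natAbs = some q := by
  have h1 : ∀ e : ℕ, annRun δ (total t) q i (d * e * L.natAbs) = some q := by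
    intro e
    induction e with
    | zero => simp [annRun]
    | succ e ih =>
      rw [Nat.mul_succ, add_mul, annRun_add, ih, Option.bind_some,
        annRun_shift (total_natAbs ht _), h]
  have h2 := annRun_stable hδ (m := d * N) (Nat.le_mul_of_pos_left _ hd) q i
  rw [h1, add_mul, one_mul, annRun_add, h1, Option.bind_some,
    annRun_shift (total_natAbs ht _)] at h2
  exact h2.symm

/-- The counterpart of `annRun_cycle` for candidate maps, on which a period acts by precomposition.
-/
theorem bind_annRun_cycle (ht : ∀ i, t (i + L) = t i)
    (hδ : ∀ q i, annRun δ (total t) q i (N * L.natAbs) = annRun δ (total t) q i ((N + 1) * L.natAbs))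
    {d : ℕ} (hd : 1 ≤ d) {h : Q → Option Q} {i : ℤ}
    (hh : ∀ s, h s = (annRun δ (total t) s i (d * L.natAbs)).bind h) (s : Q) :
    h s = (annRun δ (total t) s i L.natAbs).bind h := by
  have h1 : ∀ (e : ℕ) s, (annRun δ (total t) s i (d * e * L.natAbs)).bind h = h s := by
    intro e
    induction e with
    | zero => simp [annRun]
    | succ e ih =>
      intro s
      rw [Nat.mul_succ, add_comm, add_mul, annRun_add, Option.bind_assoc, hh s]
      congr 1
      funext q'
      rw [annRun_shift (total_natAbs ht _), ih]
  have h2 := annRun_stable hδ (m := d * N) (Nat.le_mul_of_pos_left _ hd) s i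
  rw [← h1 N s, h2, add_comm, add_mul, one_mul, annRun_add, Option.bind_assoc]
  congr 1
  funext q'
  have := total_natAbs ht 1
  rw [one_mul] at this
  rw [annRun_shift this, h1]

/-- A state that comes back after a period gives rise to a periodic annotation. -/
theorem exists_annotation (hL : L ≠ 0) (ht : ∀ i, t (i + L) = t i) {q : Q} {i : ℤ}
    (h : annRun δ (total t) q i L.natAbs = some q) :
    ∃ α : ℤ → Q, α i = q ∧ (∀ j, δ (α j) (t j) = some (α (j + 1))) ∧ ∀ j, α (j + L) = α j := by
  have hpos : (0 : ℤ) < L.natAbs := by omega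
  have hdef : ∀ n ≤ L.natAbs, ∃ q', annRun δ (total t) q i n = some q' := by
    intro n hn
    rw [← Nat.add_sub_of_le hn, annRun_add, Option.bind_eq_some_iff] at h
    exact ⟨_, h.choose_spec.1⟩
  have : Nonempty Q := ⟨q⟩
  choose! f hf using hdef
  have f0 : f 0 = q := by
    have := hf 0 (by omega)
    simpa [annRun] using this.symm
  have fL : f L.natAbs = q := by
    have := hf L.natAbs le_rfl
    rw [h] at this
    exact (Option.some.inj this).symm
  have hstep : ∀ n < L.natAbs, δ (f n) (t (i + n)) = some (f (n + 1)) := by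
    intro n hn
    have := hf (n + 1) (by omega)
    rw [annRun_add, hf n (by omega), Option.bind_some, annRun_one] at this
    simpa [total] using this
  have ht1 : ∀ j m : ℤ, t (j + m * L.natAbs) = t j := by
    intro j m
    rcases Int.natAbs_eq m with e | e
    · have := total_natAbs ht m.natAbs j
      simp only [total, Option.some.injEq] at this
      rw [← this, Nat.cast_mul, ← e]
    · have := total_natAbs ht m.natAbs (j + m * L.natAbs)
      simp only [total, Option.some.injEq] at this
      rw [← this, Nat.cast_mul]
      congr 1
      rw [add_assoc, ← add_mul, show m + (m.natAbs : ℤ) = 0 by omega]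
      simp
  refine ⟨fun j => f ((j - i) % L.natAbs).toNat, by simp [f0], fun j => ?_, fun j => ?_⟩
  · have h0 := Int.emod_nonneg (j - i) hpos.ne'
    have h1 := Int.emod_lt_of_pos (j - i) hpos
    -- Consistency inside a period; at its end, the next index is `0` and `f L.natAbs = f 0` closes
    -- the cycle.
    have h2 := hstep ((j - i) % L.natAbs).toNat (by omega)
    rw [Int.toNat_of_nonneg h0] at h2
    have h3 : t j = t (i + (j - i) % L.natAbs) := by
      rw [← ht1 (i + (j - i) % L.natAbs) ((j - i) / L.natAbs)]
      congr 1
      have := Int.emod_add_mul_ediv (j - i) L.natAbs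
      linarith [mul_comm ((j - i) / (L.natAbs : ℤ)) L.natAbs]
    simp only
    rw [h3, h2]
    congr 1
    rw [show j + 1 - i = j - i + 1 by ring, ← Int.emod_add_emod]
    rcases (show (j - i) % L.natAbs + 1 ≤ L.natAbs by omega).lt_or_eq with h | h
    · rw [Int.emod_eq_of_lt (by omega) h]
      congr 1
      omega
    · rw [show ((j - i) % L.natAbs).toNat + 1 = L.natAbs by omega, fL, h]
      simp [f0]
  · simp only
    congr 2
    rw [show j + L - i = j - i + L by ring]
    exact Int.emod_eq_emod_iff_emod_sub_eq_zero.mpr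
      (Int.emod_eq_zero_of_dvd (by simp))

theorem ReflTransGen_shift {t : ℤ → Option Γ} {s : ℤ} (ht : ∀ i, t (i + s) = t i)
    {c c' : (P × Q) × ℤ} (h : Relation.ReflTransGen (SimStep δ C t) c c') :
    Relation.ReflTransGen (SimStep δ C t) (c.1, c.2 + s) (c'.1, c'.2 + s) :=
  Relation.ReflTransGen.lift (fun c : (P × Q) × ℤ => (c.1, c.2 + s))
    (fun _ _ h => h.shift ht) _ _ h

theorem reach_of_simSteps {t : ℤ → Option Γ} {c c' : (P × Q) × ℤ}
    (h : Relation.ReflTransGen (SimStep δ C t) c c') :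
    Reach (compStep δ C) t (simConf c) (simConf c') := by
  induction h with
  | refl => exact .refl
  | tail _ h ih => exact ih.trans h.reach

/-- At a rightmost configuration of the cycle, the stored state recurs after `d` periods of the
transducer, hence after one, and so extends to a periodic annotation. The run then projects to a
cycle of `C` on the annotated tape. Steadiness of `C` gives a shift by one period, which is lifted
back to the composition. -/
theorem sim_steady (hL : L ≠ 0) (ht : ∀ i, t (i + L) = t i)
    (hδ : ∀ q i, annRun δ (total t) q i (N * L.natAbs) = annRun δ (total t) q i ((N + 1) * L.natAbs))
    (hC : ∀ α : ℤ → Q, (∀ i, δ (α i) (t i) = some (α (i + 1))) → (∀ i, α (i + L) = α i) →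
      Steady C (fun i => (t i, α i)) L) {p : P} {q : Q} {i : ℤ} {d : ℕ} (hd : 1 ≤ d)
    (h : Reach (compStep δ C) (total t) (.sim p q, i) (.sim p q, i + d * L)) :
    ∃ p' i', Reach (compStep δ C) (total t) (.sim p q, i) (p', i') ∧
      Reach (compStep δ C) (total t) (p', i') (p', i' + L) := by
  have htt : ∀ (e : ℕ) i, total t (i + e * L) = total t i := fun e i =>
    congrArg some (periodic_nat_mul ht e i)
  have h0 := Reach.simSteps (c := ((p, q), i)) (c' := ((p, q), i + d * L)) h
  obtain ⟨⟨⟨p₁, q₁⟩, K⟩, h1, h2⟩ := exists_max_on_path Prod.snd h0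
  have hmono : ∀ {K : ℤ} {a b : (P × Q) × ℤ}, Relation.ReflTransGen
      (fun a b => SimStep δ C (total t) a b ∧ a.2 ≤ K ∧ b.2 ≤ K) a b →
      Relation.ReflTransGen (SimStep δ C (total t)) a b := fun h =>
    Relation.ReflTransGen.mono (fun _ _ h => h.1) _ _ h
  have hcyc := (hmono h2).trans (ReflTransGen_shift (htt d) (hmono h1))
  have hq : annRun δ (total t) q₁ K (d * L.natAbs) = some q₁ := by
    let K' := max K (K + d * L)
    have g2 : Relation.ReflTransGen
        (fun a b => SimStep δ C (total t) a b ∧ a.2 ≤ K' ∧ b.2 ≤ K') ((p₁, q₁), K)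
          ((p, q), i + d * L) :=
      Relation.ReflTransGen.mono (fun a b h => ⟨h.1, le_trans h.2.1 (le_max_left _ _),
        le_trans h.2.2 (le_max_left _ _)⟩) _ _ h2
    have g1 : Relation.ReflTransGen
        (fun a b => SimStep δ C (total t) a b ∧ a.2 ≤ K' ∧ b.2 ≤ K') ((p, q), i + d * L)
          ((p₁, q₁), K + d * L) :=
      Relation.ReflTransGen.lift (fun c : (P × Q) × ℤ => (c.1, c.2 + d * L))
        (fun a b h => ⟨h.1.shift (htt d), le_trans (by simpa using h.2.1) (le_max_right _ _),
          le_trans (by simpa using h.2.2) (le_max_right _ _)⟩) _ _ h1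
    have g := annRun_eq_of_simSteps (g2.trans g1)
    simp only at g
    -- By the choice of `K`, the cycle lies on the left of its rightmost endpoint: the start if `L <
    -- 0`, the end if `L > 0`. No cell remains to be read there, so the state at this endpoint is
    -- `q₁` itself.
    rcases lt_or_gt_of_ne hL with hneg | hpos
    · have e : (d : ℤ) * L = - (d * L.natAbs : ℕ) := by
        rw [Nat.cast_mul, show ((L.natAbs : ℕ) : ℤ) = -L by omega]; ring
      have e' : K' = K := max_eq_left (by rw [e]; omega)
      rw [e', e] at g
      simp only [sub_self, Int.toNat_zero, annRun_zero] at g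
      rw [show (K - (K + -((d * L.natAbs : ℕ) : ℤ))).toNat = d * L.natAbs by omega,
        ← annRun_shift (total_natAbs ht d), neg_add_cancel_right] at g
      exact g.symm
    · have e : (d : ℤ) * L = (d * L.natAbs : ℕ) := by
        rw [Nat.cast_mul, show ((L.natAbs : ℕ) : ℤ) = L by omega]
      have e' : K' = K + d * L := max_eq_right (by rw [e]; omega)
      rw [e', e] at g
      simp only [sub_self, Int.toNat_zero, annRun_zero] at g
      rwa [show (K + ((d * L.natAbs : ℕ) : ℤ) - K).toNat = d * L.natAbs by omega] at g
  obtain ⟨α, hαK, hα, hαL⟩ := exists_annotation hL ht (annRun_cycle ht hδ hd hq)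
  have hαd : ∀ (e : ℕ) j, α (j + e * L) = α j := fun e j => periodic_nat_mul hαL e j
  -- The translates of the maximal configuration, all on one endless run. On an infinite tape a
  -- look-back may fail to determine the annotation; a configuration that still has some `mc e`
  -- ahead of it is known not to be blocked.
  let mc : ℕ → (P × Q) × ℤ := fun e => ((p₁, α K), K + (e * d : ℕ) * L)
  have hmc : ∀ e, Relation.ReflTransGen (SimStep δ C (total t)) (mc e) (mc (e + 1)) := by
    intro e
    have := ReflTransGen_shift (htt (e * d)) hcyc
    rw [← hαK] at this
    simp only [mc]
    convert this using 2
    push_cast; ring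
  -- the simulation of runs of `C` from configurations on the periodic run
  have key : ∀ c c' : P × ℤ, Reach C (total fun i => (t i, α i)) c c' →
      (∃ e, Relation.ReflTransGen (SimStep δ C (total t)) ((c.1, α c.2), c.2) (mc e)) →
      Relation.ReflTransGen (SimStep δ C (total t)) ((c.1, α c.2), c.2)
        ((c'.1, α c'.2), c'.2) ∧
      ∃ e, Relation.ReflTransGen (SimStep δ C (total t)) ((c'.1, α c'.2), c'.2) (mc e) := by
    intro c c' hcc he
    induction hcc with
    | refl => exact ⟨.refl, he⟩
    | @tail c₁ c₂ _ h12 ih =>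
      obtain ⟨ih1, e, ih2⟩ := ih
      have hstep : ∀ e', ((c₁.1, α c₁.2), c₁.2) ≠ mc e' →
          Relation.ReflTransGen (SimStep δ C (total t)) ((c₁.1, α c₁.2), c₁.2) (mc e') →
          SimStep δ C (total t) ((c₁.1, α c₁.2), c₁.2) ((c₂.1, α c₂.2), c₂.2) ∧
          Relation.ReflTransGen (SimStep δ C (total t)) ((c₂.1, α c₂.2), c₂.2) (mc e') := by
        intro e' hne hr
        rcases Relation.ReflTransGen.cases_head hr with h | ⟨x, hx, hx'⟩
        · exact absurd h hne
        -- The next simulated step exists because the run goes on, and by determinism of `C` it is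
        -- the lift of the given move.
        · obtain ⟨hx1, hx2⟩ := hx.of_consistent hα
          have := Moves.rightUnique hx2 h12
          subst this
          rw [hx1] at hx hx'
          exact ⟨hx, hx'⟩
      by_cases heq : ((c₁.1, α c₁.2), c₁.2) = mc e
      -- At `mc e` itself the next translate serves as the target; it is a different configuration
      -- because `d * L ≠ 0`.
      · have hne : ((c₁.1, α c₁.2), c₁.2) ≠ mc (e + 1) := by
          rw [heq]
          intro h
          have := congrArg Prod.snd h
          simp only [mc, Nat.cast_mul, Nat.cast_add, Nat.cast_one] at this
          have h3 : (d : ℤ) * L = 0 := by linarith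
          rcases mul_eq_zero.mp h3 with h | h
          · omega
          · exact hL h
        obtain ⟨s1, s2⟩ := hstep _ hne (by rw [heq]; exact hmc e)
        exact ⟨ih1.tail s1, _, s2⟩
      · obtain ⟨s1, s2⟩ := hstep _ heq ih2
        exact ⟨ih1.tail s1, _, s2⟩
  have hCr : Reach C (total fun i => (t i, α i)) (p₁, K) (p₁, K + d * L) := by
    have : ∀ c', Relation.ReflTransGen (SimStep δ C (total t)) ((p₁, q₁), K) c' →
        Reach C (total fun i => (t i, α i)) (p₁, K) (c'.1.1, c'.2) ∧ c'.1.2 = α c'.2 := by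
      intro c' h
      induction h with
      | refl => exact ⟨.refl, hαK.symm⟩
      | @tail b c _ hbc ih =>
        obtain ⟨ih1, ih2⟩ := ih
        have hb : b = ((b.1.1, α b.2), b.2) := by rw [← ih2]
        rw [hb] at hbc
        obtain ⟨h1, h2⟩ := hbc.of_consistent hα
        exact ⟨ih1.tail h2, by rw [h1]⟩
    exact (this _ hcyc).1
  obtain ⟨p', i', r1, r2⟩ := hC α hα hαL p₁ K d hd hCr
  obtain ⟨s1, s2⟩ := key _ _ r1 ⟨0, by
    simp only [mc, Nat.cast_zero, zero_mul, add_zero]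
    exact .refl⟩
  obtain ⟨s3, -⟩ := key _ _ r2 s2
  simp only at s1 s3
  rw [hαL] at s3
  rw [hαK] at s1
  exact ⟨_, i', reach_of_simSteps ((hmono h1).trans s1), reach_of_simSteps s3⟩

end Periodic

end CompSteady


/-! ### Cycles inside a look-back, and steadiness of the composition -/

section CompSteady

variable {Γ : Type*} {Q : Type*} {P : Type*} {B : Type*} {δ : Q → Γ → Option Q}
  {C : TwoWayStep (Γ × Q) B P}

/-- The run from `c` to `c'` visits a configuration in which a transition is simulated. -/
def ViaSim (δ : Q → Γ → Option Q) (C : TwoWayStep (Γ × Q) B P) (t : ℤ → Option Γ)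
    (c c' : CompState P Q × ℤ) : Prop :=
  ∃ p q i, Reach (compStep δ C) t c (.sim p q, i) ∧ Reach (compStep δ C) t (.sim p q, i) c'

variable {t : ℤ → Option Γ}

theorem ViaSim.tail {c c' c'' : CompState P Q × ℤ} (h : ViaSim δ C t c c')
    (h' : Moves (compStep δ C) t c' c'') : ViaSim δ C t c c'' := by
  obtain ⟨p, q, i, h1, h2⟩ := h
  exact ⟨p, q, i, h1, Relation.ReflTransGen.tail h2 h'⟩

/-- Until the simulation resumes, the phase just runs the transducer from both states; the
intermediate configurations are kept in order to stop after exactly one period. -/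
theorem reach_fwd {p : P} {r s s' : Q} {i : ℤ} {c' : CompState P Q × ℤ}
    (h : Reach (compStep δ C) t (.fwd p r s s', i) c') : ViaSim δ C t (.fwd p r s s', i) c' ∨
      ∃ (n : ℕ) (u u' : Q), c' = (.fwd p r u u', i + n) ∧ annRun δ t s i n = some u ∧
        annRun δ t s' i n = some u' ∧ ∀ m ≤ n, ∃ v v',
          Reach (compStep δ C) t (.fwd p r s s', i) (.fwd p r v v', i + m) ∧
          annRun δ t s i m = some v ∧ annRun δ t s' i m = some v' := by
  induction h with
  | refl =>
    refine .inr ⟨0, s, s', by simp, rfl, rfl, fun m hm => ⟨s, s', ?_⟩⟩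
    obtain rfl : m = 0 := by omega
    simp only [Nat.cast_zero, add_zero]
    exact ⟨.refl, rfl, rfl⟩
  | @tail c d h1 h2 ih =>
    rcases ih with h | ⟨n, u, u', rfl, hu, hu', hn⟩
    · exact .inl (h.tail h2)
    · have h2' := h2
      obtain ⟨y, a, m, ha, hs, hi⟩ := h2
      simp only [compStep] at hs
      split at hs
      · next v v' hv hv' =>
        split_ifs at hs with e
        · simp only [Option.some.injEq, Prod.mk.injEq] at hs
          obtain ⟨-, hs, -⟩ := hs
          obtain ⟨d, j⟩ := d
          simp only at hs
          subst hs
          exact .inl ⟨p, r, j, h1.tail h2', .refl⟩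
        · simp only [Option.some.injEq, Prod.mk.injEq] at hs
          obtain ⟨-, hs, rfl⟩ := hs
          have hd : d = (.fwd p r v v', i + (n + 1 : ℕ)) := by
            refine Prod.ext hs.symm ?_
            simp only [hi, HeadMove.toInt]; push_cast; ring
          simp only at ha
          have hv1 : annRun δ t s i (n + 1) = some v := by
            rw [annRun_add, hu, Option.bind_some, annRun_one, ha]; exact hv
          have hv1' : annRun δ t s' i (n + 1) = some v' := by
            rw [annRun_add, hu', Option.bind_some, annRun_one, ha]; exact hv'
          refine .inr ⟨n + 1, v, v', hd, hv1, hv1', fun m hm => ?_⟩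
          rcases Nat.le_or_eq_of_le_succ hm with hm | rfl
          · exact hn m hm
          · exact ⟨v, v', by rw [← hd]; exact h1.tail h2', hv1, hv1'⟩
      · cases hs

/-- While the head moves left, the candidate map is the original one precomposed with the action of
the cells passed over. -/
theorem reach_back {p : P} {h : Q → Option Q} {i : ℤ} {c' : CompState P Q × ℤ}
    (hr : Reach (compStep δ C) t (.back p h, i) c') : ViaSim δ C t (.back p h, i) c' ∨
      (∃ r s s' j, c' = (.fwd p r s s', j)) ∨
      ∃ (n : ℕ) (h' : Q → Option Q), c' = (.back p h', i - n) ∧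
        (∀ s, h' s = (annRun δ t s (i + 1 - n) n).bind h) ∧ ∀ m ≤ n, ∃ h'',
          Reach (compStep δ C) t (.back p h, i) (.back p h'', i - m) ∧
          ∀ s, h'' s = (annRun δ t s (i + 1 - m) m).bind h := by
  induction hr with
  | refl =>
    refine .inr (.inr ⟨0, h, by simp, fun s => rfl, fun m hm => ⟨h, ?_, ?_⟩⟩)
    · obtain rfl : m = 0 := by omega
      simp only [Nat.cast_zero, sub_zero]
      exact .refl
    · obtain rfl : m = 0 := by omega
      exact fun s => rfl
  | @tail c d h1 h2 ih =>
    rcases ih with h | ⟨r, s, s', j, rfl⟩ | ⟨n, h', rfl, hh', hn⟩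
    · exact .inl (h.tail h2)
    · have := reach_fwd (Relation.ReflTransGen.single h2)
      rcases this with ⟨p', q', j', h3, h4⟩ | ⟨n, u, u', rfl, -⟩
      · exact .inl ⟨p', q', j', Reach.trans h1 h3, h4⟩
      · exact .inr (.inl ⟨_, _, _, _, rfl⟩)
    · have h2' := h2
      obtain ⟨y, a, m, ha, hs, hi⟩ := h2
      simp only [compStep] at hs
      split_ifs at hs with e1 e2 e3
      · simp only [Option.some.injEq, Prod.mk.injEq] at hs
        obtain ⟨-, hs, -⟩ := hs
        exact .inr (.inl ⟨_, _, _, d.2, Prod.ext hs.symm rfl⟩)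
      · simp only [Option.some.injEq, Prod.mk.injEq] at hs
        obtain ⟨-, hs, rfl⟩ := hs
        have hd : d = (.back p (stepCand δ h' a), i - (n + 1 : ℕ)) := by
          refine Prod.ext hs.symm ?_
          simp only [hi, HeadMove.toInt]; push_cast; ring
        simp only at ha
        have hst : ∀ s, stepCand δ h' a s =
            (annRun δ t s (i + 1 - (n + 1 : ℕ)) (n + 1)).bind h := by
          intro s
          rw [annRun_succ, show i + 1 - (n + 1 : ℕ) = i - n by push_cast; ring, ha,
            Option.bind_some, Option.bind_assoc, stepCand]
          congr 1
          funext q'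
          rw [hh', show i - n + 1 = i + 1 - n by ring]
        refine .inr (.inr ⟨n + 1, _, hd, hst, fun m hm => ?_⟩)
        rcases Nat.le_or_eq_of_le_succ hm with hm | rfl
        · exact hn m hm
        · exact ⟨_, by rw [← hd]; exact h1.tail h2', hst⟩

/-- A `prev` configuration is left at once, and `prev` is entered only from a simulating
configuration; so a nontrivial cycle at `prev` goes through the simulation. -/
theorem reach_prev {p : P} {q : Q} {i : ℤ} {c' : CompState P Q × ℤ}
    (hr : Reach (compStep δ C) t (.prev p q, i) c') : ViaSim δ C t (.prev p q, i) c' ∨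
      c' = (.prev p q, i) ∨ (∃ r s s' j, c' = (.fwd p r s s', j)) ∨
      ∃ h j, c' = (.back p h, j) := by
  rcases Relation.ReflTransGen.cases_head hr with h | ⟨d, h, h'⟩
  · exact .inr (.inl h.symm)
  · have h2 := h
    obtain ⟨y, a, m, ha, hs, hi⟩ := h2
    obtain ⟨d, j⟩ := d
    simp only [compStep] at hs
    split_ifs at hs with e1 e2 
    · simp only [Option.some.injEq, Prod.mk.injEq] at hs
      obtain ⟨-, rfl, -⟩ := hs
      exact .inl ⟨_, _, _, .single h, h'⟩
    · simp only [Option.some.injEq, Prod.mk.injEq] at hs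
      obtain ⟨-, rfl, -⟩ := hs
      rcases reach_back h' with ⟨p', q', j', h3, h4⟩ | ⟨r, s, s', j, rfl⟩ | ⟨n, h', rfl, -⟩
      · exact .inl ⟨p', q', j', .head h h3, h4⟩
      · exact .inr (.inr (.inl ⟨_, _, _, _, rfl⟩))
      · exact .inr (.inr (.inr ⟨_, _, rfl⟩))

/-- The composition of a steady machine with an aperiodic sequential transducer is steady. -/
theorem comp_steady {t : ℤ → Γ} {L : ℤ} {N : ℕ} (hL : L ≠ 0) (ht : ∀ i, t (i + L) = t i)
    (hδ : ∀ q i, annRun δ (total t) q i (N * L.natAbs) = annRun δ (total t) q i ((N + 1) * L.natAbs))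
    (hC : ∀ α : ℤ → Q, (∀ i, δ (α i) (t i) = some (α (i + 1))) → (∀ i, α (i + L) = α i) →
      Steady C (fun i => (t i, α i)) L) : Steady (compStep δ C) t L := by
  intro c i d hd h
  have hdL : (d : ℤ) * L ≠ 0 := mul_ne_zero (by omega) hL
  have hsim : ViaSim δ C (total t) (c, i) (c, i + d * L) →
      ∃ p' i', Reach (compStep δ C) (total t) (c, i) (p', i') ∧
      Reach (compStep δ C) (total t) (p', i') (p', i' + L) := by
    rintro ⟨p, q, j, h1, h2⟩
    -- The cycle is rotated so as to start at the simulating configuration that it visits.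
    have h3 := h2.trans (h1.total_shift (periodic_nat_mul ht d))
    obtain ⟨p', i', h4, h5⟩ := sim_steady hL ht hδ hC hd h3
    exact ⟨p', i', h1.trans h4, h5⟩
  have hmul : ∀ n : ℕ, (n : ℤ) = d * L ∨ (n : ℤ) = - (d * L) →
      n = d * L.natAbs ∧ L.natAbs ≤ n := by
    intro n hn
    have : n = d * L.natAbs := by
      have := Int.natAbs_eq_natAbs_iff.mpr hn
      simpa [Int.natAbs_mul] using this
    exact ⟨this, by rw [this]; exact Nat.le_mul_of_pos_left _ hd⟩
  rcases c with ⟨p, q⟩ | ⟨p, q⟩ | ⟨p, g⟩ | ⟨p, r, s, s'⟩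
  · exact hsim ⟨p, q, i, .refl, h⟩
  · rcases reach_prev h with h1 | h1 | ⟨_, _, _, _, h1⟩ | ⟨_, _, h1⟩
    · exact hsim h1
    · have := congrArg Prod.snd h1
      simp only at this
      omega
    · cases h1
    · cases h1
  · rcases reach_back h with h1 | ⟨_, _, _, _, h1⟩ | ⟨n, g', h1, hg', hn⟩
    · exact hsim h1
    · cases h1
    · simp only [Prod.mk.injEq, CompState.back.injEq, true_and] at h1
      obtain ⟨rfl, h1⟩ := h1
      obtain ⟨rfl, hle⟩ := hmul n (.inr (by omega))
      have hLn : L = - (L.natAbs : ℤ) := by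
        by_contra hne
        have hpos : 0 < L := by omega
        have : (0 : ℤ) < d * L := mul_pos (by omega) hpos
        omega
      obtain ⟨g'', hr, hg''⟩ := hn _ hle
      have e1 := annRun_shift (δ := δ) (total_natAbs ht d)
      have e2 := annRun_shift (δ := δ) (total_natAbs ht 1)
      -- The map comes back after `d` periods, hence after one by aperiodicity. The cells read start
      -- just right of the final head position, whence `i + 1`.
      have hcyc := bind_annRun_cycle ht hδ hd (h := g) (i := i + 1) fun s => by
        rw [hg', ← e1, sub_add_cancel]
      have : g'' = g := by
        funext s
        rw [hg'', hcyc s, ← e2, one_mul, sub_add_cancel]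
      rw [this, show i - (L.natAbs : ℤ) = i + L by omega] at hr
      exact ⟨_, i, .refl, hr⟩
  · rcases reach_fwd h with h1 | ⟨n, u, u', h1, hu, hu', hn⟩
    · exact hsim h1
    · simp only [Prod.mk.injEq, CompState.fwd.injEq, true_and] at h1
      obtain ⟨⟨rfl, rfl⟩, h1⟩ := h1
      obtain ⟨rfl, hle⟩ := hmul n (.inl (by omega))
      have hLn : L = (L.natAbs : ℤ) := by
        by_contra hne
        have hpos : L < 0 := by omega
        have : (d : ℤ) * L < 0 := mul_neg_of_pos_of_neg (by omega) hpos
        omega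
      obtain ⟨v, v', hr, hv, hv'⟩ := hn _ hle
      rw [annRun_cycle ht hδ hd hu, Option.some.injEq] at hv
      rw [annRun_cycle ht hδ hd hu', Option.some.injEq] at hv'
      subst hv hv'
      rw [← hLn] at hr
      exact ⟨_, i, .refl, hr⟩

end CompSteady


/-! ### Steadiness of the composition with a right-to-left transducer -/

section ScanSteady

variable {A : Type*} {R : Type*} {Q : Type*} {P : Type*} {B : Type*}
  {δ : Q → TapeSym A × R → Option Q} {C : TwoWayStep ((TapeSym A × R) × Q) B P}

theorem compStepRL_toEnd_letter (ι : Q) (p₀ : P) (a : A) (r : R) :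
    compStepRL δ ι C p₀ .toEnd (.letter a, r) = some ([], .toEnd, .right) := rfl

theorem compStepRL_toStart_letter (ι : Q) (p₀ : P) (s : Q) (a : A) (r : R) :
    compStepRL δ ι C p₀ (.toStart s) (.letter a, r) =
      (δ s (.letter a, r)).map fun s' => ([], .toStart s', .left) := rfl

theorem compStepRL_run (ι : Q) (p₀ : P) (c : CompState P Q) (a : TapeSym A × R) :
    compStepRL δ ι C p₀ (.run c) a =
      (mirrorStep (compStep δ (mirrorStep C)) c a).map fun r => (r.1, .run r.2.1, r.2.2) := by
  obtain ⟨_ | a | _, r⟩ := a <;> rfl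

variable {t : ℤ → TapeSym A × R}

theorem reach_toEnd (hlet : ∀ i, ∃ a r, t i = (.letter a, r)) (ι : Q) (p₀ : P) {i : ℤ}
    {c' : ScanState P Q × ℤ} (h : Reach (compStepRL δ ι C p₀) (total t) (.toEnd, i) c') :
    ∃ n : ℕ, c' = (.toEnd, i + n) ∧
      ∀ m ≤ n, Reach (compStepRL δ ι C p₀) (total t) (.toEnd, i) (.toEnd, i + m) := by
  induction h with
  | refl =>
    refine ⟨0, by simp, fun m hm => ?_⟩
    obtain rfl : m = 0 := by omega
    simp only [Nat.cast_zero, add_zero]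
    exact .refl
  | @tail c d h1 h2 ih =>
    obtain ⟨n, rfl, hn⟩ := ih
    have h2' := h2
    obtain ⟨y, a, m, ha, hs, hi⟩ := h2
    obtain ⟨b, r, hb⟩ := hlet (i + n)
    simp only [total, hb, Option.some.injEq] at ha
    subst ha
    simp only [compStepRL_toEnd_letter, Option.some.injEq, Prod.mk.injEq] at hs
    obtain ⟨-, hs, rfl⟩ := hs
    have hd : d = (.toEnd, i + (n + 1 : ℕ)) := by
      refine Prod.ext hs.symm ?_
      simp only [hi, HeadMove.toInt]; push_cast; ring
    refine ⟨n + 1, hd, fun m hm => ?_⟩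
    rcases Nat.le_or_eq_of_le_succ hm with hm | rfl
    · exact hn m hm
    · rw [← hd]; exact h1.tail h2'

theorem reach_toStart (hlet : ∀ i, ∃ a r, t i = (.letter a, r)) (ι : Q) (p₀ : P) {i : ℤ} {s : Q}
    {c' : ScanState P Q × ℤ} (h : Reach (compStepRL δ ι C p₀) (total t) (.toStart s, i) c') :
    ∃ (n : ℕ) (s' : Q), c' = (.toStart s', i - n) ∧
      annRun δ (total fun i => t (0 - i)) s (0 - i) n = some s' ∧
      ∀ m ≤ n, ∃ u, Reach (compStepRL δ ι C p₀) (total t) (.toStart s, i) (.toStart u, i - m) ∧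
        annRun δ (total fun i => t (0 - i)) s (0 - i) m = some u := by
  induction h with
  | refl =>
    refine ⟨0, s, by simp, rfl, fun m hm => ⟨s, ?_⟩⟩
    obtain rfl : m = 0 := by omega
    simp only [Nat.cast_zero, sub_zero]
    exact ⟨.refl, rfl⟩
  | @tail c d h1 h2 ih =>
    obtain ⟨n, s', rfl, hs', hn⟩ := ih
    have h2' := h2
    obtain ⟨y, a, m, ha, hs, hi⟩ := h2
    obtain ⟨b, r, hb⟩ := hlet (i - n)
    simp only [total, hb, Option.some.injEq] at ha
    subst ha
    simp only [compStepRL_toStart_letter, Option.map_eq_some_iff, Prod.mk.injEq] at hs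
    obtain ⟨s'', hs'', -, hs, rfl⟩ := hs
    have hd : d = (.toStart s'', i - (n + 1 : ℕ)) := by
      refine Prod.ext hs.symm ?_
      simp only [hi, HeadMove.toInt]; push_cast; ring
    have hr : annRun δ (total fun i => t (0 - i)) s (0 - i) (n + 1) = some s'' := by
      rw [annRun_add, hs', Option.bind_some, annRun_one]
      simp only [total, show 0 - (0 - i + (n : ℤ)) = i - n by ring, hb, Option.bind_some, hs'']
    refine ⟨n + 1, s'', hd, hr, fun m hm => ?_⟩
    rcases Nat.le_or_eq_of_le_succ hm with hm | rfl
    · exact hn m hm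
    · exact ⟨s'', by rw [← hd]; exact h1.tail h2', hr⟩

/-- The composition of a steady machine with an aperiodic right-to-left sequential transducer is
steady on words without endmarkers. -/
theorem compRL_steady (hlet : ∀ i, ∃ a r, t i = (.letter a, r)) {L : ℤ} {N : ℕ} (hL : L ≠ 0)
    (ht : ∀ i, t (i + L) = t i) (ι : Q) (p₀ : P)
    (hδ : ∀ q i, annRun δ (total fun i => t (0 - i)) q i (N * L.natAbs) =
      annRun δ (total fun i => t (0 - i)) q i ((N + 1) * L.natAbs))
    (hC : ∀ β : ℤ → Q, (∀ i, δ (β (i + 1)) (t (i + 1)) = some (β i)) → (∀ i, β (i + L) = β i) →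
      Steady C (fun i => (t i, β i)) L) : Steady (compStepRL δ ι C p₀) t L := by
  have hL' : -L ≠ 0 := neg_ne_zero.mpr hL
  have ht' : ∀ i, (fun i => t (0 - i)) (i + -L) = (fun i => t (0 - i)) i := by
    intro i
    simp only
    rw [← ht (0 - i)]
    congr 1; ring
  rw [← Int.natAbs_neg] at hδ
  -- The `run` part is the left-to-right case on the reflected tape, for the period `-L`, reflected
  -- back.
  have hcomp : Steady (mirrorStep (compStep δ (mirrorStep C))) t L := by
    have := (comp_steady (C := mirrorStep C) hL' ht' hδ fun α hα hαL => ?_).mirror 0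
    · simpa using this
    · have h := (hC (fun i => α (0 - i)) (fun i => ?_) (fun i => ?_)).mirror 0
      · simpa using h
      · have : δ (α (0 - (i + 1))) (t (0 - (0 - (i + 1)))) = some (α (0 - (i + 1) + 1)) := hα _
        rw [show 0 - (0 - (i + 1)) = i + 1 by ring, show 0 - (i + 1) + 1 = 0 - i by ring] at this
        exact this
      · rw [← hαL (0 - i)]
        congr 1; ring
  intro c i d hd h
  have hmul : ∀ n : ℕ, (n : ℤ) = d * L ∨ (n : ℤ) = - (d * L) →
      n = d * L.natAbs ∧ L.natAbs ≤ n := by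
    intro n hn
    have : n = d * L.natAbs := by
      have := Int.natAbs_eq_natAbs_iff.mpr hn
      simpa [Int.natAbs_mul] using this
    exact ⟨this, by rw [this]; exact Nat.le_mul_of_pos_left _ hd⟩
  rcases c with _ | s | c
  · obtain ⟨n, h1, hn⟩ := reach_toEnd hlet ι p₀ h
    simp only [Prod.mk.injEq, true_and] at h1
    obtain ⟨rfl, hle⟩ := hmul n (.inl (by omega))
    have hLn : L = (L.natAbs : ℤ) := by
      by_contra hne
      have hpos : L < 0 := by omega
      have : (d : ℤ) * L < 0 := mul_neg_of_pos_of_neg (by omega) hpos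
      omega
    have := hn _ hle
    rw [← hLn] at this
    exact ⟨_, i, .refl, this⟩
  · obtain ⟨n, s', h1, hs', hn⟩ := reach_toStart hlet ι p₀ h
    simp only [Prod.mk.injEq, ScanState.toStart.injEq] at h1
    obtain ⟨rfl, h1⟩ := h1
    obtain ⟨rfl, hle⟩ := hmul n (.inr (by omega))
    have hLn : L = - (L.natAbs : ℤ) := by
      by_contra hne
      have hpos : 0 < L := by omega
      have : (0 : ℤ) < d * L := mul_pos (by omega) hpos
      omega
    obtain ⟨u, hr, hu⟩ := hn _ hle
    rw [← Int.natAbs_neg] at hs' hu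
    rw [annRun_cycle ht' hδ hd hs', Option.some.injEq] at hu
    rw [show i - (L.natAbs : ℤ) = i + L by omega, ← hu] at hr
    exact ⟨_, i, .refl, hr⟩
  · obtain ⟨e, h1, h2⟩ := Reach.of_embed (c := (c, i)) ScanState.run (compStepRL_run ι p₀) h
    obtain ⟨e, j⟩ := e
    simp only [Prod.mk.injEq, ScanState.run.injEq] at h1
    obtain ⟨rfl, rfl⟩ := h1
    obtain ⟨p', i', h3, h4⟩ := hcomp c i d hd h2
    exact ⟨.run p', i', h3.embed ScanState.run (compStepRL_run ι p₀),
      h4.embed ScanState.run (compStepRL_run ι p₀)⟩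

end ScanSteady


/-! ## The machine that follows the output structure -/

section Forest

variable {V : Type*}

/-- The vertex `v.1` at boundary `v.2` is a child of `w`. -/
def Child (E : ℤ → V → V → Prop) (v w : V × ℤ) : Prop := w.2 = v.2 + 1 ∧ E v.2 v.1 w.1

/-- The vertex `v` is a descendant of `w`. -/
def Desc (E : ℤ → V → V → Prop) : V × ℤ → V × ℤ → Prop := Relation.ReflTransGen (Child E)

variable {E : ℤ → V → V → Prop} {S : ℤ → Set V} {u v w : V × ℤ}

theorem Desc.trans (h : Desc E u v) (h' : Desc E v w) : Desc E u w :=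
  Relation.ReflTransGen.trans h h'

theorem Desc.le (h : Desc E v w) : v.2 ≤ w.2 := by
  induction h with
  | refl => exact le_rfl
  | tail _ h ih => rw [h.1]; omega

theorem Desc.eq (h : Desc E v w) (e : v.2 = w.2) : v = w := by
  rcases Relation.ReflTransGen.cases_head h with h | ⟨u, h1, h2⟩
  · exact h
  · have := Desc.le h2
    rw [h1.1] at this
    omega

theorem Desc.split {k : ℤ} (h : Desc E v w) (h1 : v.2 ≤ k) (h2 : k ≤ w.2) :
    ∃ Z, Desc E v (Z, k) ∧ Desc E (Z, k) w := by
  induction h using Relation.ReflTransGen.head_induction_on with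
  | refl =>
    refine ⟨w.1, ?_⟩
    rw [show (w.1, k) = w from Prod.ext rfl (by simp only; omega)]
    exact ⟨.refl, .refl⟩
  | @head a c h h' ih =>
    rcases h1.eq_or_lt with rfl | hlt
    · exact ⟨a.1, .refl, .head h h'⟩
    · obtain ⟨Z, g1, g2⟩ := ih (by rw [h.1]; omega)
      exact ⟨Z, .head h g1, g2⟩

/-- Usefulness is inherited by descendants. The set `S i` concerns the variables after cell `i`,
that is at boundary `i + 1`, hence the index `w.2 - 1`. -/
theorem Desc.useful (hS : ∀ i X Y, Y ∈ S (i + 1) → E (i + 1) X Y → X ∈ S i) (h : Desc E v w)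
    (hw : w.1 ∈ S (w.2 - 1)) : v.1 ∈ S (v.2 - 1) := by
  induction h using Relation.ReflTransGen.head_induction_on with
  | refl => exact hw
  | @head a c h _ ih =>
    rw [h.1, add_sub_cancel_right] at ih
    refine hS (a.2 - 1) _ _ (by rwa [sub_add_cancel]) (by rw [sub_add_cancel]; exact h.2)

theorem Desc.shift {L : ℤ} (hE : ∀ i, E (i + L) = E i) (h : Desc E v w) :
    Desc E (v.1, v.2 + L) (w.1, w.2 + L) :=
  Relation.ReflTransGen.lift (fun v : V × ℤ => (v.1, v.2 + L))
    (fun a b h => ⟨by simp only [h.1]; ring, by simp only [hE]; exact h.2⟩) _ _ h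

/-- The possible moves in the forest of the occurrences of variables. -/
inductive FollowMove (E : ℤ → V → V → Prop) (S : ℤ → Set V) :
    FollowState V × ℤ → FollowState V × ℤ → Prop
  | start (i : ℤ) : FollowMove E S (.start, i) (.start, i + 1)
  | up (X : V) (i : ℤ) : FollowMove E S (.inn X, i) (.out X, i + 1)
  | down (X Y : V) (i : ℤ) (h : E i Y X) : FollowMove E S (.inn X, i) (.inn Y, i - 1)
  | parent (X Y : V) (i : ℤ) (hY : Y ∈ S i) (h : E i X Y) (hu : ∀ Y' ∈ S i, E i X Y' → Y' = Y) :
      FollowMove E S (.out X, i) (.out Y, i + 1)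
  | sibling (X Y X' : V) (i : ℤ) (hY : Y ∈ S i) (h : E i X Y)
      (hu : ∀ Y' ∈ S i, E i X Y' → Y' = Y) (h' : E i X' Y) :
      FollowMove E S (.out X, i) (.inn X', i - 1)

/-- The configuration `c` is at the vertex `v`. -/
inductive AtVertex : FollowState V × ℤ → V × ℤ → Prop
  | inn (X : V) (i : ℤ) : AtVertex (.inn X, i) (X, i + 1)
  | out (X : V) (i : ℤ) : AtVertex (.out X, i) (X, i)

variable {c c' : FollowState V × ℤ} {r : FollowState V × ℤ → FollowState V × ℤ → Prop}

/-- A run that stays on the left of the vertex `w` remains below it. -/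
theorem FollowMove.desc (hS : ∀ i X Y, Y ∈ S (i + 1) → E (i + 1) X Y → X ∈ S i)
    (hw : w.1 ∈ S (w.2 - 1)) (hc : ∃ v, AtVertex c v ∧ Desc E v w)
    (h : Relation.ReflTransGen (fun a b => FollowMove E S a b ∧ a.2 < w.2) c c') :
    ∃ v, AtVertex c' v ∧ Desc E v w := by
  induction h with
  | refl => exact hc
  | tail _ h ih =>
    obtain ⟨v, hv, hd⟩ := ih
    obtain ⟨hm, hlt⟩ := h
    -- Strictly below `w`, the next vertex on the path to `w` is a useful parent, hence the unique
    -- one, to which the machine goes.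
    have hpar : ∀ X Y i, i < w.2 → Desc E (X, i) w → (∀ Y' ∈ S i, E i X Y' → Y' = Y) →
        Desc E (Y, i + 1) w := by
      intro X Y i hi hd hu
      rcases Relation.ReflTransGen.cases_head hd with h | ⟨⟨Y', j⟩, h1, h2⟩
      · rw [← h] at hi
        exact absurd hi (lt_irrefl _)
      · have hY' := Desc.useful hS h2 hw
        obtain ⟨rfl, hE⟩ := h1
        simp only [add_sub_cancel_right] at hY'
        rw [← hu Y' hY' hE]
        exact h2
    cases hm with
    | start => cases hv
    | up X i => cases hv; exact ⟨_, .out _ _, hd⟩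
    | down X Y i h =>
      cases hv
      refine ⟨_, .inn _ _, .head ⟨?_, ?_⟩ hd⟩
      · simp
      · simpa using h
    | parent X Y i hY h hu =>
      cases hv
      exact ⟨_, .out _ _, hpar X Y i hlt hd hu⟩
    | sibling X Y X' i hY h hu h' =>
      cases hv
      refine ⟨_, .inn _ _, .head ⟨?_, ?_⟩ (hpar X Y i hlt hd hu)⟩
      · simp
      · simpa using h'

/-- After the last crossing of boundary `k` to the left, the run stays on the left of `k`, so
`FollowMove.desc` keeps it below `W`. -/
theorem last_crossing (hr : ∀ a b, r a b → FollowMove E S a b) {k : ℤ}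
    (h : Relation.ReflTransGen r c c') (hc : k ≤ c.2) (hc' : c'.2 < k) :
    ∃ W, Relation.ReflTransGen r c (.inn W, k - 1) ∧
      Relation.ReflTransGen (fun a b => r a b ∧ a.2 < k) (.inn W, k - 1) c' := by
  induction h with
  | refl => omega
  | @tail a b hca h ih =>
    rcases lt_or_ge a.2 k with hlt | hge
    · obtain ⟨W, h1, h2⟩ := ih hlt
      exact ⟨W, h1, h2.tail ⟨h, hlt⟩⟩
    · have hm := hr _ _ h
      cases hm with
      | start => simp only at hge hc'; omega
      | up => simp only at hge hc'; omega
      | down X Y i =>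
        obtain rfl : i = k := by simp only at hge hc'; omega
        exact ⟨Y, hca.tail h, .refl⟩
      | parent => simp only at hge hc'; omega
      | sibling X Y X' i =>
        obtain rfl : i = k := by simp only at hge hc'; omega
        exact ⟨X', hca.tail h, .refl⟩

/-- Away from `start`, a boundary is crossed to the right only into an output state; `hv` excludes
the scanning state. -/
theorem first_crossing (hr : ∀ a b, r a b → FollowMove E S a b) {k : ℤ} (hv : ∃ v, AtVertex c v)
    (h : Relation.ReflTransGen r c c') (hc : c.2 < k) (hc' : k ≤ c'.2) :
    ∃ W, Relation.ReflTransGen (fun a b => r a b ∧ a.2 < k) c (.out W, k) ∧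
      Relation.ReflTransGen r (.out W, k) c' := by
  induction h using Relation.ReflTransGen.head_induction_on with
  | refl => omega
  | @head a b h hbc ih =>
    have hm := hr _ _ h
    obtain ⟨v, hv⟩ := hv
    rcases lt_or_ge b.2 k with hlt | hge
    · obtain ⟨W, h1, h2⟩ := ih (by cases hm with
        | start => cases hv
        | up => exact ⟨_, .out _ _⟩
        | down => exact ⟨_, .inn _ _⟩
        | parent => exact ⟨_, .out _ _⟩
        | sibling => exact ⟨_, .inn _ _⟩) hlt
      exact ⟨W, .head ⟨h, hc⟩ h1, h2⟩
    · cases hm with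
      | start => cases hv
      | up X i =>
        obtain rfl : i + 1 = k := by simp only at hge hc; omega
        exact ⟨X, .single ⟨h, hc⟩, hbc⟩
      | down => simp only at hge hc; omega
      | parent X Y i =>
        obtain rfl : i + 1 = k := by simp only at hge hc; omega
        exact ⟨Y, .single ⟨h, hc⟩, hbc⟩
      | sibling => simp only at hge hc; omega

/-- After a first move from an output configuration, only useful vertices are visited. -/
theorem useful_of_out (hS : ∀ i X Y, Y ∈ S (i + 1) → E (i + 1) X Y → X ∈ S i)
    (hr : ∀ a b, r a b → FollowMove E S a b) {X : V} {i : ℤ}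
    (h : Relation.ReflTransGen r (.out X, i) c) :
    c = (.out X, i) ∨ ∃ v, AtVertex c v ∧ v.1 ∈ S (v.2 - 1) := by
  have hS' : ∀ i X Y, Y ∈ S i → E i X Y → X ∈ S (i - 1) := fun i X Y h1 h2 =>
    hS (i - 1) X Y (by rwa [sub_add_cancel]) (by rwa [sub_add_cancel])
  induction h with
  | refl => exact .inl rfl
  | tail _ h ih =>
    right
    have hm := hr _ _ h
    cases hm with
    | start => rcases ih with e | ⟨v, hv, -⟩ <;> [cases e; cases hv]
    | up X i =>
      rcases ih with e | ⟨v, hv, hv'⟩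
      · cases e
      · cases hv; exact ⟨_, .out _ _, hv'⟩
    | down X Y i hE =>
      rcases ih with e | ⟨v, hv, hv'⟩
      · cases e
      · cases hv
        refine ⟨_, .inn _ _, ?_⟩
        simp only [add_sub_cancel_right] at hv' ⊢
        exact hS' _ _ _ hv' hE
    | parent X Y i hY => exact ⟨_, .out _ _, by simpa using hY⟩
    | sibling X Y X' i hY h hu h' =>
      exact ⟨_, .inn _ _, by simpa using hS' _ _ _ hY h'⟩

/-- The run goes straight down, or visits an output configuration. -/
theorem straight_or_out (hr : ∀ a b, r a b → FollowMove E S a b) {X : V} {i : ℤ}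
    (h : Relation.ReflTransGen r (.inn X, i) c) :
    (∃ Y j, Relation.ReflTransGen r (.inn X, i) (.out Y, j) ∧
      Relation.ReflTransGen r (.out Y, j) c) ∨
    ∃ (n : ℕ) (Y : V), c = (.inn Y, i - n) ∧ ∀ m ≤ n, ∃ Z,
      Relation.ReflTransGen r (.inn X, i) (.inn Z, i - m) ∧
      Desc E (Y, i - n + 1) (Z, i - m + 1) ∧ Desc E (Z, i - m + 1) (X, i + 1) := by
  induction h with
  | refl =>
    refine .inr ⟨0, X, by simp, fun m hm => ⟨X, ?_⟩⟩
    obtain rfl : m = 0 := by omega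
    simp only [Nat.cast_zero, sub_zero]
    exact ⟨.refl, .refl, .refl⟩
  | @tail a b h1 h2 ih =>
    rcases ih with ⟨Y, j, h3, h4⟩ | ⟨n, Y, rfl, hn⟩
    · exact .inl ⟨Y, j, h3, h4.tail h2⟩
    · have hm := hr _ _ h2
      cases hm with
      | up => exact .inl ⟨_, _, h1.tail h2, .refl⟩
      | down _ Z _ hE =>
        have e : i - (n + 1 : ℕ) = i - n - 1 := by push_cast; ring
        have hch : Desc E (Z, i - (n + 1 : ℕ) + 1) (Y, i - n + 1) := by
          refine .single ⟨by simp only [e]; ring, ?_⟩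
          simp only [e, sub_add_cancel]
          exact hE
        refine .inr ⟨n + 1, Z, by rw [e], fun m hm => ?_⟩
        rcases Nat.le_or_eq_of_le_succ hm with hm | rfl
        · obtain ⟨W, g1, g2, g3⟩ := hn m hm
          exact ⟨W, g1, hch.trans g2, g3⟩
        · obtain ⟨W, g1, g2, g3⟩ := hn n le_rfl
          exact ⟨Z, by rw [e]; exact h1.tail h2, .refl, hch.trans (g2.trans g3)⟩

/-- First passage through the next boundaries goes to the ancestors. -/
theorem climb_one (hS : ∀ i X Y, Y ∈ S (i + 1) → E (i + 1) X Y → X ∈ S i)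
    (hr : ∀ a b, r a b → FollowMove E S a b) {X : V} {k : ℤ}
    (h : Relation.ReflTransGen r (.out X, k) c) (hc : k < c.2) :
    ∃ Y, Relation.ReflTransGen r (.out X, k) (.out Y, k + 1) ∧
      Relation.ReflTransGen r (.out Y, k + 1) c ∧ Desc E (X, k) (Y, k + 1) := by
  rcases Relation.ReflTransGen.cases_head h with h | ⟨d, h1, h2⟩
  · rw [← h] at hc
    exact absurd hc (lt_irrefl _)
  · have hm := hr _ _ h1
    cases hm with
    | parent _ Y _ hY h hu => exact ⟨Y, .single h1, h2, .single ⟨rfl, h⟩⟩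
    | sibling _ Y X' _ hY h hu h' =>
      obtain ⟨W, g1, g2⟩ := first_crossing hr ⟨_, .inn _ _⟩ h2 (k := k + 1)
        (by simp only; omega) (by omega)
      obtain ⟨v, hv, hd⟩ := FollowMove.desc (w := (Y, k + 1)) hS (by simpa using hY)
        ⟨_, .inn X' (k - 1), .single ⟨by simp, by simpa using h'⟩⟩
        (Relation.ReflTransGen.mono (fun a b h => ⟨hr _ _ h.1, h.2⟩) _ _ g1)
      cases hv
      have e : W = Y := congrArg Prod.fst (hd.eq rfl)
      -- The run through the siblings stays below the parent `Y`, and the only descendant of `Y` at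
      -- its own boundary is `Y`.
      subst e
      exact ⟨W, .head h1 (Relation.ReflTransGen.mono (fun a b h => h.1) _ _ g1), g2,
        .single ⟨rfl, h⟩⟩

theorem climb (hS : ∀ i X Y, Y ∈ S (i + 1) → E (i + 1) X Y → X ∈ S i)
    (hr : ∀ a b, r a b → FollowMove E S a b) {X : V} {k : ℤ} (n : ℕ)
    (h : Relation.ReflTransGen r (.out X, k) c) (hc : k + n ≤ c.2) :
    ∃ Y, Relation.ReflTransGen r (.out X, k) (.out Y, k + n) ∧
      Relation.ReflTransGen r (.out Y, k + n) c ∧ Desc E (X, k) (Y, k + n) := by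
  induction n with
  | zero => exact ⟨X, by simpa using .refl, by simpa using h, by simpa using .refl⟩
  | succ n ih =>
    obtain ⟨Y, h1, h2, h3⟩ := ih (by push_cast at hc; omega)
    obtain ⟨Z, g1, g2, g3⟩ := climb_one hS hr h2 (by push_cast at hc; omega)
    push_cast
    rw [← add_assoc]
    exact ⟨Z, h1.trans g1, g2, h3.trans g3⟩

/-- Pigeonhole along a chain of linked choices, with one more vertex than there are elements of `V`.
-/
theorem exists_chain_repetition {V : Type*} [Finite V] (p : ℕ → V → Prop)
    (link : ℕ → V → V → Prop) (h0 : ∃ v, p 0 v)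
    (hs : ∀ m < Nat.card V, ∀ v, p m v → ∃ v', p (m + 1) v' ∧ link m v v') :
    ∃ (f : ℕ → V) (a b : ℕ), a < b ∧ b ≤ Nat.card V ∧ f a = f b ∧
      (∀ m ≤ Nat.card V, p m (f m)) ∧ ∀ m < Nat.card V, link m (f m) (f (m + 1)) := by
  obtain ⟨v₀, hv₀⟩ := h0
  choose! g hg hg' using hs
  let f : ℕ → V := fun n => Nat.rec v₀ (fun m v => g m v) n
  have hf : ∀ m ≤ Nat.card V, p m (f m) := by
    intro m
    induction m with
    | zero => exact fun _ => hv₀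
    | succ m ih => exact fun h => hg m (by omega) _ (ih (by omega))
  have : Fintype V := Fintype.ofFinite V
  obtain ⟨a, b, hab, e⟩ := Fintype.exists_ne_map_eq_of_card_lt
    (fun i : Fin (Nat.card V + 1) => f i) (by rw [Fintype.card_fin, ← Nat.card_eq_fintype_card]; omega)
  have hl : ∀ m < Nat.card V, link m (f m) (f (m + 1)) := fun m hm => hg' m hm _ (hf m hm.le)
  rcases lt_or_gt_of_ne hab with h | h
  · exact ⟨f, a, b, h, by omega, e, hf, hl⟩
  · exact ⟨f, b, a, h, by omega, e.symm, hf, hl⟩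

/-- A machine that moves in the forest is steady if the vertices on a cycle are equal. -/
theorem follow_steady [Finite V] {Γ B : Type*} {M : TwoWayStep Γ B (FollowState V)} {t : ℤ → Γ}
    {L : ℤ} (hL : L ≠ 0) (ht : ∀ i, t (i + L) = t i) (hE : ∀ i, E (i + L) = E i)
    (hS : ∀ i X Y, Y ∈ S (i + 1) → E (i + 1) X Y → X ∈ S i)
    (hM : ∀ a b, Moves M (total t) a b → FollowMove E S a b)
    (hstart : ∀ i, Moves M (total t) (.start, i) (.start, i + 1))
    (hcyc : ∀ X Y k (d : ℕ), Desc E (X, k) (Y, k + L.natAbs) →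
      Desc E (Y, k + L.natAbs) (X, k + L.natAbs + d * L.natAbs) → X = Y) :
    Steady M t L := by
  have hE' : ∀ (d : ℕ) i, E (i + d * L) = E i := fun d i => periodic_nat_mul hE d i
  have hiter : ∀ {c : FollowState V} {i : ℤ} {d : ℕ}, Reach M (total t) (c, i) (c, i + d * L) →
      ∀ e : ℕ, Reach M (total t) (c, i) (c, i + (e * d : ℕ) * L) := by
    intro c i d h e
    induction e with
    | zero => simp only [Nat.cast_zero, zero_mul, add_zero]; exact .refl
    | succ e ih =>
      have := h.total_shift (periodic_nat_mul ht (e * d))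
      simp only at this
      refine ih.trans ?_
      rwa [show (i + ((e + 1) * d : ℕ) * L) = i + d * L + (e * d : ℕ) * L by push_cast; ring]
  have hstart' : ∀ (i : ℤ) (n : ℕ), Reach M (total t) (.start, i) (.start, i + n) := by
    intro i n
    induction n with
    | zero => simp only [Nat.cast_zero, add_zero]; exact .refl
    | succ n ih =>
      push_cast
      rw [← add_assoc]
      exact Relation.ReflTransGen.tail ih (hstart _)
  have hEn : ∀ (d : ℕ) i, E (i + d * L.natAbs) = E i := by
    intro d i
    rcases Int.natAbs_eq L with e | e
    · rw [← e, hE']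
    · rw [← hE' d]
      congr 1
      rw [add_assoc, ← mul_add, show (L.natAbs : ℤ) + L = 0 by omega]
      simp
  -- The hypothesis `hcyc` with the cycle rotated, so that the single period comes last.
  have hcyc' : ∀ X Y k (d : ℕ), Desc E (X, k) (Y, k + d * L.natAbs) →
      Desc E (Y, k + d * L.natAbs) (X, k + d * L.natAbs + L.natAbs) → X = Y := by
    intro X Y k d h1 h2
    refine (hcyc _ _ _ d h2 ?_).symm
    have := h1.shift (hEn (d + 1))
    simp only at this
    convert this using 2 <;> push_cast <;> ring
  intro c i d hd h
  have hdL : (d : ℤ) * L ≠ 0 := mul_ne_zero (by omega) hL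
  rcases lt_or_gt_of_ne hL with hneg | hpos
  · have hLn : L = -(L.natAbs : ℤ) := by omega
    -- the case of a run from an output configuration
    have hout : ∀ X j, Reach M (total t) (.out X, j) (.out X, j + d * L) →
        ∃ p' i', Reach M (total t) (.out X, j) (p', i') ∧
          Reach M (total t) (p', i') (p', i' + L) := by
      intro X j h
      set n := Nat.card V
      -- The loop is repeated until the run ends beyond `n + 1` boundaries, enough for a repetition
      -- among `n` variables.
      have hc := hiter h (n + 1)
      set c' : FollowState V × ℤ := (.out X, j + ((n + 1) * d : ℕ) * L)
      have hc'2 : ∀ m ≤ n, c'.2 < j + m * L := by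
        intro m hm
        have h1 : (m : ℤ) < ((n + 1) * d : ℕ) := by
          have : n + 1 ≤ (n + 1) * d := Nat.le_mul_of_pos_right _ hd
          exact_mod_cast (by omega : m < (n + 1) * d)
        have := mul_lt_mul_of_neg_right h1 hneg
        simp only [c']
        linarith
      obtain ⟨f, a, b, hab, hb, e, hp, hl⟩ := exists_chain_repetition (V := V)
        (fun m W => Reach M (total t) (.out X, j) (.inn W, j + m * L - 1) ∧
          Relation.ReflTransGen (fun a b => Moves M (total t) a b ∧ a.2 < j + m * L)
            (.inn W, j + m * L - 1) c')
        (fun m W W' => Reach M (total t) (.inn W, j + m * L - 1) (.inn W', j + (m + 1 : ℕ) * L - 1) ∧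
          Desc E (W', j + (m + 1 : ℕ) * L) (W, j + m * L)) (by
          obtain ⟨W, h1, h2⟩ := last_crossing hM hc (k := j + (0 : ℕ) * L) (by simp)
            (hc'2 0 (Nat.zero_le _))
          exact ⟨W, h1, h2⟩) (by
          rintro m hm W ⟨h1, h2⟩
          obtain ⟨W', h3, h4⟩ := last_crossing (fun a b h => hM a b h.1) h2
            (k := j + (m + 1 : ℕ) * L) (by simp only; push_cast; linarith) (hc'2 _ hm)
          have h3' : Reach M (total t) (.inn W, j + m * L - 1) (.inn W', j + (m + 1 : ℕ) * L - 1) :=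
            Relation.ReflTransGen.mono (fun a b h => h.1) _ _ h3
          -- The run started in an output state, so it has entered only useful vertices; this is
          -- required in order to stay below `W`.
          have hW : W ∈ S (j + m * L - 1) := by
            rcases useful_of_out hS hM h1 with h | ⟨v, hv, hv'⟩
            · cases h
            · cases hv; simpa using hv'
          obtain ⟨v, hv, hd⟩ := FollowMove.desc (w := (W, j + m * L)) hS hW
            ⟨_, .inn _ _, by rw [sub_add_cancel]; exact .refl⟩
            (Relation.ReflTransGen.mono (fun a b h => ⟨hM _ _ h.1, h.2⟩) _ _ h3)
          cases hv
          rw [sub_add_cancel] at hd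
          exact ⟨W', ⟨h1.trans h3', Relation.ReflTransGen.mono (fun a b h => ⟨h.1.1, h.2⟩) _ _ h4⟩,
            h3', hd⟩)
      have hdesc : ∀ m m' : ℕ, m ≤ m' → m' ≤ n → Desc E (f m', j + m' * L) (f m, j + m * L) := by
        intro m m' hmm hm'
        induction m', hmm using Nat.le_induction with
        | base => exact .refl
        | succ m' hmm ih => exact (hl m' (by omega)).2.trans (ih (by omega))
      have h1 := hdesc a (a + 1) (by omega) (by omega)
      have h2 := hdesc (a + 1) b (by omega) hb
      have e1 : j + (a + 1 : ℕ) * L = j + b * L + (b - a - 1 : ℕ) * L.natAbs := by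
        rw [show ((b - a - 1 : ℕ) : ℤ) = b - a - 1 by omega, show (L.natAbs : ℤ) = -L by omega]
        push_cast; ring
      have e2 : j + a * L = j + b * L + (b - a - 1 : ℕ) * L.natAbs + L.natAbs := by
        rw [← e1, show (L.natAbs : ℤ) = -L by omega]
        push_cast; ring
      rw [e1] at h1 h2
      rw [e2] at h1
      rw [← e] at h2
      -- The vertices `f a` and `f (a + 1)`, one period apart, lie on a descending cycle closed by
      -- `f a = f b`; so they are equal, and the run from one to the other is the required shift by
      -- `L`.
      have := hcyc' _ _ _ _ h2 h1
      have h4 := (hl a (by omega)).1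
      rw [← this] at h4
      refine ⟨_, _, (hp a (by omega)).1, ?_⟩
      convert h4 using 2
      push_cast; ring
    rcases c with _ | X | X | _
    · exfalso
      have : ∀ c', Reach M (total t) (.start, i) c' → c'.1 = .start ∧ i ≤ c'.2 := by
        intro c' h
        induction h with
        | refl => exact ⟨rfl, le_rfl⟩
        | @tail a b _ h ih =>
          obtain ⟨ih1, ih2⟩ := ih
          have hm := hM _ _ h
          cases hm with
          | start j => exact ⟨rfl, by simp only at ih2 ⊢; omega⟩
          | up | down | parent | sibling => cases ih1
      have h1 := (this _ h).2
      simp only at h1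
      have : (d : ℤ) * L < 0 := mul_neg_of_pos_of_neg (by omega) hneg
      omega
    · rcases straight_or_out hM h with ⟨Y, j, h1, h2⟩ | ⟨n, Y, h1, hn⟩
      · obtain ⟨p', i', h3, h4⟩ := hout Y j
          (Reach.trans h2 (Reach.total_shift (periodic_nat_mul ht d) h1))
        exact ⟨p', i', Reach.trans h1 h3, h4⟩
      · simp only [Prod.mk.injEq, FollowState.inn.injEq] at h1
        obtain ⟨rfl, h1⟩ := h1
        have hn' : n = d * L.natAbs := by
          have : (n : ℤ) = d * L.natAbs := by
            rw [show (L.natAbs : ℤ) = -L by omega]; linarith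
          exact_mod_cast this
        subst hn'
        -- A run that only descends visits a descendant of `X` after one period, with a copy of `X`
        -- below it after `d` periods.
        obtain ⟨Z, g1, g2, g3⟩ := hn L.natAbs (Nat.le_mul_of_pos_left _ hd)
        have hd' : ((d - 1 : ℕ) : ℤ) = d - 1 := by omega
        have e1 : i - (L.natAbs : ℤ) + 1 =
            i - ((d * L.natAbs : ℕ) : ℤ) + 1 + (d - 1 : ℕ) * L.natAbs := by
          rw [hd', Nat.cast_mul]; ring
        rw [e1] at g2 g3
        rw [show i + 1 = i - ((d * L.natAbs : ℕ) : ℤ) + 1 + (d - 1 : ℕ) * L.natAbs + L.natAbs by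
          rw [hd', Nat.cast_mul]; ring] at g3
        rw [← hcyc' _ _ _ _ g2 g3, show i - (L.natAbs : ℤ) = i + L by omega] at g1
        exact ⟨_, i, .refl, g1⟩
    · exact hout X i h
    · exfalso
      rcases Relation.ReflTransGen.cases_head h with h | ⟨b, h, -⟩
      · have := congrArg Prod.snd h
        simp only at this
        omega
      · have hm := hM _ _ h
        cases hm
  · have hLn : L = (L.natAbs : ℤ) := by omega
    have hvar : (∃ v, AtVertex (c, i) v) → ∃ p' i', Reach M (total t) (c, i) (p', i') ∧
        Reach M (total t) (p', i') (p', i' + L) := by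
      intro hv
      set n := Nat.card V
      have hc := hiter h (n + 1)
      set c' : FollowState V × ℤ := (c, i + ((n + 1) * d : ℕ) * L)
      have hc'2 : ∀ m ≤ n, i + (m + 1 : ℕ) * L ≤ c'.2 := by
        intro m hm
        have h1 : ((m + 1 : ℕ) : ℤ) ≤ ((n + 1) * d : ℕ) := by
          have : n + 1 ≤ (n + 1) * d := Nat.le_mul_of_pos_right _ hd
          exact_mod_cast (by omega : m + 1 ≤ (n + 1) * d)
        have := mul_le_mul_of_nonneg_right h1 hpos.le
        simp only [c']
        linarith
      obtain ⟨f, a, b, hab, hb, e, hp, hl⟩ := exists_chain_repetition (V := V)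
        (fun m W => Reach M (total t) (c, i) (.out W, i + (m + 1 : ℕ) * L) ∧
          Reach M (total t) (.out W, i + (m + 1 : ℕ) * L) c')
        (fun m W W' => Reach M (total t) (.out W, i + (m + 1 : ℕ) * L)
            (.out W', i + (m + 1 + 1 : ℕ) * L) ∧
          Desc E (W, i + (m + 1 : ℕ) * L) (W', i + (m + 1 + 1 : ℕ) * L)) (by
          obtain ⟨W, h1, h2⟩ := first_crossing hM hv hc (k := i + (0 + 1 : ℕ) * L)
            (by simpa using hpos) (hc'2 0 (Nat.zero_le _))
          exact ⟨W, Relation.ReflTransGen.mono (fun a b h => h.1) _ _ h1, h2⟩) (by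
          rintro m hm W ⟨h1, h2⟩
          have e1 : i + (m + 1 + 1 : ℕ) * L = i + (m + 1 : ℕ) * L + L.natAbs := by
            rw [← hLn]; push_cast; ring
          have h3 := hc'2 (m + 1) hm
          rw [e1] at h3 ⊢
          -- Moving right, the first crossing of the next period boundary is at an ancestor of the
          -- present vertex.
          obtain ⟨W', g1, g2, g3⟩ := climb hS hM L.natAbs h2 h3
          exact ⟨W', ⟨h1.trans g1, g2⟩, g1, g3⟩)
      have hdesc : ∀ m m' : ℕ, m ≤ m' → m' ≤ n →
          Desc E (f m, i + (m + 1 : ℕ) * L) (f m', i + (m' + 1 : ℕ) * L) := by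
        intro m m' hmm hm'
        induction m', hmm using Nat.le_induction with
        | base => exact .refl
        | succ m' hmm ih => exact (ih (by omega)).trans (hl m' (by omega)).2
      have h1 := hdesc a (a + 1) (by omega) (by omega)
      have h2 := hdesc (a + 1) b (by omega) hb
      have e1 : i + (a + 1 + 1 : ℕ) * L = i + (a + 1 : ℕ) * L + L.natAbs := by
        rw [← hLn]; push_cast; ring
      have e2 : i + (b + 1 : ℕ) * L =
          i + (a + 1 : ℕ) * L + L.natAbs + (b - a - 1 : ℕ) * L.natAbs := by
        rw [show ((b - a - 1 : ℕ) : ℤ) = b - a - 1 by omega, ← hLn]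
        push_cast; ring
      rw [e1] at h1 h2
      rw [e2, ← e] at h2
      have := hcyc _ _ _ _ h1 h2
      have h4 := (hl a (by omega)).1
      rw [← this] at h4
      refine ⟨_, _, (hp a (by omega)).1, ?_⟩
      convert h4 using 2
      push_cast; ring
    rcases c with _ | X | X | _
    · have := hstart' i L.natAbs
      rw [← hLn] at this
      exact ⟨.start, i, .refl, this⟩
    · exact hvar ⟨_, .inn _ _⟩
    · exact hvar ⟨_, .out _ _⟩
    · exfalso
      rcases Relation.ReflTransGen.cases_head h with h | ⟨b, h, -⟩
      · have := congrArg Prod.snd h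
        simp only at this
        omega
      · have hm := hM _ _ h
        cases hm

end Forest


/-! ## Runs and flows of streaming string transducers -/

section Words

variable {X : Type*} {B : Type*}

theorem varCount_append (x : X) (y z : List (X ⊕ B)) :
    varCount x (y ++ z) = varCount x y + varCount x z := by simp [varCount]

theorem varCount_pos {x : X} {y : List (X ⊕ B)} : 0 < varCount x y ↔ Sum.inl x ∈ y := by
  classical
  rw [varCount, List.count_pos_iff]
  simp

namespace VarSubst

theorem ext_append (σ : VarSubst X B) (y z : List (X ⊕ B)) :
    σ.ext (y ++ z) = σ.ext y ++ σ.ext z := by simp [ext]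

theorem ext_cons_inl (σ : VarSubst X B) (x : X) (y : List (X ⊕ B)) :
    σ.ext (.inl x :: y) = σ x ++ σ.ext y := by simp [ext]

theorem ext_cons_inr (σ : VarSubst X B) (b : B) (y : List (X ⊕ B)) :
    σ.ext (.inr b :: y) = .inr b :: σ.ext y := by simp [ext]

theorem ext_one (y : List (X ⊕ B)) : VarSubst.one.ext y = y := by
  induction y with
  | nil => rfl
  | cons a y ih =>
    cases a with
    | inl x => rw [ext_cons_inl, ih]; rfl
    | inr b => rw [ext_cons_inr, ih]

theorem ext_comp (σ τ : VarSubst X B) (y : List (X ⊕ B)) :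
    (VarSubst.comp σ τ).ext y = σ.ext (τ.ext y) := by
  induction y with
  | nil => rfl
  | cons a y ih =>
    cases a with
    | inl x => rw [ext_cons_inl, ext_cons_inl, ext_append, ih]; rfl
    | inr b => rw [ext_cons_inr, ext_cons_inr, ext_cons_inr, ih]

theorem comp_assoc (σ τ υ : VarSubst X B) :
    VarSubst.comp (VarSubst.comp σ τ) υ = VarSubst.comp σ (VarSubst.comp τ υ) := by
  funext x
  exact ext_comp _ _ _

theorem one_comp (σ : VarSubst X B) : VarSubst.comp VarSubst.one σ = σ := by
  funext x
  exact ext_one _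

theorem comp_one (σ : VarSubst X B) : VarSubst.comp σ VarSubst.one = σ := by
  funext x
  show σ.ext [.inl x] = σ x
  simp [ext]

theorem mem_ext {σ : VarSubst X B} {y : List (X ⊕ B)} {x : X} :
    Sum.inl x ∈ σ.ext y ↔ ∃ z, Sum.inl z ∈ y ∧ Sum.inl x ∈ σ z := by
  simp [ext]

/-- Distinct variables of `y` are replaced at distinct places, so their contributions to the count
add up. -/
theorem two_le_varCount {σ : VarSubst X B} {y : List (X ⊕ B)} {x z z' : X} (hne : z ≠ z')
    (hz : Sum.inl z ∈ y) (hz' : Sum.inl z' ∈ y) (hx : Sum.inl x ∈ σ z) (hx' : Sum.inl x ∈ σ z') :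
    2 ≤ varCount x (σ.ext y) := by
  have hpos : ∀ {z y}, Sum.inl z ∈ y → Sum.inl x ∈ σ z → 0 < varCount x (σ.ext y) :=
    fun h h' => varCount_pos.mpr (mem_ext.mpr ⟨_, h, h'⟩)
  induction y with
  | nil => cases hz
  | cons a y ih =>
    rcases List.mem_cons.mp hz with e | h <;> rcases List.mem_cons.mp hz' with e' | h'
    · rw [← e] at e'
      exact absurd (Sum.inl.inj e').symm hne
    · rw [← e, ext_cons_inl, varCount_append]
      have := varCount_pos.mpr hx
      have := hpos h' hx'
      omega
    · rw [← e', ext_cons_inl, varCount_append]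
      have := varCount_pos.mpr hx'
      have := hpos h hx
      omega
    · refine (ih h h').trans ?_
      cases a with
      | inl w => rw [ext_cons_inl, varCount_append]; omega
      | inr b => rw [ext_cons_inr, ← List.singleton_append, varCount_append]; omega

end VarSubst

theorem mem_of_leading {y : List (X ⊕ B)} {z : List B} {x : X} (h : leading y = (z, some x)) :
    Sum.inl x ∈ y := by
  induction y generalizing z with
  | nil => simp [leading] at h
  | cons a y ih =>
    cases a with
    | inl w =>
      simp only [leading, Prod.mk.injEq, Option.some.injEq] at h
      simp [h.2]
    | inr b =>
      simp only [leading, Prod.mk.injEq] at h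
      exact List.mem_cons_of_mem _ (ih (Prod.ext rfl h.2))

theorem mem_of_mem_afterVar {y : List (X ⊕ B)} {x : X} {a : X ⊕ B} (h : a ∈ afterVar x y) :
    a ∈ y := by
  induction y with
  | nil => simp [afterVar] at h
  | cons c y ih =>
    cases c with
    | inl w =>
      simp only [afterVar] at h
      split_ifs at h
      · exact List.mem_cons_of_mem _ h
      · exact List.mem_cons_of_mem _ (ih h)
    | inr b => exact List.mem_cons_of_mem _ (ih h)

end Words

/-! ### Segments of a tape and the flow of variables along them -/

section Segments

variable {A : Type*}

/-- The word in the `n` cells from cell `j`. -/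
def seg (x : ℤ → A) : ℤ → ℕ → List A
  | _, 0 => []
  | j, n + 1 => x j :: seg x (j + 1) n

theorem seg_add (x : ℤ → A) (j : ℤ) (m n : ℕ) : seg x j (m + n) = seg x j m ++ seg x (j + m) n := by
  induction m generalizing j with
  | zero => simp [seg]
  | succ m ih =>
    rw [Nat.succ_add]
    simp only [seg, ih, List.cons_append]
    congr 3
    push_cast; ring

theorem seg_shift {x : ℤ → A} {s : ℤ} (hx : ∀ i, x (i + s) = x i) (j : ℤ) (n : ℕ) :
    seg x (j + s) n = seg x j n := by
  induction n generalizing j with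
  | zero => rfl
  | succ n ih => simp only [seg, hx, add_right_comm j s 1, ih]

theorem seg_mul {x : ℤ → A} {ℓ : ℕ} (hx : ∀ i, x (i + ℓ) = x i) (j : ℤ) (n : ℕ) :
    seg x j (n * ℓ) = wordPow (seg x j ℓ) n := by
  induction n with
  | zero => simp [seg, wordPow]
  | succ n ih => rw [Nat.succ_mul, add_comm, seg_add, seg_shift hx, ih, wordPow_succ]

/-- The composition of the substitutions in the `n` cells from cell `j`. -/
def segSubst {X B : Type*} (τ : ℤ → VarSubst X B) : ℤ → ℕ → VarSubst X B
  | _, 0 => VarSubst.one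
  | j, n + 1 => VarSubst.comp (τ j) (segSubst τ (j + 1) n)

variable {X B : Type*} {τ : ℤ → VarSubst X B}

theorem segSubst_add (j : ℤ) (m n : ℕ) : segSubst τ j (m + n) =
    VarSubst.comp (segSubst τ j m) (segSubst τ (j + m) n) := by
  induction m generalizing j with
  | zero => simp [segSubst, VarSubst.one_comp]
  | succ m ih =>
    rw [Nat.succ_add]
    simp only [segSubst, ih, VarSubst.comp_assoc]
    congr 3
    push_cast; ring

/-- Occurrence of a variable in another one in a cell. -/
def Occurs (τ : ℤ → VarSubst X B) (i : ℤ) (x y : X) : Prop := Sum.inl x ∈ τ i y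

/-- Links the algebra of substitutions, where boundedness and flows are stated, with paths between
variables. -/
theorem mem_segSubst {j : ℤ} {n : ℕ} {x y : X} :
    Sum.inl x ∈ segSubst τ j n y ↔ Desc (Occurs τ) (x, j) (y, j + n) := by
  induction n generalizing j x with
  | zero =>
    simp only [segSubst, VarSubst.one, List.mem_singleton, Sum.inl.injEq, Nat.cast_zero, add_zero]
    constructor
    · rintro rfl; exact .refl
    · intro h; exact congrArg Prod.fst (h.eq rfl)
  | succ n ih =>
    simp only [segSubst, VarSubst.comp, VarSubst.mem_ext, ih]
    have e : j + 1 + (n : ℤ) = j + (n + 1 : ℕ) := by push_cast; ring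
    rw [e]
    constructor
    · rintro ⟨z, h1, h2⟩
      exact .head (b := (z, j + 1)) ⟨rfl, h2⟩ h1
    · intro h
      rcases Relation.ReflTransGen.cases_head h with h | ⟨⟨z, k⟩, ⟨h1, h2⟩, h3⟩
      · have := congrArg Prod.snd h
        simp only at this
        omega
      · simp only at h1 h2
        subst h1
        exact ⟨z, h3, h2⟩

end Segments

/-! ### Consequences of an aperiodic flow monoid -/

namespace SST

variable {A : Type u} {B : Type v} {T : SST.{u, v, w} A B}

theorem run_append (p : T.State) (x y : List A) : T.run p (x ++ y) =
    (T.run p x).bind fun r => (T.run r.1 y).map fun s => (s.1, VarSubst.comp r.2 s.2) := by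
  induction x generalizing p with
  | nil => simp [run, VarSubst.one_comp]
  | cons a x ih =>
    simp only [List.cons_append, run, ih]
    cases h : T.step p a with
    | none => simp
    | some s =>
      cases h' : T.run s.1 x with
      | none => simp [h']
      | some r =>
        cases h'' : T.run r.1 y with
        | none => simp [h', h'']
        | some r' => simp [h', h'', VarSubst.comp_assoc]

theorem run_seg {x : ℤ → A} {q : ℤ → T.State} {τ : ℤ → VarSubst T.Var B}
    (h : ∀ i, T.step (q i) (x i) = some (q (i + 1), τ i)) (j : ℤ) (n : ℕ) :
    T.run (q j) (seg x j n) = some (q (j + n), segSubst τ j n) := by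
  induction n generalizing j with
  | zero => simp [seg, run, segSubst]
  | succ n ih =>
    simp only [seg, run, h, Option.bind_some, ih, Option.map_some, segSubst]
    congr 3
    push_cast; ring

/-- The flow records the target state by the position of the entries other than `⊥`; without
variables the matrix would be empty and show nothing. -/
theorem map_fst_run_of_flow_eq [Nonempty T.Var] {x y : List A} (h : T.flow x = T.flow y)
    (p : T.State) : (T.run p x).map Prod.fst = (T.run p y).map Prod.fst := by
  obtain ⟨X⟩ := ‹Nonempty T.Var›
  have h' : ∀ {x y : List A}, T.flow x = T.flow y → ∀ q, (T.run p x).map Prod.fst = some q →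
      (T.run p y).map Prod.fst = some q := by
    intro x y h q hq
    simp only [Option.map_eq_some_iff] at hq
    obtain ⟨⟨q', σ⟩, hr, rfl⟩ := hq
    have := congrFun (congrFun h (p, X)) (q', X)
    simp only [flow, hr, if_true] at this
    cases hy : T.run p y with
    | none => rw [hy] at this; exact absurd this (by simp)
    | some s =>
      rw [hy] at this
      simp only at this
      split_ifs at this with e
      · simp [e]
      · exact absurd this (by simp)
  ext q
  exact ⟨h' h q, h' h.symm q⟩

theorem varCount_eq_of_flow_eq {x y : List A} (h : T.flow x = T.flow y) {p q : T.State}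
    {σ σ' : VarSubst T.Var B} (hx : T.run p x = some (q, σ)) (hy : T.run p y = some (q, σ'))
    (X Y : T.Var) : varCount X (σ Y) = varCount X (σ' Y) := by
  have := congrFun (congrFun h (p, X)) (q, Y)
  simpa only [flow, hx, hy, if_true, WithBot.coe_inj, Nat.cast_inj] using this

/-- A positive exponent is needed because the initial annotation `none` is blocked by one letter but
not by the empty word. -/
theorem Aperiodic.exists_pos (h : T.Aperiodic) :
    ∃ n : ℕ, 1 ≤ n ∧ ∀ x : List A, T.flow (wordPow x n) = T.flow (wordPow x (n + 1)) := by
  obtain ⟨n, hn⟩ := h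
  rcases Nat.eq_zero_or_pos n with rfl | hpos
  · refine ⟨1, le_rfl, fun x => ?_⟩
    have h1 := hn x
    have h2 := hn (x ++ x)
    simp only [wordPow, List.replicate, List.flatten_nil, List.flatten_cons, List.append_nil]
      at h1 h2 ⊢
    rw [← h1, h2]
  · exact ⟨n, hpos, hn⟩

/-- Along a tape with a consistent annotation by states, the cells carry states and
substitutions. -/
theorem exists_states {x : ℤ → A} {α : ℤ → Option T.State}
    (hα : ∀ i, T.stateAnn (α i) (.letter (x i)) = some (α (i + 1))) :
    ∃ (q : ℤ → T.State) (τ : ℤ → VarSubst T.Var B), (∀ i, α i = some (q i)) ∧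
      ∀ i, T.step (q i) (x i) = some (q (i + 1), τ i) := by
  have h1 : ∀ i, ∃ q, α i = some q := by
    intro i
    have := hα i
    cases h : α i with
    | none => rw [h] at this; simp [stateAnn] at this
    | some q => exact ⟨q, rfl⟩
  choose q hq using h1
  have h2 : ∀ i, ∃ τ, T.step (q i) (x i) = some (q (i + 1), τ) := by
    intro i
    have := hα i
    rw [hq, hq] at this
    simp only [stateAnn, Option.map_eq_some_iff, Option.some.injEq] at this
    obtain ⟨⟨q', τ⟩, h, e⟩ := this
    exact ⟨τ, by rw [h, ← e]⟩
  choose τ hτ using h2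
  exact ⟨q, τ, hq, hτ⟩

theorem annRun_stateAnn (x : ℤ → A) (p : T.State) (i : ℤ) (n : ℕ) :
    annRun T.stateAnn (total fun i => .letter (x i)) (some p) i n =
      (T.run p (seg x i n)).map fun r => some r.1 := by
  induction n generalizing p i with
  | zero => simp [annRun, seg, run]
  | succ n ih =>
    simp only [annRun_succ, total, Option.bind_some, stateAnn, seg, run]
    cases h : T.step p (x i) with
    | none => simp
    | some s =>
      simp only [Option.map_some, Option.bind_some, Option.map_map]
      exact ih s.1 (i + 1)

theorem annRun_stateAnn_none (x : ℤ → A) (i : ℤ) (n : ℕ) :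
    annRun T.stateAnn (total fun i => .letter (x i)) none i (n + 1) = none := by
  simp [annRun_succ, total, stateAnn]

theorem natAbs_periodic {α : Type*} {f : ℤ → α} {L : ℤ} (h : ∀ i, f (i + L) = f i) (i : ℤ) :
    f (i + L.natAbs) = f i := by
  have := total_natAbs h 1 i
  simpa [total] using this

theorem stateAnn_aperiodic [Nonempty T.Var] {n : ℕ} (hn : 1 ≤ n)
    (h : ∀ x : List A, T.flow (wordPow x n) = T.flow (wordPow x (n + 1))) {x : ℤ → A} {L : ℤ}
    (hL : L ≠ 0) (hx : ∀ i, x (i + L) = x i) (q : Option T.State) (i : ℤ) :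
    annRun T.stateAnn (total fun i => .letter (x i)) q i (n * L.natAbs) =
      annRun T.stateAnn (total fun i => .letter (x i)) q i ((n + 1) * L.natAbs) := by
  cases q with
  | none =>
    obtain ⟨a, ha⟩ := Nat.exists_eq_succ_of_ne_zero (n := n * L.natAbs)
      (mul_ne_zero (by omega) (by omega))
    obtain ⟨b, hb⟩ := Nat.exists_eq_succ_of_ne_zero (n := (n + 1) * L.natAbs)
      (mul_ne_zero (by omega) (by omega))
    rw [ha, hb, annRun_stateAnn_none, annRun_stateAnn_none]
  | some p =>
    rw [annRun_stateAnn, annRun_stateAnn, seg_mul (natAbs_periodic hx), seg_mul (natAbs_periodic hx)]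
    have := congrArg (Option.map some) (map_fst_run_of_flow_eq (h (seg x i L.natAbs)) p)
    simpa only [Option.map_map, Function.comp_def] using this

section Periodic

variable {x : ℤ → A} {q : ℤ → T.State} {τ : ℤ → VarSubst T.Var B}
  {ℓ n : ℕ}

theorem occurs_periodic (hτ : ∀ i, T.step (q i) (x i) = some (q (i + 1), τ i))
    (hx : ∀ i, x (i + ℓ) = x i) (hq : ∀ i, q (i + ℓ) = q i)
    (i : ℤ) : Occurs τ (i + ℓ) = Occurs τ i := by
  have h1 := hτ (i + ℓ)
  rw [hq, hx, hτ i] at h1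
  simp only [Option.some.injEq, Prod.mk.injEq] at h1
  funext X Y
  simp only [Occurs, h1.2]

/-- By periodicity of `q`, both runs join the same pair of states, so equality of flows compares the
counts of `X` in `Y`. -/
theorem desc_stable (hτ : ∀ i, T.step (q i) (x i) = some (q (i + 1), τ i))
    (hx : ∀ i, x (i + ℓ) = x i) (hq : ∀ i, q (i + ℓ) = q i)
    (h : ∀ x : List A, T.flow (wordPow x n) = T.flow (wordPow x (n + 1))) (X Y : T.Var) (k : ℤ) :
    Desc (Occurs τ) (X, k) (Y, k + (n * ℓ : ℕ)) ↔
      Desc (Occurs τ) (X, k) (Y, k + ((n + 1) * ℓ : ℕ)) := by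
  rw [← mem_segSubst, ← mem_segSubst, ← varCount_pos, ← varCount_pos]
  have hq' : ∀ m : ℕ, q (k + (m * ℓ : ℕ)) = q k := fun m => by
    rw [Nat.cast_mul]; exact periodic_nat_mul hq m k
  have h1 := run_seg hτ k (n * ℓ)
  have h2 := run_seg hτ k ((n + 1) * ℓ)
  rw [seg_mul hx, hq'] at h1 h2
  rw [varCount_eq_of_flow_eq (h _) h1 h2]

/-- Aperiodicity absorbs the difference between the lengths of the flows: `X` flows to `X` and `Y`,
and both flow to `X`, in one common number of periods. For `X ≠ Y`, doubling this number gives two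
occurrences of `X` in the value of `X`. -/
theorem desc_cycle (hτ : ∀ i, T.step (q i) (x i) = some (q (i + 1), τ i))
    (hx : ∀ i, x (i + ℓ) = x i) (hq : ∀ i, q (i + ℓ) = q i)
    (hb : T.IsBounded 1)
    (h : ∀ x : List A, T.flow (wordPow x n) = T.flow (wordPow x (n + 1))) (X Y : T.Var) (k : ℤ)
    (d : ℕ) (h1 : Desc (Occurs τ) (X, k) (Y, k + ℓ))
    (h2 : Desc (Occurs τ) (Y, k + ℓ) (X, k + ℓ + d * ℓ)) : X = Y := by
  have hE := occurs_periodic hτ hx hq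
  have hEm : ∀ m : ℕ, ∀ i, Occurs τ (i + (m * ℓ : ℕ)) = Occurs τ i := fun m i => by
    rw [Nat.cast_mul]; exact periodic_nat_mul hE m i
  let D : ℕ → T.Var → T.Var → Prop := fun m X Y => Desc (Occurs τ) (X, k) (Y, k + (m * ℓ : ℕ))
  have Dt : ∀ {a b : ℕ} {X Y Z}, D a X Y → D b Y Z → D (a + b) X Z := by
    intro a b X Y Z h h'
    have := h'.shift (hEm a)
    simp only at this
    refine h.trans ?_
    rwa [show k + ((a + b) * ℓ : ℕ) = k + (b * ℓ : ℕ) + (a * ℓ : ℕ) by push_cast; ring]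
  -- Beyond `n` periods the duration can be decreased: `e` periods are split off, and stability is
  -- applied to the remaining `n + 1`.
  have Ds : ∀ e X Y, D (n + e + 1) X Y → D (n + e) X Y := by
    intro e X Y hD
    obtain ⟨Z, g1, g2⟩ := Desc.split hD (k := k + (e * ℓ : ℕ))
      (by simp only; omega)
      (by simp only; push_cast; nlinarith [Nat.zero_le (n * ℓ)])
    have e1 : ∀ m : ℕ, k + ((m + e) * ℓ : ℕ) = k + ((e * ℓ : ℕ) : ℤ) + (m * ℓ : ℕ) := fun m => by
      push_cast; ring
    rw [show n + e + 1 = n + 1 + e by ring, e1] at g2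
    simp only [D]
    rw [e1]
    exact g1.trans ((desc_stable hτ hx hq h Z Y _).mpr g2)
  have Ds' : ∀ e f X Y, D (n + e + f) X Y → D (n + e) X Y := by
    intro e f X Y hD
    induction f with
    | zero => exact hD
    | succ f ih => exact ih (by
      have := Ds (e + f) X Y (by rwa [← add_assoc n e f, add_assoc (n + e)])
      rwa [← add_assoc] at this)
  have d1 : D 1 X Y := by simpa [D] using h1
  have d2 : D d Y X := by
    have := h2.shift (L := -ℓ) (fun i => by rw [← hE (i + -ℓ), neg_add_cancel_right])
    simp only [add_neg_cancel_right] at this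
    simp only [D]
    convert this using 2
    push_cast; ring
  have d3 : ∀ e, D (e * (d + 1)) X X := by
    intro e
    induction e with
    | zero => simp only [D, Nat.zero_mul, Nat.cast_zero, add_zero]; exact .refl
    | succ e ih =>
      have := Dt (Dt d1 d2) ih
      rwa [show 1 + d + e * (d + 1) = (e + 1) * (d + 1) by ring] at this
  -- The cycle has length `d + 1`; its `n`-fold repetition is long enough for stability, and the
  -- common number of periods is `n + m`.
  obtain ⟨m, hm⟩ : ∃ m, n * (d + 1) = n + m := ⟨n * d, by ring⟩
  have d4 := d3 n
  have d5 := Ds' m 1 X Y (by rw [← hm]; exact Dt d4 d1)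
  have d6 := Ds' m d Y X (by rw [add_comm, ← hm]; exact Dt d2 d4)
  rw [hm] at d4
  by_contra hne
  have hu : ∀ {Z}, D (n + m) Z X →
      Sum.inl Z ∈ segSubst τ (k + ((n + m) * ℓ : ℕ)) ((n + m) * ℓ) X := by
    intro Z hZ
    rw [mem_segSubst]
    exact hZ.shift (hEm (n + m))
  have hcount := VarSubst.two_le_varCount hne (hu d4) (hu d6) (mem_segSubst.mpr d4)
    (mem_segSubst.mpr d5)
  have hrun := run_seg hτ k ((n + m) * ℓ + (n + m) * ℓ)
  have hle := hb _ _ _ _ hrun X X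
  rw [segSubst_add] at hle
  exact absurd (hcount.trans hle) (by norm_num)

end Periodic

end SST


/-! ### Aperiodicity of the useful annotation and of the built machine -/

namespace SST

variable {A : Type u} {B : Type v} {T : SST.{u, v, w} A B}

section Follow

variable {x : ℤ → A} {q : ℤ → T.State} {τ : ℤ → VarSubst T.Var B}

/-- Cell `i` of the reflected tape is cell `-i`, whose right boundary is `1 - i`. The annotation
thus turns into reachability, to which `desc_stable` applies. -/
theorem annRun_usefulAnn (hτ : ∀ i, T.step (q i) (x i) = some (q (i + 1), τ i)) (S : Set T.Var)
    (i : ℤ) (n : ℕ) :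
    annRun T.usefulAnn (total fun i => (.letter (x (0 - i)), some (q (0 - i)))) (some S) i n =
      some (some {X | ∃ Y ∈ S, Desc (Occurs τ) (X, 1 - i - n) (Y, 1 - i)}) := by
  induction n generalizing S i with
  | zero =>
    simp only [annRun_zero, Nat.cast_zero, sub_zero, Option.some.injEq]
    ext X
    constructor
    · exact fun h => ⟨X, h, .refl⟩
    · rintro ⟨Y, hY, h⟩
      have := congrArg Prod.fst (h.eq rfl)
      simp only at this
      exact this ▸ hY
  | succ n ih =>
    simp only [annRun_succ, total, Option.bind_some, usefulAnn, hτ, Option.map_some]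
    rw [ih {X | ∃ Y ∈ S, Sum.inl X ∈ τ (0 - i) Y} (i + 1)]
    congr 2
    ext X
    have e1 : 1 - (i + 1) - (n : ℤ) = 1 - i - (n + 1 : ℕ) := by push_cast; ring
    have e2 : 1 - (i + 1) = 0 - i := by ring
    rw [e1, e2]
    constructor
    · rintro ⟨Z, ⟨Y, hY, h1⟩, h2⟩
      exact ⟨Y, hY, h2.tail ⟨by simp only; ring, h1⟩⟩
    · rintro ⟨Y, hY, h⟩
      obtain ⟨Z, g1, g2⟩ := h.split (k := 0 - i) (by simp only; omega) (by simp only; omega)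
      refine ⟨Z, ⟨Y, hY, ?_⟩, g1⟩
      rcases Relation.ReflTransGen.cases_head g2 with h | ⟨⟨W, j⟩, ⟨h1, h2⟩, h3⟩
      · have := congrArg Prod.snd h
        simp only at this
        omega
      · simp only at h1
        have := congrArg Prod.fst (Desc.eq h3 (by simp only; omega))
        simp only at this
        rw [← this]
        exact h2

theorem annRun_usefulAnn_none (i : ℤ) (n : ℕ) :
    annRun T.usefulAnn (total fun i => (.letter (x (0 - i)), some (q (0 - i)))) none i (n + 1) =
      none := by
  simp [annRun_succ, total, usefulAnn]

theorem usefulAnn_aperiodic {n : ℕ} (hn : 1 ≤ n)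
    (h : ∀ x : List A, T.flow (wordPow x n) = T.flow (wordPow x (n + 1))) {L : ℤ} (hL : L ≠ 0)
    (hτ : ∀ i, T.step (q i) (x i) = some (q (i + 1), τ i)) (hx : ∀ i, x (i + L) = x i)
    (hq : ∀ i, q (i + L) = q i) (S : Option (Set T.Var)) (i : ℤ) :
    annRun T.usefulAnn (total fun i => (.letter (x (0 - i)), some (q (0 - i)))) S i (n * L.natAbs) =
      annRun T.usefulAnn (total fun i => (.letter (x (0 - i)), some (q (0 - i)))) S i
        ((n + 1) * L.natAbs) := by
  cases S with
  | none =>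
    obtain ⟨a, ha⟩ := Nat.exists_eq_succ_of_ne_zero (n := n * L.natAbs)
      (mul_ne_zero (by omega) (by omega))
    obtain ⟨b, hb⟩ := Nat.exists_eq_succ_of_ne_zero (n := (n + 1) * L.natAbs)
      (mul_ne_zero (by omega) (by omega))
    rw [ha, hb, annRun_usefulAnn_none, annRun_usefulAnn_none]
  | some S =>
    have hx' := natAbs_periodic hx
    have hq' := natAbs_periodic hq
    have hE := occurs_periodic hτ hx' hq'
    rw [annRun_usefulAnn hτ, annRun_usefulAnn hτ]
    congr 2
    ext X
    have hD : ∀ (m : ℕ) Y, Desc (Occurs τ) (X, 1 - i - (m * L.natAbs : ℕ)) (Y, 1 - i) ↔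
        Desc (Occurs τ) (X, 1 - i) (Y, 1 - i + (m * L.natAbs : ℕ)) := by
      intro m Y
      have hEm : ∀ i, Occurs τ (i + (m * L.natAbs : ℕ)) = Occurs τ i := fun i => by
        rw [Nat.cast_mul]; exact periodic_nat_mul hE m i
      constructor
      · intro h
        simpa using h.shift hEm
      · intro h
        have := h.shift (L := -(m * L.natAbs : ℕ))
          (fun i => by rw [← hEm (i + -_), neg_add_cancel_right])
        simpa [sub_eq_add_neg] using this
    simp only [Set.mem_ofPred_eq, hD, desc_stable hτ hx' hq' h]

variable {S : ℤ → Set T.Var}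

/-- Forgets the outputs and the order of occurrences; membership in the updates and uniqueness of
the useful parent suffice for steadiness. -/
theorem followStep_moves (hτ : ∀ i, T.step (q i) (x i) = some (q (i + 1), τ i))
    {a b : FollowState T.Var × ℤ}
    (h : Moves T.followStep (total fun i => ((.letter (x i), some (q i)), some (S i))) a b) :
    FollowMove (Occurs τ) S a b := by
  obtain ⟨p, i⟩ := a
  obtain ⟨p', i'⟩ := b
  obtain ⟨y, c, d, hc, hs, hi⟩ := h
  simp only [total, Option.some.injEq] at hc hs hi
  subst hc
  subst hi
  rcases p with _ | X | X | _
  · simp only [followStep, Option.some.injEq, Prod.mk.injEq] at hs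
    obtain ⟨-, rfl, rfl⟩ := hs
    exact .start _
  · simp only [followStep, hτ, Option.map_some, Option.some.injEq] at hs
    split at hs
    · simp only [Prod.mk.injEq] at hs
      obtain ⟨-, rfl, rfl⟩ := hs
      exact .up _ _
    · next y Y hl =>
      simp only [Prod.mk.injEq] at hs
      obtain ⟨-, rfl, rfl⟩ := hs
      exact .down _ _ _ (mem_of_leading hl)
  · simp only [followStep, hτ, Option.bind_some] at hs
    split_ifs at hs with hY
    obtain ⟨⟨h1, h2⟩, h3⟩ := hY.choose_spec
    split at hs
    · simp only [Option.some.injEq, Prod.mk.injEq] at hs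
      obtain ⟨-, rfl, rfl⟩ := hs
      exact .parent _ _ _ h1 h2 (fun Y' g1 g2 => h3 Y' ⟨g1, g2⟩)
    · next y X' hl =>
      simp only [Option.some.injEq, Prod.mk.injEq] at hs
      obtain ⟨-, rfl, rfl⟩ := hs
      exact .sibling _ _ _ _ h1 h2 (fun Y' g1 g2 => h3 Y' ⟨g1, g2⟩)
        (mem_of_mem_afterVar (mem_of_leading hl))
  · simp [followStep] at hs

theorem followStep_start (i : ℤ) :
    Moves T.followStep (total fun i => ((.letter (x i), some (q i)), some (S i)))
      (.start, i) (.start, i + 1) :=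
  ⟨[], _, .right, rfl, rfl, rfl⟩

end Follow

/-- The two-way transducer built from an aperiodic 1-bounded transducer is aperiodic. -/
theorem toTwoDFT_aperiodic [Nonempty T.Var] (hb : T.IsBounded 1) (hap : T.Aperiodic) :
    T.toTwoDFT.Aperiodic := by
  obtain ⟨n, hn, h⟩ := hap.exists_pos
  refine TwoDFT.aperiodic_of_steady _ fun x L hL hx => ?_
  have hx' : ∀ i, (fun i => TapeSym.letter (x i)) (i + L) = TapeSym.letter (x i) := fun i =>
    congrArg _ (hx i)
  refine comp_steady (N := n) hL hx' (stateAnn_aperiodic hn h hL hx) fun α hα hαL => ?_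
  obtain ⟨q, τ, hq, hτ⟩ := exists_states hα
  obtain rfl : α = fun i => some (q i) := funext hq
  have hqL : ∀ i, q (i + L) = q i := fun i => Option.some.inj (hαL i)
  have ht : ∀ i, (fun i => (TapeSym.letter (x i), some (q i))) (i + L) =
      (TapeSym.letter (x i), some (q i)) := fun i => by simp only [hx, hqL]
  refine compRL_steady (N := n) (fun i => ⟨_, _, rfl⟩) hL ht _ _
    (usefulAnn_aperiodic hn h hL hτ hx hqL) fun β hβ hβL => ?_
  have hS : ∀ i, ∃ S, β i = some S := by
    intro i
    have := hβ i
    cases hi : β (i + 1) with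
    | none => rw [hi] at this; simp [usefulAnn] at this
    | some S =>
      rw [hi] at this
      simp only [usefulAnn, hτ, Option.map_some, Option.some.injEq] at this
      exact ⟨_, this.symm⟩
  choose S hS using hS
  obtain rfl : β = fun i => some (S i) := funext hS
  have hS' : ∀ i X Y, Y ∈ S (i + 1) → Occurs τ (i + 1) X Y → X ∈ S i := by
    intro i X Y hY hX
    have := hβ i
    simp only [usefulAnn, hτ, Option.map_some, Option.some.injEq] at this
    rw [← this]
    exact ⟨Y, hY, hX⟩
  have := T.finite_var
  have ht' : ∀ i, (fun i => ((TapeSym.letter (x i), some (q i)), some (S i))) (i + L) =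
      ((TapeSym.letter (x i), some (q i)), some (S i)) := fun i => by
    have h1 := hβL i
    simp only at h1
    simp only [hx, hqL, h1]
  refine follow_steady hL ht' (E := Occurs τ) (S := S) ?_ hS' (fun a b h => followStep_moves hτ h)
    followStep_start (desc_cycle hτ (natAbs_periodic hx) (natAbs_periodic hqL) hb h)
  intro i
  have h1 := hτ (i + L)
  rw [add_right_comm, hqL, hqL, hx, hτ i] at h1
  simp only [Option.some.injEq, Prod.mk.injEq, true_and] at h1
  funext X Y
  simp only [Occurs, h1]

end SST


/-! ## Correctness of the composition on words with endmarkers -/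

section Simulation

variable {Γ : Type*} {Q : Type*} {P : Type*} {B : Type*} {δ : Q → Γ → Option Q}
  {C : TwoWayStep (Γ × Q) B P} {t : ℤ → Option Γ} {α : ℤ → Q}

/-- The tape `t` annotated by `α`. -/
def annotate (t : ℤ → Option Γ) (α : ℤ → Q) : ℤ → Option (Γ × Q) :=
  fun i => (t i).map fun a => (a, α i)

/-- If the annotation can be maintained, then the composition simulates the machine reading the
annotated tape. -/
theorem Run.comp
    (hR : ∀ i a p y p', t i = some a → C p (a, α i) = some (y, p', .right) →
      δ (α i) a = some (α (i + 1)))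
    (hLf : ∀ i a p y p', t i = some a → C p (a, α i) = some (y, p', .left) →
      Landing δ t (i - 1) (α i) (α (i - 1)))
    {c c' : P × ℤ} {y : List B} (h : Run C (annotate t α) c y c') :
    Run (compStep δ C) t (.sim c.1 (α c.2), c.2) y (.sim c'.1 (α c'.2), c'.2) := by
  induction h with
  | refl => exact .refl _
  | @head c c' c'' y y' h _ ih =>
    refine Run.trans ?_ ih
    obtain ⟨⟨a, q⟩, d, h1, h2, h3⟩ := h
    simp only [annotate, Option.map_eq_some_iff, Prod.mk.injEq] at h1
    obtain ⟨a', ha, rfl, rfl⟩ := h1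
    cases d with
    | stay =>
      refine .fires ⟨a', .stay, ha, ?_, h3⟩
      simp only [HeadMove.toInt, add_zero] at h3
      simp [compStep, h2, h3]
    | right =>
      refine .fires ⟨a', .right, ha, ?_, h3⟩
      simp only [HeadMove.toInt] at h3
      simp [compStep, h2, h3, hR _ _ _ _ _ ha h2]
    | left =>
      have h4 : c'.2 = c.2 - 1 := by rw [h3]; rfl
      have h5 := hLf _ _ _ _ _ ha h2
      rw [← h4] at h5
      have h6 : Fires (compStep δ C) t (.sim c.1 (α c.2), c.2) y (.prev c'.1 (α c.2), c'.2) :=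
        ⟨a', .left, ha, by simp [compStep, h2], h3⟩
      simpa using Run.head h6 (h5.run c'.1)

/-- The annotation can be recovered if it is unambiguous in some cell. -/
theorem Landing.of_unambiguous {l k : ℤ} (hlk : l ≤ k)
    (hα : ∀ i, l ≤ i → i ≤ k → ∃ a, t i = some a ∧ δ (α i) a = some (α (i + 1)))
    (hl : ∀ a s s', t l = some a → δ s a = some s' → s = α l) :
    Landing δ t k (α (k + 1)) (α k) := by
  have hrun : ∀ n : ℕ, l + n ≤ k + 1 → annRun δ t (α l) l n = some (α (l + n)) := by
    intro n
    induction n with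
    | zero => intro _; simp [annRun]
    | succ n ih =>
      intro hn
      push_cast at hn
      obtain ⟨a, ha, h⟩ := hα (l + n) (by omega) (by omega)
      rw [annRun_add, ih (by omega), Option.bind_some, annRun_one, ha, Option.bind_some, h]
      push_cast
      rw [add_assoc]
  obtain ⟨m, rfl⟩ : ∃ m : ℕ, k = l + m := ⟨(k - l).toNat, by omega⟩
  refine ⟨m, ?_⟩
  have e : l + m - (m : ℤ) = l := by ring
  ext r
  simp only [Cands, Set.mem_ofPred_eq, Set.mem_singleton_iff, e]
  constructor
  · rintro ⟨⟨s, hs⟩, hr⟩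
    have h1 : annRun δ t s l (m + 1) = some (α (l + m + 1)) := by
      rw [annRun_add, hs, Option.bind_some, hr]
    rw [annRun_succ, Option.bind_eq_some_iff] at h1
    obtain ⟨a, ha, h1⟩ := h1
    rw [Option.bind_eq_some_iff] at h1
    obtain ⟨s', hs', -⟩ := h1
    rw [hl a s s' ha hs', hrun m (by omega), Option.some.injEq] at hs
    exact hs.symm
  · rintro rfl
    refine ⟨⟨α l, hrun m (by omega)⟩, ?_⟩
    obtain ⟨a, ha, h⟩ := hα (l + m) (by omega) le_rfl
    rw [annRun_one, ha, Option.bind_some, h]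

/-- The left-to-right simulation on the reflected tape. The roles of the moves are exchanged: `δ` is
applied on left moves, and the look-back follows right moves. -/
theorem Run.compRL {A R : Type*} {δ : Q → TapeSym A × R → Option Q}
    {C : TwoWayStep ((TapeSym A × R) × Q) B P} {t : ℤ → Option (TapeSym A × R)} {β : ℤ → Q}
    (ι : Q) (p₀ : P)
    (hR : ∀ i a p y p', t i = some a → C p (a, β i) = some (y, p', .right) →
      Landing δ (fun i => t (0 - i)) (-i - 1) (β i) (β (i + 1)))
    (hLf : ∀ i a p y p', t i = some a → C p (a, β i) = some (y, p', .left) →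
      δ (β i) a = some (β (i - 1)))
    {p p' : P} {i i' : ℤ} {y : List B} (h : Run C (annotate t β) (p, i) y (p', i')) :
    Run (compStepRL δ ι C p₀) t (.run (.sim p (β i)), i) y (.run (.sim p' (β i')), i') := by
  have h1 := h.mirror 0
  have h2 : Run (mirrorStep C) (annotate (fun i => t (0 - i)) (fun i => β (0 - i))) (p, 0 - i) y
      (p', 0 - i') := h1
  have h3 := h2.comp (δ := δ) (fun j a p y p' ha hC => ?_) (fun j a p y p' ha hC => ?_)
  · have h4 := (h3.mirror 0).embed ScanState.run (compStepRL_run (δ := δ) (C := C) ι p₀)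
    simpa using h4
  · have := hLf _ _ _ _ _ ha (mirrorStep_eq_some hC)
    rw [this]
    congr 2
    ring
  · have := hR _ _ _ _ _ ha (mirrorStep_eq_some hC)
    rw [show -(0 - j) - 1 = j - 1 by ring, show 0 - j + 1 = 0 - (j - 1) by ring] at this
    exact this

end Simulation

/-! ### Evaluation of an expression by following its occurrences -/

section Traverse

variable {X : Type*} {B : Type*}

/-- The value of an expression for a valuation of the variables. -/
def evalWord (g : X → List B) (y : List (X ⊕ B)) : List B :=
  y.flatMap (Sum.elim g fun b => [b])

theorem evalWord_append (g : X → List B) (y z : List (X ⊕ B)) :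
    evalWord g (y ++ z) = evalWord g y ++ evalWord g z := by simp [evalWord]

theorem evalWord_inr (g : X → List B) (y : List B) : evalWord g (y.map Sum.inr) = y := by
  induction y with
  | nil => rfl
  | cons b y ih =>
    rw [List.map_cons, ← List.singleton_append, evalWord_append, ih]
    simp [evalWord]

theorem evalWord_cons_inl (g : X → List B) (x : X) (y : List (X ⊕ B)) :
    evalWord g (.inl x :: y) = g x ++ evalWord g y := by simp [evalWord]

theorem evalWord_ext (σ : VarSubst X B) (y : List (X ⊕ B)) :
    evalWord (fun x => (σ x).filterMap Sum.getRight?) y = (σ.ext y).filterMap Sum.getRight? := by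
  induction y with
  | nil => rfl
  | cons a y ih =>
    cases a with
    | inl x => rw [VarSubst.ext_cons_inl, evalWord_cons_inl, ih, List.filterMap_append]
    | inr b =>
      rw [VarSubst.ext_cons_inr, ← List.singleton_append, evalWord_append, ih]
      simp [evalWord]

theorem leading_eq_none {w : List (X ⊕ B)} {y : List B} (h : leading w = (y, none)) :
    w = y.map Sum.inr := by
  induction w generalizing y with
  | nil =>
    simp only [leading, Prod.mk.injEq, and_true] at h
    subst h
    rfl
  | cons a w ih =>
    cases a with
    | inl x => simp [leading] at h
    | inr b =>
      simp only [leading, Prod.mk.injEq] at h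
      obtain ⟨rfl, h⟩ := h
      rw [List.map_cons, ← ih (Prod.ext rfl h)]

theorem leading_eq_some {w : List (X ⊕ B)} {y : List B} {x : X} (h : leading w = (y, some x)) :
    ∃ w', w = y.map Sum.inr ++ .inl x :: w' := by
  induction w generalizing y with
  | nil => simp [leading] at h
  | cons a w ih =>
    cases a with
    | inl x =>
      simp only [leading, Prod.mk.injEq, Option.some.injEq] at h
      obtain ⟨rfl, rfl⟩ := h
      exact ⟨w, rfl⟩
    | inr b =>
      simp only [leading, Prod.mk.injEq] at h
      obtain ⟨rfl, h⟩ := h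
      obtain ⟨w', e⟩ := ih (Prod.ext rfl h)
      exact ⟨w', by rw [List.map_cons, List.cons_append, ← e]⟩

theorem afterVar_append {v w : List (X ⊕ B)} {x : X} (h : Sum.inl x ∉ v) :
    afterVar x (v ++ .inl x :: w) = w := by
  induction v with
  | nil => simp [afterVar]
  | cons a v ih =>
    cases a with
    | inl z =>
      have hz : z ≠ x := fun e => h (by simp [e])
      simp only [List.cons_append, afterVar, if_neg hz]
      exact ih fun h' => h (List.mem_cons_of_mem _ h')
    | inr b => exact ih fun h' => h (List.mem_cons_of_mem _ h')

theorem afterVar_of_linear {v w : List (X ⊕ B)} {x : X}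
    (h : varCount x (v ++ .inl x :: w) ≤ 1) : afterVar x (v ++ .inl x :: w) = w := by
  refine afterVar_append fun h' => ?_
  rw [varCount_append] at h
  have h1 := varCount_pos.mpr h'
  have h2 : 0 < varCount x (.inl x :: w) := varCount_pos.mpr (by simp)
  omega

/-- Following the occurrences of variables in an expression produces its value. -/
theorem run_traverse {Γ : Type*} {M : TwoWayStep Γ B (FollowState X)} {t : ℤ → Option Γ} {i : ℤ}
    {F c₀ : FollowState X × ℤ} {w : List (X ⊕ B)} {g : X → List B}
    (hg : ∀ z, Sum.inl z ∈ w → Run M t (.inn z, i - 1) (g z) (.out z, i))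
    (hn : ∀ v z w' y, w = v ++ .inl z :: w' → leading w' = (y, none) → Fires M t (.out z, i) y F)
    (hs : ∀ v z w' y z', w = v ++ .inl z :: w' → leading w' = (y, some z') →
      Fires M t (.out z, i) y (.inn z', i - 1))
    (hn₀ : ∀ y, leading w = (y, none) → Fires M t c₀ y F)
    (hs₀ : ∀ y z, leading w = (y, some z) → Fires M t c₀ y (.inn z, i - 1)) :
    Run M t c₀ (evalWord g w) F := by
  -- Induction on a bound for the length of the unread part, because one step skips all the letters
  -- before the next variable.
  have key : ∀ (n : ℕ) (w' v : List (X ⊕ B)) (z : X), w'.length ≤ n → w = v ++ .inl z :: w' →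
      Run M t (.out z, i) (evalWord g w') F := by
    intro n
    induction n with
    | zero =>
      intro w' v z hl e
      obtain rfl : w' = [] := List.length_eq_zero_iff.mp (by omega)
      exact .fires (hn v z [] [] e rfl)
    | succ n ih =>
      intro w' v z hl e
      rcases hw : leading w' with ⟨y, _ | z'⟩
      · rw [leading_eq_none hw, evalWord_inr]
        exact .fires (hn v z w' y e hw)
      · obtain ⟨w'', e'⟩ := leading_eq_some hw
        have h1 := hs v z w' y z' e hw
        rw [e', evalWord_append, evalWord_inr, evalWord_cons_inl]
        have hmem : Sum.inl z' ∈ w := by rw [e, e']; simp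
        refine .head h1 ((hg z' hmem).trans (ih w'' (v ++ .inl z :: y.map Sum.inr) z' ?_ ?_))
        · rw [e'] at hl
          simp only [List.length_append, List.length_cons] at hl
          omega
        · rw [e, e']; simp
  rcases hw : leading w with ⟨y, _ | z⟩
  · have := hn₀ y hw
    rw [leading_eq_none hw, evalWord_inr]
    exact .fires this
  · obtain ⟨w', e⟩ := leading_eq_some hw
    have hmem : Sum.inl z ∈ w := by rw [e]; simp
    have h2 := (hg z hmem).trans (key _ w' (y.map Sum.inr) z le_rfl e)
    have h3 := Run.head (hs₀ y z hw) h2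
    rwa [e, evalWord_append, evalWord_inr, evalWord_cons_inl]

end Traverse


/-! ## The built transducer follows the output structure -/

section MarkTape

variable {A : Type*}

/-- The word `x` between endmarkers. -/
def markTape (x : List A) : ℤ → Option (TapeSym A) :=
  cellAt (TapeSym.lend :: (x.map TapeSym.letter ++ [TapeSym.rend]))

theorem markTape_zero (x : List A) : markTape x 0 = some .lend := by simp [markTape, cellAt]

theorem markTape_letter {x : List A} {m : ℕ} (hm : m < x.length) :
    markTape x (m + 1) = some (.letter x[m]) := by
  have h : (0 : ℤ) ≤ m + 1 := by omega
  simp [markTape, cellAt, if_pos h, List.getElem?_append, hm]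

theorem markTape_rend (x : List A) : markTape x (x.length + 1) = some .rend := by
  have h : (0 : ℤ) ≤ x.length + 1 := by omega
  simp [markTape, cellAt, if_pos h]

theorem markTape_eq_some {x : List A} {i : ℤ} {a : TapeSym A} (h : markTape x i = some a) :
    (i = 0 ∧ a = .lend) ∨ (∃ (m : ℕ) (hm : m < x.length), i = m + 1 ∧ a = .letter x[m]) ∨
      (i = x.length + 1 ∧ a = .rend) := by
  have h0 : 0 ≤ i := by
    by_contra h0
    simp [markTape, cellAt, h0] at h
  obtain ⟨_ | m, rfl⟩ := Int.eq_ofNat_of_zero_le h0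
  · rw [Nat.cast_zero, markTape_zero, Option.some.injEq] at h
    exact .inl ⟨rfl, h.symm⟩
  · push_cast at h ⊢
    rcases lt_trichotomy m x.length with hm | rfl | hm
    · rw [markTape_letter hm, Option.some.injEq] at h
      exact .inr (.inl ⟨m, hm, rfl, h.symm⟩)
    · rw [markTape_rend, Option.some.injEq] at h
      exact .inr (.inr ⟨rfl, h.symm⟩)
    · have h1 : (TapeSym.lend :: (x.map TapeSym.letter ++ [TapeSym.rend])).length ≤ m + 1 := by
        simp only [List.length_cons, List.length_append, List.length_map, List.length_nil]
        omega
      have h2 : (0 : ℤ) ≤ m + 1 := by omega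
      rw [markTape, cellAt, if_pos h2, show ((m : ℤ) + 1).toNat = m + 1 by omega,
        List.getElem?_eq_none h1] at h
      cases h

end MarkTape

/-! ### Accepting runs and the output of the third machine -/

namespace SST

variable {A : Type u} {B : Type v}

/-- An accepting run over `x` with its intermediate states, the updates in each step, and the
substitutions induced by its prefixes and suffixes. -/
structure Trace (T : SST.{u, v, w} A B) (x : List A) where
  state : ℕ → T.State
  update : ℕ → VarSubst T.Var B
  pre : ℕ → VarSubst T.Var B
  suf : ℕ → VarSubst T.Var B
  f : List (T.Var ⊕ B)
  run_take : ∀ m, T.run T.init (x.take m) = some (state m, pre m)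
  run_drop : ∀ m, T.run (state m) (x.drop m) = some (state x.length, suf m)
  step : ∀ m (hm : m < x.length), T.step (state m) x[m] = some (state (m + 1), update m)
  pre_succ : ∀ m < x.length, pre (m + 1) = VarSubst.comp (pre m) (update m)
  suf_eq : ∀ m < x.length, suf m = VarSubst.comp (update m) (suf (m + 1))
  out : T.out (state x.length) = some f

variable {T : SST.{u, v, w} A B} {x : List A}

theorem run_singleton (p : T.State) (a : A) : T.run p [a] = T.step p a := by
  simp only [run, Option.map_some]
  cases T.step p a with
  | none => rfl
  | some s => simp [VarSubst.comp_one]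

theorem exists_trace {q : T.State} {σ : VarSubst T.Var B} {f : List (T.Var ⊕ B)}
    (h : T.run T.init x = some (q, σ)) (hf : T.out q = some f) :
    ∃ D : T.Trace x, D.pre x.length = σ ∧ D.f = f := by
  have hs : ∀ m, ∃ p π υ, T.run T.init (x.take m) = some (p, π) ∧
      T.run p (x.drop m) = some (q, υ) := by
    intro m
    rw [← List.take_append_drop m x, run_append, Option.bind_eq_some_iff] at h
    obtain ⟨⟨p, π⟩, h1, h⟩ := h
    rw [Option.map_eq_some_iff] at h
    obtain ⟨⟨q', υ⟩, h2, h3⟩ := h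
    simp only [Prod.mk.injEq] at h3
    obtain ⟨rfl, -⟩ := h3
    exact ⟨p, π, υ, h1, h2⟩
  choose st π υ ht hd using hs
  have hl := ht x.length
  rw [List.take_length, h, Option.some.injEq, Prod.mk.injEq] at hl
  have hstep : ∀ m, ∃ τ, ∀ hm : m < x.length, T.step (st m) x[m] = some (st (m + 1), τ) ∧
      π (m + 1) = VarSubst.comp (π m) τ ∧ υ m = VarSubst.comp τ (υ (m + 1)) := by
    intro m
    by_cases hm : m < x.length
    · have h1 := ht (m + 1)
      rw [List.take_succ_eq_append_getElem hm, run_append, ht m, Option.bind_some, run_singleton,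
        Option.map_eq_some_iff] at h1
      obtain ⟨⟨p, τ⟩, h1, h2⟩ := h1
      simp only [Prod.mk.injEq] at h2
      obtain ⟨rfl, h2⟩ := h2
      have h3 := hd m
      rw [List.drop_eq_getElem_cons hm] at h3
      simp only [run, h1, Option.bind_some, hd (m + 1), Option.map_some, Option.some.injEq,
        Prod.mk.injEq, true_and] at h3
      exact ⟨τ, fun _ => ⟨h1, h2.symm, h3.symm⟩⟩
    · exact ⟨VarSubst.one, fun h => absurd h hm⟩
  choose τ hτ using hstep
  exact ⟨⟨st, τ, π, υ, f, ht, fun m => by rw [hd m, hl.1], fun m hm => (hτ m hm).1,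
    fun m hm => (hτ m hm).2.1, fun m hm => (hτ m hm).2.2, by rw [← hl.1, hf]⟩, hl.2.symm, rfl⟩

namespace Trace

variable (D : T.Trace x)

theorem pre_zero : D.pre 0 = VarSubst.one := by
  have := D.run_take 0
  simp only [List.take_zero, run, Option.some.injEq, Prod.mk.injEq] at this
  exact this.2.symm

theorem state_zero : D.state 0 = T.init := by
  have := D.run_take 0
  simp only [List.take_zero, run, Option.some.injEq, Prod.mk.injEq] at this
  exact this.1.symm

theorem suf_length : D.suf x.length = VarSubst.one := by
  have := D.run_drop x.length
  simp only [List.drop_length, run, Option.some.injEq, Prod.mk.injEq] at this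
  exact this.2.symm

/-- The annotation of the cells with states. -/
def stateAt (i : ℤ) : Option T.State := if i ≤ 0 then none else some (D.state (i - 1).toNat)

/-- The variables that are useful after `m` letters. -/
def useful (m : ℕ) : Set T.Var := {X | Sum.inl X ∈ (D.suf m).ext D.f}

/-- The annotation of the cells with useful variables. -/
def usefulAt (i : ℤ) : Option (Set T.Var) :=
  if i ≤ x.length then some (D.useful i.toNat) else none

theorem stateAt_zero : D.stateAt 0 = none := by simp [stateAt]

theorem stateAt_succ (m : ℕ) : D.stateAt (m + 1) = some (D.state m) := by
  have h : ¬ (m : ℤ) + 1 ≤ 0 := by omega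
  simp [stateAt, h]

theorem usefulAt_nat {m : ℕ} (hm : m ≤ x.length) : D.usefulAt m = some (D.useful m) := by
  simp [usefulAt, hm]

theorem usefulAt_end : D.usefulAt (x.length + 1) = none := by
  simp [usefulAt]

theorem stateAnn_stateAt {i : ℤ} {a : TapeSym A} (ha : markTape x i = some a)
    (hi : i ≤ x.length) : T.stateAnn (D.stateAt i) a = some (D.stateAt (i + 1)) := by
  rcases markTape_eq_some ha with ⟨rfl, rfl⟩ | ⟨m, hm, rfl, rfl⟩ | ⟨rfl, rfl⟩
  · have := D.stateAt_succ 0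
    simp only [Nat.cast_zero] at this
    rw [stateAt_zero, this, state_zero]
    rfl
  · have := D.stateAt_succ (m + 1)
    push_cast at this
    rw [stateAt_succ, this]
    simp [stateAnn, D.step m hm]
  · omega

theorem useful_eq {m : ℕ} (hm : m < x.length) :
    {X | ∃ Y ∈ D.useful (m + 1), Sum.inl X ∈ D.update m Y} = D.useful m := by
  ext X
  rw [useful, useful, D.suf_eq m hm, Set.mem_ofPred_eq, Set.mem_ofPred_eq, VarSubst.ext_comp,
    VarSubst.mem_ext]
  rfl

theorem useful_length : D.useful x.length = {X | Sum.inl X ∈ D.f} := by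
  rw [useful, suf_length]
  simp only [VarSubst.ext_one]

theorem usefulAnn_usefulAt {i : ℤ} {a : TapeSym A} (ha : markTape x i = some a)
    (hi : 0 < i) : T.usefulAnn (D.usefulAt i) (a, D.stateAt i) = some (D.usefulAt (i - 1)) := by
  rcases markTape_eq_some ha with ⟨rfl, rfl⟩ | ⟨m, hm, rfl, rfl⟩ | ⟨rfl, rfl⟩
  · omega
  · have := D.usefulAt_nat hm
    push_cast at this
    rw [stateAt_succ, this, add_sub_cancel_right, D.usefulAt_nat hm.le, ← D.useful_eq hm]
    simp only [usefulAnn, D.step m hm, Option.map_some]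
  · rw [stateAt_succ, usefulAt_end, add_sub_cancel_right, D.usefulAt_nat le_rfl, useful_length]
    simp only [usefulAnn, D.out, Option.map_some]

theorem varCount_update (hb : T.IsBounded 1) {m : ℕ} (hm : m < x.length) (X Y : T.Var) :
    varCount X (D.update m Y) ≤ 1 :=
  hb (D.state m) [x[m]] _ _ (by rw [run_singleton, D.step m hm]) X Y

theorem varCount_suf (hl : T.OutputLinear) (m : ℕ) (X : T.Var) :
    varCount X ((D.suf m).ext D.f) ≤ 1 :=
  hl _ _ _ _ _ _ _ (D.run_take m) (D.run_drop m) D.out X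

theorem varCount_out (hl : T.OutputLinear) (X : T.Var) : varCount X D.f ≤ 1 := by
  have := D.varCount_suf hl x.length X
  rwa [suf_length, VarSubst.ext_one] at this

/-- Two distinct useful parents would bring `Z` twice into the final output expression, against
linearity. -/
theorem eq_of_useful (hl : T.OutputLinear) {m : ℕ} (hm : m < x.length) {X Y Z : T.Var}
    (hX : X ∈ D.useful (m + 1)) (hY : Y ∈ D.useful (m + 1)) (hZX : Sum.inl Z ∈ D.update m X)
    (hZY : Sum.inl Z ∈ D.update m Y) : X = Y := by
  by_contra hne
  have h1 := VarSubst.two_le_varCount hne hX hY hZX hZY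
  have h2 := D.varCount_suf hl m Z
  rw [D.suf_eq m hm, VarSubst.ext_comp] at h2
  omega

/-- The tape with both annotations. -/
def tape : ℤ → Option ((TapeSym A × Option T.State) × Option (Set T.Var)) :=
  annotate (annotate (markTape x) D.stateAt) D.usefulAt

theorem tape_zero : D.tape 0 = some ((.lend, none), some (D.useful 0)) := by
  have := D.usefulAt_nat (Nat.zero_le _)
  simp only [Nat.cast_zero] at this
  simp [tape, annotate, markTape_zero, stateAt_zero, this]

theorem tape_letter {m : ℕ} (hm : m < x.length) :
    D.tape (m + 1) = some ((.letter x[m], some (D.state m)), some (D.useful (m + 1))) := by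
  have := D.usefulAt_nat hm
  push_cast at this
  simp [tape, annotate, markTape_letter hm, stateAt_succ, this]

theorem tape_rend : D.tape (x.length + 1) =
    some ((.rend, some (D.state x.length)), none) := by
  simp [tape, annotate, markTape_rend, stateAt_succ, usefulAt_end]

/-- The letters in the value of a variable after `m` letters. -/
def value (m : ℕ) (X : T.Var) : List B := (D.pre m X).filterMap Sum.getRight?

theorem value_succ {m : ℕ} (hm : m < x.length) (X : T.Var) :
    D.value (m + 1) X = evalWord (D.value m) (D.update m X) := by
  rw [value, D.pre_succ m hm]
  exact (evalWord_ext _ _).symm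

/-- In `(X, i)`, the third machine produces the value of `X` and comes back in `(X, o)`. -/
theorem run_inn (hb : T.IsBounded 1) (hl : T.OutputLinear) {m : ℕ} (hm : m ≤ x.length)
    {X : T.Var} (hX : X ∈ D.useful m) :
    Run T.followStep D.tape (.inn X, m) (D.value m X) (.out X, m + 1) := by
  induction m generalizing X with
  | zero =>
    have h : D.value 0 X = [] := by rw [value, pre_zero]; rfl
    rw [h]
    exact .fires ⟨_, .right, D.tape_zero, rfl, rfl⟩
  | succ m ih =>
    have hm' : m < x.length := hm
    have htape := D.tape_letter hm'
    rw [D.value_succ hm']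
    push_cast
    -- The machine resumes at the right place: linearity of the output makes `X` the only useful
    -- parent of `z`, and 1-boundedness makes the first occurrence of `z` in the update of `X` the
    -- only one.
    have hout : ∀ v z w', D.update m X = v ++ .inl z :: w' →
        T.followStep (.out z) ((.letter x[m], some (D.state m)), some (D.useful (m + 1))) =
          match leading w' with
          | (y, none) => some (y, .out X, .right)
          | (y, some X') => some (y, .inn X', .left) := by
      intro v z w' e
      have hz : Sum.inl z ∈ D.update m X := by rw [e]; simp
      have hY : ∃! Y, Y ∈ D.useful (m + 1) ∧ Sum.inl z ∈ D.update m Y :=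
        ⟨X, ⟨hX, hz⟩, fun Y ⟨hY, hzY⟩ => D.eq_of_useful hl hm' hY hX hzY hz⟩
      have hc : hY.choose = X :=
        D.eq_of_useful hl hm' hY.choose_spec.1.1 hX hY.choose_spec.1.2 hz
      have haft : afterVar z (D.update m X) = w' := by
        have := D.varCount_update hb hm' z X
        rw [e] at this ⊢
        exact afterVar_of_linear this
      rcases hw : leading w' with ⟨y, _ | X'⟩ <;>
        simp only [followStep, D.step m hm', Option.bind_some, dif_pos hY, hc, haft, hw]
    refine run_traverse (i := (m : ℤ) + 1) (fun z hz => ?_) (fun v z w' y e hw => ?_)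
      (fun v z w' y z' e hw => ?_) (fun y hw => ?_) (fun y z hw => ?_)
    · rw [add_sub_cancel_right]
      refine ih hm'.le ?_
      rw [← D.useful_eq hm']
      exact ⟨X, hX, hz⟩
    · exact ⟨_, .right, htape, by rw [hout v z w' e, hw], rfl⟩
    · exact ⟨_, .left, htape, by rw [hout v z w' e, hw], rfl⟩
    · exact ⟨_, .right, htape, by simp only [followStep, D.step m hm', Option.map_some, hw], rfl⟩
    · exact ⟨_, .left, htape, by simp only [followStep, D.step m hm', Option.map_some, hw], rfl⟩

theorem run_start {m : ℕ} (hm : m ≤ x.length) :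
    Run T.followStep D.tape (.start, 0) [] (.start, m + 1) := by
  induction m with
  | zero => exact .fires ⟨_, .right, D.tape_zero, rfl, rfl⟩
  | succ m ih =>
    have h : Fires T.followStep D.tape (.start, m + 1) [] (.start, m + 1 + 1) :=
      ⟨_, .right, D.tape_letter hm, rfl, rfl⟩
    push_cast
    exact (ih (by omega)).trans (.fires h)

/-- The third machine produces the output of the transducer. -/
theorem run_followStep (hb : T.IsBounded 1) (hl : T.OutputLinear) :
    Run T.followStep D.tape (.start, 0)
      (((D.pre x.length).ext D.f).filterMap Sum.getRight?) (.fin, x.length + 1) := by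
  have htape := D.tape_rend
  have hout : ∀ v z w', D.f = v ++ .inl z :: w' →
      T.followStep (.out z) ((.rend, some (D.state x.length)), none) =
        match leading w' with
        | (y, none) => some (y, .fin, .stay)
        | (y, some X') => some (y, .inn X', .left) := by
    intro v z w' e
    have hz : Sum.inl z ∈ D.f := by rw [e]; simp
    have haft : afterVar z D.f = w' := by
      have := D.varCount_out hl z
      rw [e] at this ⊢
      exact afterVar_of_linear this
    rcases hw : leading w' with ⟨y, _ | X'⟩ <;>
      simp only [followStep, D.out, Option.bind_some, if_pos hz, haft, hw]
  have h : Run T.followStep D.tape (.start, (x.length : ℤ) + 1)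
      (evalWord (D.value x.length) D.f) (.fin, x.length + 1) := by
    refine run_traverse (i := (x.length : ℤ) + 1) (fun z hz => ?_) (fun v z w' y e hw => ?_)
      (fun v z w' y z' e hw => ?_) (fun y hw => ?_) (fun y z hw => ?_)
    · rw [add_sub_cancel_right]
      refine D.run_inn hb hl le_rfl ?_
      rw [useful_length]
      exact hz
    · exact ⟨_, .stay, htape, by rw [hout v z w' e, hw], (add_zero _).symm⟩
    · exact ⟨_, .left, htape, by rw [hout v z w' e, hw], rfl⟩
    · exact ⟨_, .stay, htape, by simp only [followStep, D.out, Option.map_some, hw],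
        (add_zero _).symm⟩
    · exact ⟨_, .left, htape, by simp only [followStep, D.out, Option.map_some, hw], rfl⟩
  rw [← evalWord_ext]
  exact (D.run_start le_rfl).trans h

end Trace

end SST


/-! ## Correctness of the built transducer -/

theorem exists_markTape {A : Type*} {x : List A} {i : ℤ} (h0 : 0 ≤ i) (h1 : i ≤ x.length + 1) :
    ∃ a, markTape x i = some a := by
  obtain ⟨_ | m, rfl⟩ := Int.eq_ofNat_of_zero_le h0
  · exact ⟨_, markTape_zero x⟩
  · push_cast at h1 ⊢
    rcases (show m ≤ x.length by omega).lt_or_eq with hm | rfl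
    · exact ⟨_, markTape_letter hm⟩
    · exact ⟨_, markTape_rend x⟩

namespace SST

variable {A : Type u} {B : Type v} {T : SST.{u, v, w} A B} {x : List A}

namespace Trace

variable (D : T.Trace x)

/-- Only `none` can read `⊣`, so looking as far as `⊣` leaves a single candidate. -/
theorem landing_usefulAt {i : ℤ} (h0 : 0 ≤ i) (h1 : i ≤ x.length) :
    Landing T.usefulAnn (fun i => annotate (markTape x) D.stateAt (0 - i)) (-i - 1)
      (D.usefulAt i) (D.usefulAt (i + 1)) := by
  have h := Landing.of_unambiguous (δ := T.usefulAnn)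
    (t := fun i => annotate (markTape x) D.stateAt (0 - i)) (α := fun i => D.usefulAt (0 - i))
    (l := -(x.length + 1)) (k := -i - 1) (by omega) (fun j hj hj' => ?_) (fun a s s' ha hs => ?_)
  · rwa [show 0 - (-i - 1 + 1) = i by ring, show 0 - (-i - 1) = i + 1 by ring] at h
  · obtain ⟨a, ha⟩ := exists_markTape (x := x) (i := 0 - j) (by omega) (by omega)
    refine ⟨(a, D.stateAt (0 - j)), by simp only [annotate, ha, Option.map_some], ?_⟩
    rw [D.usefulAnn_usefulAt ha (by omega)]
    congr 2
    ring
  · have e : 0 - -((x.length : ℤ) + 1) = x.length + 1 := by ring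
    simp only [e] at ha ⊢
    simp only [annotate, markTape_rend, Option.map_some, Option.some.injEq] at ha
    subst ha
    rw [usefulAt_end]
    cases s with
    | none => rfl
    | some S => simp [usefulAnn] at hs

/-- Only `none` can read `⊢`, so looking as far as `⊢` leaves a single candidate. -/
theorem landing_stateAt {i : ℤ} (h0 : 0 < i) (h1 : i ≤ x.length + 1) :
    Landing T.stateAnn (markTape x) (i - 1) (D.stateAt i) (D.stateAt (i - 1)) := by
  have h := Landing.of_unambiguous (δ := T.stateAnn) (t := markTape x) (α := D.stateAt)
    (l := 0) (k := i - 1) (by omega) (fun j hj hj' => ?_) (fun a s s' ha hs => ?_)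
  · rwa [sub_add_cancel] at h
  · obtain ⟨a, ha⟩ := exists_markTape (x := x) hj (by omega)
    exact ⟨a, ha, D.stateAnn_stateAt ha (by omega)⟩
  · rw [markTape_zero, Option.some.injEq] at ha
    subst ha
    rw [stateAt_zero]
    cases s with
    | none => rfl
    | some S => simp [stateAnn] at hs

theorem run_toStart {m : ℕ} (hm : m ≤ x.length + 1) :
    Run T.midStep (annotate (markTape x) D.stateAt) (.toStart (D.usefulAt m), m) []
      (.toStart (D.usefulAt 0), 0) := by
  induction m with
  | zero => exact .refl _
  | succ m ih =>
    refine Run.head (y := []) ?_ (ih (by omega))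
    obtain ⟨a, ha⟩ := exists_markTape (x := x) (i := (m + 1 : ℕ)) (by omega) (by omega)
    have h := D.usefulAnn_usefulAt ha (by omega)
    rw [show ((m + 1 : ℕ) : ℤ) - 1 = m by push_cast; ring] at h
    refine ⟨(a, D.stateAt (m + 1 : ℕ)), .left, by simp only [annotate, ha, Option.map_some], ?_,
      by simp [HeadMove.toInt]⟩
    rcases markTape_eq_some ha with ⟨h', -⟩ | ⟨_, _, _, rfl⟩ | ⟨_, rfl⟩
    · omega
    · simp only [midStep, compStepRL, h, Option.map_some]
    · simp only [midStep, compStepRL, h, Option.map_some]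

theorem run_midStep (hb : T.IsBounded 1) (hl : T.OutputLinear) :
    Run T.midStep (annotate (markTape x) D.stateAt) (.toStart none, x.length + 1)
      (((D.pre x.length).ext D.f).filterMap Sum.getRight?)
      (.run (.sim .fin none), x.length + 1) := by
  have h1 := D.run_toStart le_rfl
  push_cast at h1
  rw [usefulAt_end] at h1
  have h2 : Fires T.midStep (annotate (markTape x) D.stateAt) (.toStart (D.usefulAt 0), 0) []
      (.run (.sim .start (D.usefulAt 0)), 0) :=
    ⟨(.lend, D.stateAt 0), .stay, by simp only [annotate, markTape_zero, Option.map_some], rfl, rfl⟩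
  have h3 := (D.run_followStep hb hl).compRL (δ := T.usefulAnn) none .start
    (fun i a p y p' ha hC => ?_) (fun i a p y p' ha hC => ?_)
  · rw [usefulAt_end] at h3
    exact h1.trans (.head h2 h3)
  · simp only [annotate, Option.map_eq_some_iff] at ha
    obtain ⟨a, ha, rfl⟩ := ha
    rcases markTape_eq_some ha with ⟨rfl, -⟩ | ⟨m, hm, rfl, -⟩ | ⟨-, rfl⟩
    · exact D.landing_usefulAt le_rfl (by omega)
    · exact D.landing_usefulAt (by omega) (by omega)
    · exact absurd hC (T.followStep_no_right _ _ _ _ _)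
  · simp only [annotate, Option.map_eq_some_iff] at ha
    obtain ⟨a, ha, rfl⟩ := ha
    refine D.usefulAnn_usefulAt ha ?_
    rcases markTape_eq_some ha with ⟨-, rfl⟩ | ⟨m, hm, rfl, -⟩ | ⟨rfl, -⟩
    · exact absurd hC (T.followStep_no_left _ _ _ _ _)
    · omega
    · omega

theorem run_builtStep (hb : T.IsBounded 1) (hl : T.OutputLinear) :
    Run T.builtStep (markTape x) (.sim (.toStart none) (some (D.state x.length)), x.length + 1)
      (((D.pre x.length).ext D.f).filterMap Sum.getRight?)
      (.sim (.run (.sim .fin none)) (some (D.state x.length)), x.length + 1) := by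
  have h := (D.run_midStep hb hl).comp (δ := T.stateAnn)
    (fun i a p y p' ha hC => ?_) (fun i a p y p' ha hC => ?_)
  · simp only [stateAt_succ] at h
    exact h
  · refine D.stateAnn_stateAt ha ?_
    rcases markTape_eq_some ha with ⟨rfl, -⟩ | ⟨m, hm, rfl, -⟩ | ⟨-, rfl⟩
    · omega
    · omega
    · exact absurd hC (T.midStep_no_right _ _ _ _)
  · rcases markTape_eq_some ha with ⟨-, rfl⟩ | ⟨m, hm, rfl, -⟩ | ⟨rfl, -⟩
    · exact absurd hC (T.midStep_no_left _ _ _ _)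
    · exact D.landing_stateAt (by omega) (by omega)
    · exact D.landing_stateAt (by omega) (by omega)

end Trace

/-- The initial sweep to the right end simulates the transducer. -/
theorem run_toEnd {m : ℕ} (hm : m ≤ x.length) {q : T.State} {σ : VarSubst T.Var B}
    (h : T.run T.init (x.take m) = some (q, σ)) :
    Run T.builtStep (markTape x) (.sim .toEnd none, 0) [] (.sim .toEnd (some q), m + 1) := by
  induction m generalizing q σ with
  | zero =>
    simp only [List.take_zero, run, Option.some.injEq, Prod.mk.injEq] at h
    obtain ⟨rfl, -⟩ := h
    exact .fires ⟨_, .right, markTape_zero x, rfl, rfl⟩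
  | succ m ih =>
    have hm' : m < x.length := hm
    rw [List.take_succ_eq_append_getElem hm', run_append, Option.bind_eq_some_iff] at h
    obtain ⟨⟨p, π⟩, h1, h2⟩ := h
    rw [run_singleton, Option.map_eq_some_iff] at h2
    obtain ⟨⟨q', τ⟩, h2, h3⟩ := h2
    simp only [Prod.mk.injEq] at h3
    obtain ⟨rfl, -⟩ := h3
    push_cast
    refine (ih hm'.le h1).trans (.fires ⟨_, .right, markTape_letter hm', ?_, rfl⟩)
    simp only at h2
    simp [builtStep, compStep, midStep, compStepRL, stateAnn, h2]

/-- Final states being stuck, an accepting run and its output are unique, and acceptance happens at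
the first visit. -/
theorem builtStep_final {c : T.BuiltState} (hc : c ∈ T.toTwoDFT.final) (a : TapeSym A) :
    T.builtStep c a = none := by
  obtain ⟨s, q, rfl⟩ := hc
  rcases a with _ | a | _ <;>
    simp [builtStep, compStep, midStep, compStepRL, mirrorStep, followStep]

/-- If `T` has no run on `x`, then its simulation gets stuck in the initial sweep. -/
theorem exists_stuck_toEnd (h : T.run T.init x = none) :
    ∃ q i, Run T.builtStep (markTape x) (.sim .toEnd none, 0) [] (.sim .toEnd q, i) ∧
      ∀ d, ¬ Moves T.builtStep (markTape x) (.sim .toEnd q, i) d := by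
  have key : ∃ m q σ, ∃ hm : m < x.length, T.run T.init (x.take m) = some (q, σ) ∧
      T.step q x[m] = none := by
    by_contra! hk
    have : ∀ m ≤ x.length, (T.run T.init (x.take m)).isSome := by
      intro m hm
      induction m with
      | zero => simp [run]
      | succ m ih =>
        obtain ⟨⟨q, σ⟩, h1⟩ := Option.isSome_iff_exists.mp (ih (by omega))
        obtain ⟨s, hs⟩ := Option.ne_none_iff_exists'.mp (hk m q σ hm h1)
        rw [List.take_succ_eq_append_getElem hm, run_append, h1, Option.bind_some, run_singleton,
          hs]
        rfl
    simpa [h] using this x.length le_rfl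
  obtain ⟨m, q, σ, hm, h1, h2⟩ := key
  refine ⟨some q, m + 1, run_toEnd hm.le h1, ?_⟩
  rintro d ⟨y, a, e, ha, hs, -⟩
  simp only [markTape_letter hm, Option.some.injEq] at ha
  subst ha
  simp [builtStep, compStep, midStep, compStepRL, stateAnn, h2] at hs

theorem toTwoDFT_realizes_iff (hb : T.IsBounded 1) (hl : T.OutputLinear) (x : List A)
    (y : List B) : T.toTwoDFT.Realizes x y ↔ T.Realizes x y := by
  have hfin : ∀ (c : T.BuiltState × ℤ), c.1 ∈ T.toTwoDFT.final →
      ∀ d, ¬ Moves T.builtStep (markTape x) c d := by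
    rintro c hc d ⟨y, a, e, -, hs, -⟩
    rw [builtStep_final hc] at hs
    cases hs
  have hend : ∀ {q σ}, T.run T.init x = some (q, σ) → Run T.builtStep (markTape x)
      (.sim .toEnd none, 0) [] (.sim (.toStart none) (some q), x.length + 1) := by
    intro q σ h
    have h1 := run_toEnd (x := x) le_rfl (q := q) (σ := σ) (by rw [List.take_length, h])
    refine h1.trans (.fires ⟨_, .stay, markTape_rend x, ?_, (add_zero _).symm⟩)
    simp [builtStep, compStep, midStep, compStepRL]
  have hrun : ∀ {q σ f}, T.run T.init x = some (q, σ) → T.out q = some f →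
      ∃ p ∈ T.toTwoDFT.final, Run T.builtStep (markTape x) (.sim .toEnd none, 0)
        ((VarSubst.ext σ f).filterMap Sum.getRight?) (p, x.length + 1) := by
    intro q σ f h hf
    obtain ⟨D, rfl, rfl⟩ := exists_trace h hf
    have hq := D.run_take x.length
    rw [List.take_length, h, Option.some.injEq, Prod.mk.injEq] at hq
    exact ⟨_, ⟨_, _, rfl⟩, (hend (hq.1 ▸ h)).trans (D.run_builtStep hb hl)⟩
  constructor
  · rintro ⟨p, hp, h⟩
    have h : Run T.builtStep (markTape x) (.sim .toEnd none, 0) y (p, x.length + 1) := h.run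
    rcases hr : T.run T.init x with _ | ⟨q, σ⟩
    · obtain ⟨q, i, h1, h2⟩ := exists_stuck_toEnd hr
      have := (h.eq_of_stuck h1 (hfin _ hp) h2).2
      obtain ⟨s, q', rfl⟩ := hp
      simp at this
    rcases hf : T.out q with _ | f
    -- If the output is undefined, the sweep that computes the useful variables is blocked on `⊣` at
    -- its first step, in a state that is not final.
    · have := (h.eq_of_stuck (hend hr) (hfin _ hp) ?_).2
      · obtain ⟨s, q', rfl⟩ := hp
        simp at this
      · rintro d ⟨y, a, e, ha, hs, -⟩
        simp only [markTape_rend, Option.some.injEq] at ha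
        subst ha
        simp [builtStep, compStep, midStep, compStepRL, usefulAnn, hf] at hs
    obtain ⟨p', hp', h'⟩ := hrun hr hf
    exact ⟨q, σ, f, hr, T.out_final _ _ hf, hf, (h.eq_of_stuck h' (hfin _ hp) (hfin _ hp')).1⟩
  · rintro ⟨q, σ, f, h, -, hf, rfl⟩
    obtain ⟨p, hp, hr⟩ := hrun h hf
    exact ⟨p, hp, hr.twoWayRun fun c d hc => hfin c hc.1 d⟩

end SST

theorem mainTheorem7 {A B : Type*} [Finite A] [Finite B] (T : SST A B) [Nonempty T.Var]
    (hbounded : T.IsBounded 1) (haperiodic : T.Aperiodic) :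
    T.toTwoDFT.Aperiodic ∧
      (T.OutputLinear → ∀ x y, T.toTwoDFT.Realizes x y ↔ T.Realizes x y) := by
  exact ⟨SST.toTwoDFT_aperiodic hbounded haperiodic,
    fun hl => SST.toTwoDFT_realizes_iff hbounded hl⟩
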